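/- **Setting.** Let $G$ be a finite discounted stochastic game with players $I$, states $S$, action sets $A^i$, $A=\prod_i A^i$, stage rewards $r^i_s(a)$, transition probabilities $P_s(a)\in\Delta(S)$ and discount factor $\delta\in(0,1)$. Let $X=\prod_i\Delta(A^i)$. Functions of pure action profiles are extended multilinearly to $X$. For each $i$ let $h^i:X\to\mathbb R$ be a continuous regularizer that is strictly concave in $x^i$, is $C^1$ on the relative interior of $X$, and satisfies $\|\nabla_{x^i}h^i(x)\|\to\infty$ as $x^i$ approaches the boundary of $\Delta(A^i)$ (uniformly in $x^{-i}$; gradient along the simplex). Let $\varepsilon>0$. **Equilibria.** For $\lambda>0$, $\kappa\ge 0$, a stationary profile $x\in X^S$ is a $\kappa$-regularized stationary equilibrium with parameter $\lambda$ if, in the discounted game with stage payoffs $r^i_s+\lambda h^i$ (total payoff $\mathbb E\sum_{k\ge0}\delta^k(r^i_{s_k}+\lambda h^i)(x_k)$, where $x_k$ is the mixed profile used at stage $k$), no player can gain more than $\kappa$ by a behavioral deviation, from any initial state. For $\kappa=0$ it is called a regularized stationary Nash equilibrium. **Dynamics (MBRD).** Let $\alpha_->0$ and $\beta:[0,\infty)\to[0,\infty)$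 be nonincreasing with $\int_0^\infty\beta_t\,dt=+\infty$ (H2). A solution consists of locally absolutely continuous functions $x_s(t)\in X$, $u^i_s(t)\in\mathbb R$, $\hat P_s(a)(t)\in\Delta(S)$, $\hat r^i_s(a)(t)\in\mathbb R$ on $[0,\infty)$ such that for almost every $t$ there are $\alpha_s\in[\alpha_-,1]$, $s\in S$, with $$\dot u^i_s=\beta_t\big(\hat f^i_s(x_s)+\varepsilon h^i(x_s)-u^i_s\big),\qquad \dot x^i_s=\alpha_s\,(b^i_s-x^i_s),$$ $$\dot{\hat P}_s(a)=\alpha_s\,b_s(a)\,\big(P_s(a)-\hat P_s(a)\big),\qquad \dot{\hat r}^i_s(a)=\alpha_s\,b_s(a)\,\big(r^i_s(a)-\hat r^i_s(a)\big),$$ where $\hat f^i_s(a)=(1-\delta)\hat r^i_s(a)+\delta\sum_{s'}\hat P_s(a)(s')\,u^i_{s'}$, $b^i_s=\arg\max_{y\in\Delta(A^i)}\hat f^i_s(y,x^{-i}_s)+\varepsilon h^i(y,x_s^{-i})$ and $b_s(a)=\prod_i b^i_s(a^i)$. **Theorem.** Put $\lambda=\varepsilon/(1-\delta)$. 1. (Identical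 interest.) If $r^i=r^j$ and $h^i=h^j$ for all $i,j$, then for every solution of MBRD in which all players have the same initial values $u^i(0)$ and $\hat r^i(0)$, the profile $x(t)$ converges to the set of regularized stationary Nash equilibria with parameter $\lambda$ (the distance to this set tends to $0$). 2. (Zero sum.) If there are two players, $r^1=-r^2$ and $h^1=-h^2$, then there is a constant $D>0$ depending only on the regularized game $(G,h,\varepsilon)$ such that for all $\alpha_-$, all $\beta$ satisfying (H2), every solution of MBRD and every $\bar\beta\ge\limsup_{t\to\infty}\beta_t$, the profile $x(t)$ converges to the set of $\frac{D}{\alpha_-}\bar\beta$-regularized stationary equilibria with parameter $\lambda$. In particular, if $\beta_t\to0$, then $x(t)$ converges to the set of regularized stationary Nash equilibria with parameter $\lambda$. -/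

import Mathlib

open Filter Topology MeasureTheory Set

noncomputable section

/-- A finite discounted stochastic game with states `S`, players `I` and action sets `A i`:
stage rewards `r^i_s(a)`, transition probabilities `P_s(a) ∈ Δ(S)` and a discount factor in
`(0, 1)`. -/
structure StochasticGame (S : Type*) [Fintype S] (I : Type*) (A : I → Type*) where
  /-- `reward i s a` is the stage reward of player `i` in state `s` under the profile `a`. -/
  reward : I → S → (∀ i, A i) → ℝ
  /-- `trans s a s'` is the probability of moving from `s` to `s'` under the profile `a`. -/
  trans : S → (∀ i, A i) → S → ℝ
  trans_mem : ∀ s a, trans s a ∈ stdSimplex ℝ S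
  /-- The discount factor. -/
  disc : ℝ
  disc_mem : disc ∈ Ioo (0 : ℝ) 1

section Profiles

variable {I : Type*} {A : I → Type*} [∀ i, Fintype (A i)]

/-- The set `X = ∏ i, Δ(A i)` of mixed action profiles. -/
def mixedProfiles (A : I → Type*) [∀ i, Fintype (A i)] : Set (∀ i, A i → ℝ) :=
  {x | ∀ i, x i ∈ stdSimplex ℝ (A i)}

/-- The (relative) interior of `X`: all actions of all players have positive weight. -/
def interiorProfiles (A : I → Type*) [∀ i, Fintype (A i)] : Set (∀ i, A i → ℝ) :=
  {x | x ∈ mixedProfiles A ∧ ∀ i a, 0 < x i a}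

/-- The probability of the pure profile `a` when the players randomize independently
according to `x`. -/
def profileProb [Fintype I] (x : ∀ i, A i → ℝ) (a : ∀ i, A i) : ℝ := ∏ i, x i (a i)

/-- Multilinear extension to mixed profiles of a function of pure profiles. -/
def mixedExt [Fintype I] [DecidableEq I] (f : (∀ i, A i) → ℝ) (x : ∀ i, A i → ℝ) : ℝ :=
  ∑ a, profileProb x a * f a

/-- The hypotheses on a family `h` of steep concave regularizers: each `h i` is continuous on `X`,
strictly concave in the mixed action of player `i`, `C¹` on the interior of `X`, and the norm
of the gradient of `h i` with respect to `x i` (along the tangent space of the simplex) tends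
to infinity as `x i` approaches the boundary of `Δ(A i)`. -/
structure IsRegularizer [Fintype I] [DecidableEq I] (h : I → (∀ i, A i → ℝ) → ℝ) : Prop where
  continuousOn : ∀ i, ContinuousOn (h i) (mixedProfiles A)
  strictConcave : ∀ i, ∀ x ∈ mixedProfiles A,
    StrictConcaveOn ℝ (stdSimplex ℝ (A i)) (fun y => h i (Function.update x i y))
  contDiffOn : ∀ i, ContDiffOn ℝ 1 (h i) (interiorProfiles A)
  steep : ∀ i, ∀ M : ℝ, ∃ ρ > 0, ∀ x ∈ interiorProfiles A, (∃ a, x i a < ρ) →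
    ∃ v : A i → ℝ, ∑ a, v a = 0 ∧ ‖v‖ ≤ 1 ∧ M ≤ lineDeriv ℝ (h i) x (Pi.single i v)

end Profiles

namespace StochasticGame

variable {S : Type*} [Fintype S] {I : Type*} [Fintype I] [DecidableEq I]
  {A : I → Type*} [∀ i, Fintype (A i)]

/-- All players have the same stage reward. -/
def IsIdenticalInterest (G : StochasticGame S I A) : Prop :=
  ∀ i j s a, G.reward i s a = G.reward j s a

/-- There are two players and their stage rewards are opposite. -/
def IsZeroSum (G : StochasticGame S I A) : Prop :=
  Fintype.card I = 2 ∧ ∀ i j, i ≠ j → ∀ s a, G.reward i s a = - G.reward j s a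

/-- Conditional expectation of the stage payoff `g` to be received `n` stages later, given the
history `hist` of past states and actions and the current state `s`, when at each stage all
players randomize independently according to `σ history state`. -/
def expStagePayoff (G : StochasticGame S I A) (g : S → (∀ i, A i → ℝ) → ℝ)
    (σ : List (S × (∀ i, A i)) → S → (∀ i, A i → ℝ)) :
    ℕ → List (S × (∀ i, A i)) → S → ℝ
  | 0, hist, s => g s (σ hist s)
  | n + 1, hist, s => ∑ a, profileProb (σ hist s) a *
      ∑ s', G.trans s a s' * expStagePayoff G g σ n (hist ++ [(s, a)]) s'

/-- Expected discounted sum of the stage payoffs `g` from the initial state `s` under the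
behavioral strategy profile `σ`. -/
def discountedPayoff (G : StochasticGame S I A) (g : S → (∀ i, A i → ℝ) → ℝ)
    (σ : List (S × (∀ i, A i)) → S → (∀ i, A i → ℝ)) (s : S) : ℝ :=
  ∑' n : ℕ, G.disc ^ n * G.expStagePayoff g σ n [] s

/-- The perturbed stage payoff `r^i_s + ε h^i` of player `i`. -/
def perturbedPayoff (G : StochasticGame S I A) (h : I → (∀ i, A i → ℝ) → ℝ) (ε : ℝ)
    (i : I) (s : S) (x : ∀ i, A i → ℝ) : ℝ :=
  mixedExt (G.reward i s) x + ε * h i x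

/-- The stationary profiles that are `κ`-equilibria of the discounted game with stage payoffs
`r^i_s + ε h^i`: from no initial state does a behavioral deviation of one player raise the
discounted payoff of this player by more than `κ`. A strategy of player `i` maps a history
(whose length is the stage) and a current state to a mixed action. -/
def regularizedEquilibria (G : StochasticGame S I A) (h : I → (∀ i, A i → ℝ) → ℝ) (ε κ : ℝ) :
    Set (S → ∀ i, A i → ℝ) :=
  {x | (∀ s, x s ∈ mixedProfiles A) ∧
    ∀ (i : I) (τ : List (S × (∀ i, A i)) → S → (A i → ℝ)),
      (∀ hist s, τ hist s ∈ stdSimplex ℝ (A i)) → ∀ s₀ : S,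
        G.discountedPayoff (G.perturbedPayoff h ε i)
            (fun hist s => Function.update (x s) i (τ hist s)) s₀
          ≤ G.discountedPayoff (G.perturbedPayoff h ε i) (fun _ s => x s) s₀ + κ}

end StochasticGame

section Dynamics

variable {S : Type*} [Fintype S] {I : Type*} [Fintype I] [DecidableEq I]
  {A : I → Type*} [∀ i, Fintype (A i)]

/-- Payoff of the auxiliary one-shot game with discount factor `δ`, stage reward `r`,
transitions `P` and continuation payoffs `u`:
`(1 - δ) r(a) + δ ∑ s', P(a)(s') u(s')`, extended to mixed profiles. -/
def auxPayoff (δ : ℝ) (r : (∀ i, A i) → ℝ) (P : (∀ i, A i) → S → ℝ) (u : S → ℝ)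
    (x : ∀ i, A i → ℝ) : ℝ :=
  mixedExt (fun a => (1 - δ) * r a + δ * ∑ s', P a s' * u s') x

/-- `y` maximizes `F (·, x^{-i})` over the mixed actions of player `i`. -/
def IsBestResponse (F : (∀ i, A i → ℝ) → ℝ) (i : I) (x : ∀ i, A i → ℝ) (y : A i → ℝ) : Prop :=
  y ∈ stdSimplex ℝ (A i) ∧
    ∀ z ∈ stdSimplex ℝ (A i), F (Function.update x i z) ≤ F (Function.update x i y)

/-- The variables of the model-free dynamics as functions of time. -/
structure MBRDPath (S I : Type*) (A : I → Type*) where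
  /-- The mixed actions `x^i_s`. -/
  act : ℝ → S → ∀ i, A i → ℝ
  /-- The continuation payoffs `u^i_s`. -/
  val : ℝ → I → S → ℝ
  /-- The estimated transitions. -/
  estTrans : ℝ → S → (∀ i, A i) → S → ℝ
  /-- The estimated rewards. -/
  estReward : ℝ → I → S → (∀ i, A i) → ℝ

/-- The estimated regularized auxiliary payoff of player `i` in state `s` at time `t`. -/
def MBRDPath.regPayoff (z : MBRDPath S I A) (G : StochasticGame S I A)
    (h : I → (∀ i, A i → ℝ) → ℝ) (ε : ℝ) (t : ℝ) (i : I) (s : S) (x : ∀ i, A i → ℝ) : ℝ :=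
  auxPayoff G.disc (z.estReward t i s) (z.estTrans t s) (z.val t i) x + ε * h i x

/-- Solutions on `[0, ∞)` of the model-free smooth best-response differential inclusion: locally
absolutely continuous paths in the state space which satisfy the inclusion at almost every time,
the multivalued part being the choice of the action rates `α s ∈ [αmin, 1]`. -/
structure MBRDPath.IsSolution (z : MBRDPath S I A) (G : StochasticGame S I A)
    (h : I → (∀ i, A i → ℝ) → ℝ) (ε αmin : ℝ) (β : ℝ → ℝ) : Prop where
  act_mem : ∀ t ≥ 0, ∀ s, z.act t s ∈ mixedProfiles A
  estTrans_mem : ∀ t ≥ 0, ∀ s a, z.estTrans t s a ∈ stdSimplex ℝ S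
  act_ac : ∀ T ≥ 0, ∀ s i a, AbsolutelyContinuousOnInterval (fun t => z.act t s i a) 0 T
  val_ac : ∀ T ≥ 0, ∀ i s, AbsolutelyContinuousOnInterval (fun t => z.val t i s) 0 T
  estTrans_ac : ∀ T ≥ 0, ∀ s a s',
    AbsolutelyContinuousOnInterval (fun t => z.estTrans t s a s') 0 T
  estReward_ac : ∀ T ≥ 0, ∀ i s a,
    AbsolutelyContinuousOnInterval (fun t => z.estReward t i s a) 0 T
  inclusion : ∀ᵐ t : ℝ, 0 ≤ t → ∃ (α : S → ℝ) (b : S → ∀ i, A i → ℝ),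
    (∀ s, α s ∈ Icc αmin 1) ∧
    (∀ s i, IsBestResponse (z.regPayoff G h ε t i s) i (z.act t s) (b s i)) ∧
    (∀ i s, HasDerivAt (fun τ => z.val τ i s)
      (β t * (z.regPayoff G h ε t i s (z.act t s) - z.val t i s)) t) ∧
    (∀ s i a, HasDerivAt (fun τ => z.act τ s i a) (α s * (b s i a - z.act t s i a)) t) ∧
    (∀ s a s', HasDerivAt (fun τ => z.estTrans τ s a s')
      (α s * profileProb (b s) a * (G.trans s a s' - z.estTrans t s a s')) t) ∧
    (∀ i s a, HasDerivAt (fun τ => z.estReward τ i s a)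
      (α s * profileProb (b s) a * (G.reward i s a - z.estReward t i s a)) t)

end Dynamics

/-- The value update rate is nonnegative and nonincreasing on `[0, ∞)`, with infinite integral. -/
structure IsValueRate (β : ℝ → ℝ) : Prop where
  nonneg : ∀ t ≥ 0, 0 ≤ β t
  antitone : AntitoneOn β (Ici 0)
  integral : Tendsto (fun T : ℝ => ∫ t in (0 : ℝ)..T, β t) atTop atTop

/-- The path `x` converges to the set `E`: the distance to `E` tends to `0` (and `E ≠ ∅`). -/
def ConvergesToSet {Y : Type*} [PseudoMetricSpace Y] (x : ℝ → Y) (E : Set Y) : Prop :=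
  ∀ η > 0, ∀ᶠ t in atTop, ∃ y ∈ E, dist (x t) y < η

end

noncomputable section

set_option linter.unusedSectionVars false

/-! Everything rests on differential inequalities, valid almost everywhere, for maxima of finitely
many absolutely continuous functions of time (`LocallyAC.le_of_barrier`, `LocallyAC.eventually_le`).

A priori estimates. The estimated rewards are bounded because they relax towards the true ones, and
the continuation payoffs are bounded because an auxiliary payoff weights them by the discount factor
only. Steepness then keeps best responses against bounded payoffs at distance at least `ρ` from the
boundary. Two consequences follow. Every pure profile is sampled at a positive rate, so the
estimates of rewards and transitions converge exponentially. The mixed actions are interior from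
time `1` on, where the regularizers are Lipschitz, so the current payoff Γ and the best-response
payoff are Lipschitz in time.

Identical interest. Players with common initial data keep common estimates. Let p be the positive
part of the maximum over states of u - Γ. Concavity of the common payoff in each player's action
gives Γ' ≥ gains - δβp - (exponentially small), whereas u' = β(Γ - u). Hence p' ≤ -(1 - δ)βp up to
an integrable term, so βp is integrable. Up to convergent corrections u and Γ are then monotone, so
both converge. Their limits agree since β is not integrable, and the gains from deviations are
integrable and Lipschitz, so they vanish by Barbalat's lemma.

Zero sum. Let V be the sum of the two best-response payoffs. By the envelope theorem and convexity
in the opponent's action, V' ≤ -αV + 2βK up to vanishing errors, so V is asymptotically at most a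
multiple κ of the limit of β divided by the minimal action rate. A small V makes the current profile
an approximate saddle point, so Γ is within κ of the maxmin of the auxiliary game; no minimax
theorem is needed. The maxmin operator is a δ-contraction, so u approaches its fixed point up to
κ/(1 - δ), and Γ - u is of the same order.

Conclusion. In both cases the one-stage gains and Γ - u are asymptotically small. Limit points of
the trajectory satisfy approximate Bellman inequalities for the true game, which sum over stages to
the equilibrium property (`StochasticGame.mem_regularizedEquilibria`), and compactness turns this
into convergence to the set. -/

/-! ### Absolutely continuous functions on half-lines -/

/-- `f` is absolutely continuous on every interval `[a, b]`. -/
def LocallyAC (f : ℝ → ℝ) (a : ℝ) : Prop := ∀ b ≥ a, AbsolutelyContinuousOnInterval f a b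

namespace LocallyAC

variable {f g : ℝ → ℝ} {a b : ℝ}

theorem on_interval (hf : LocallyAC f a) {s t : ℝ} (hs : a ≤ s) (hst : s ≤ t) :
    AbsolutelyContinuousOnInterval f s t := by
  refine (hf t (hs.trans hst)).mono ?_
  rw [uIcc_of_le hst, uIcc_of_le (hs.trans hst)]
  exact Icc_subset_Icc_left hs

theorem mono (hf : LocallyAC f a) (hab : a ≤ b) : LocallyAC f b :=
  fun _ hc => hf.on_interval hab hc

theorem add (hf : LocallyAC f a) (hg : LocallyAC g a) : LocallyAC (fun t => f t + g t) a :=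
  fun b hb => (hf b hb).fun_add (hg b hb)

theorem sub (hf : LocallyAC f a) (hg : LocallyAC g a) : LocallyAC (fun t => f t - g t) a :=
  fun b hb => (hf b hb).fun_sub (hg b hb)

theorem mul (hf : LocallyAC f a) (hg : LocallyAC g a) : LocallyAC (fun t => f t * g t) a :=
  fun b hb => (hf b hb).fun_mul (hg b hb)

theorem neg (hf : LocallyAC f a) : LocallyAC (fun t => - f t) a :=
  fun b hb => (hf b hb).fun_neg

theorem of_contDiff (hf : ContDiff ℝ 1 f) : LocallyAC f a :=
  fun _ _ => hf.contDiffOn.absolutelyContinuousOnInterval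

theorem const (c : ℝ) : LocallyAC (fun _ => c) a := of_contDiff contDiff_const

theorem const_mul (c : ℝ) (hf : LocallyAC f a) : LocallyAC (fun t => c * f t) a :=
  (const c).mul hf

/-- Absolute continuity passes to functions whose increments are controlled by those of finitely
many absolutely continuous functions. -/
theorem of_abs_sub_le {ι : Type*} [Fintype ι] {f : ι → ℝ → ℝ} (hf : ∀ k, LocallyAC (f k) a)
    (h : ∀ b ≥ a, ∃ C : ℝ, ∀ s ∈ Icc a b, ∀ t ∈ Icc a b,
      |g s - g t| ≤ C * ∑ k, |f k s - f k t|) :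
    LocallyAC g a := by
  intro b hb
  obtain ⟨C, h⟩ := h b hb
  have hlim : Tendsto (fun E : ℕ × (ℕ → ℝ × ℝ) => C * ∑ k, ∑ i ∈ Finset.range E.1,
      dist (f k (E.2 i).1) (f k (E.2 i).2))
      (AbsolutelyContinuousOnInterval.totalLengthFilter ⊓
        𝓟 (AbsolutelyContinuousOnInterval.disjWithin a b)) (𝓝 0) := by
    have := (tendsto_finsetSum Finset.univ fun k _ => hf k b hb).const_mul C
    simpa using this
  refine squeeze_zero' (Eventually.of_forall fun E => Finset.sum_nonneg fun _ _ => dist_nonneg)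
    ?_ hlim
  rw [eventually_inf_principal]
  refine Eventually.of_forall ?_
  rintro ⟨n, J⟩ hJ
  have hJ' := hJ.1
  rw [Finset.sum_comm, Finset.mul_sum]
  refine Finset.sum_le_sum fun i hi => ?_
  have hi' := hJ' i hi
  rw [uIcc_of_le hb] at hi'
  simpa [Real.dist_eq] using h _ hi'.1 _ hi'.2

theorem ae_hasDerivAt (hf : LocallyAC f a) :
    ∀ᵐ t, a ≤ t → HasDerivAt f (deriv f t) t := by
  have h : ∀ n : ℕ, ∀ᵐ t, t ∈ uIcc a (a + n) → DifferentiableAt ℝ f t := fun n =>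
    (hf (a + n) (by simp)).ae_differentiableAt
  filter_upwards [ae_all_iff.2 h] with t ht hat
  obtain ⟨n, hn⟩ := exists_nat_ge (t - a)
  refine (ht n ?_).hasDerivAt
  rw [uIcc_of_le (by simp)]
  exact ⟨hat, by linarith⟩

/-- Fundamental theorem of calculus for absolutely continuous functions. The hypothesis quantifies
over every possible derivative `D`, so that applications need not prove differentiability and may
identify `D` by uniqueness. -/
theorem sub_le_integral (hf : LocallyAC f a) {s t : ℝ} (has : a ≤ s) (hst : s ≤ t) {g : ℝ → ℝ}
    (hg : IntervalIntegrable g volume s t)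
    (h : ∀ᵐ τ, a ≤ τ → ∀ D, HasDerivAt f D τ → D ≤ g τ) :
    f t - f s ≤ ∫ τ in s..t, g τ := by
  have hac := hf.on_interval has hst
  rw [← hac.integral_deriv_eq_sub]
  refine intervalIntegral.integral_mono_ae_restrict hst hac.intervalIntegrable_deriv hg ?_
  filter_upwards [ae_restrict_of_ae h, ae_restrict_of_ae hf.ae_hasDerivAt,
    ae_restrict_mem measurableSet_Icc] with τ h1 h2 hτ
  exact h1 (has.trans hτ.1) _ (h2 (has.trans hτ.1))

theorem antitoneOn (hf : LocallyAC f a)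
    (h : ∀ᵐ τ, a ≤ τ → ∀ D, HasDerivAt f D τ → D ≤ 0) : AntitoneOn f (Ici a) := by
  intro s hs t _ hst
  have := hf.sub_le_integral hs hst (g := fun _ => 0) (by simp) h
  simp at this
  linarith

theorem monotoneOn (hf : LocallyAC f a)
    (h : ∀ᵐ τ, a ≤ τ → ∀ D, HasDerivAt f D τ → 0 ≤ D) : MonotoneOn f (Ici a) := by
  have : AntitoneOn (fun t => - f t) (Ici a) := by
    refine hf.neg.antitoneOn ?_
    filter_upwards [h] with τ h1 h2 D hD
    have := h1 h2 (-D) (by simpa using hD.fun_neg)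
    linarith
  intro s hs t ht hst
  simpa using this hs ht hst

/-- A bound on the derivative is a Lipschitz constant. -/
theorem abs_sub_le (hf : LocallyAC f a) {C : ℝ}
    (h : ∀ᵐ τ, a ≤ τ → ∀ D, HasDerivAt f D τ → |D| ≤ C) {s t : ℝ} (hs : a ≤ s) (ht : a ≤ t) :
    |f s - f t| ≤ C * |s - t| := by
  wlog hst : s ≤ t generalizing s t
  · rw [abs_sub_comm, abs_sub_comm s]
    exact this ht hs (le_of_not_ge hst)
  have h1 := hf.sub_le_integral hs hst (g := fun _ => C) (by simp) (by
    filter_upwards [h] with τ h1 h2 D hD using (le_abs_self _).trans (h1 h2 D hD))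
  have h2 := hf.neg.sub_le_integral hs hst (g := fun _ => C) (by simp) (by
    filter_upwards [h] with τ h1 h2 D hD
    have := h1 h2 (-D) (by simpa using hD.fun_neg)
    rw [abs_neg] at this
    exact (le_abs_self _).trans this)
  simp only [intervalIntegral.integral_const, smul_eq_mul] at h1 h2
  rw [abs_of_nonpos (sub_nonpos.2 hst), abs_le]
  constructor <;> linarith

end LocallyAC

/-- The difference has a local minimum at the contact point. This differentiates maxima, both over
finite families and over mixed actions, without following the maximizer in time. -/
theorem HasDerivAt.unique_of_le {f g : ℝ → ℝ} {D E t : ℝ} (hf : HasDerivAt f D t)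
    (hg : HasDerivAt g E t) (hle : ∀ᶠ τ in 𝓝 t, g τ ≤ f τ) (heq : f t = g t) : D = E := by
  have hmin : IsLocalMin (fun τ => f τ - g τ) t := by
    filter_upwards [hle] with τ hτ
    simp only [heq, sub_self]
    linarith
  have := hmin.hasDerivAt_eq_zero (hf.sub hg)
  linarith

/-! ### The positive part of the maximum of a finite family -/

section PosSup

variable {κ : Type*} [Finite κ]

/-- The maximum of `0` and of the values of a finite family. -/
def posSup (f : κ → ℝ → ℝ) (t : ℝ) : ℝ := ⨆ k : Option κ, k.elim 0 (fun k => f k t)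

theorem posSup_nonneg (f : κ → ℝ → ℝ) (t : ℝ) : 0 ≤ posSup f t :=
  le_ciSup (f := fun k : Option κ => k.elim 0 (fun k => f k t)) (Set.finite_range _).bddAbove none

theorem le_posSup (f : κ → ℝ → ℝ) (t : ℝ) (k : κ) : f k t ≤ posSup f t :=
  le_ciSup (f := fun k : Option κ => k.elim 0 (fun k => f k t)) (Set.finite_range _).bddAbove
    (some k)

theorem posSup_eq (f : κ → ℝ → ℝ) (t : ℝ) :
    posSup f t = 0 ∨ ∃ k, posSup f t = f k t ∧ 0 < f k t := by
  obtain ⟨k, hk⟩ := exists_eq_ciSup_of_finite (f := fun k : Option κ => k.elim 0 (fun k => f k t))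
  rcases (posSup_nonneg f t).eq_or_lt with h0 | h0
  · exact .inl h0.symm
  · right
    cases k with
    | none => exact absurd hk h0.ne
    | some k => exact ⟨k, hk.symm, by rw [posSup, ← hk] at h0; exact h0⟩

theorem LocallyAC.posSup {f : κ → ℝ → ℝ} {a : ℝ} (hf : ∀ k, LocallyAC (f k) a) :
    LocallyAC (posSup f) a := by
  have := Fintype.ofFinite κ
  refine LocallyAC.of_abs_sub_le hf fun b _ => ⟨1, fun s _ t _ => ?_⟩
  have key : ∀ s t, _root_.posSup f s - _root_.posSup f t ≤ ∑ k, |f k s - f k t| := by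
    intro s t
    rcases posSup_eq f s with h | ⟨k, h, _⟩
    · rw [h]
      have h1 := posSup_nonneg f t
      have h2 : 0 ≤ ∑ k, |f k s - f k t| := Finset.sum_nonneg fun _ _ => abs_nonneg _
      linarith
    · rw [h]
      have h1 := le_posSup f t k
      have h2 := Finset.single_le_sum (f := fun k => |f k s - f k t|)
        (fun _ _ => abs_nonneg _) (Finset.mem_univ k)
      have h3 := le_abs_self (f k s - f k t)
      linarith
  rw [one_mul, abs_le]
  have h1 := key s t
  have h2 := key t s
  simp only [abs_sub_comm (f _ t)] at h2
  constructor <;> linarith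

/-- The derivative of the maximum is the derivative of a maximal member of the family. -/
theorem posSup_hasDerivAt_cases {f : κ → ℝ → ℝ} {a : ℝ} (hf : ∀ k, LocallyAC (f k) a) :
    ∀ᵐ t, a ≤ t → ∀ D, HasDerivAt (posSup f) D t →
      (posSup f t = 0 ∧ D = 0) ∨
      ∃ k, posSup f t = f k t ∧ 0 < f k t ∧ (∀ l, f l t ≤ f k t) ∧ HasDerivAt (f k) D t := by
  filter_upwards [ae_all_iff.2 fun k => (hf k).ae_hasDerivAt] with t ht hat D hD
  rcases posSup_eq f t with h | ⟨k, h, hk⟩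
  · exact .inl ⟨h, hD.unique_of_le (hasDerivAt_const t (0 : ℝ))
      (Eventually.of_forall fun τ => posSup_nonneg f τ) h⟩
  · refine .inr ⟨k, h, hk, fun l => h ▸ le_posSup f t l, ?_⟩
    rw [hD.unique_of_le (ht k hat) (Eventually.of_forall fun τ => le_posSup f τ k) h]
    exact ht k hat

/-- A finite family whose maximum cannot increase above the level `K` stays below `K`. -/
theorem LocallyAC.le_of_barrier {f : κ → ℝ → ℝ} {a K : ℝ} (hf : ∀ k, LocallyAC (f k) a)
    (h0 : ∀ k, f k a ≤ K)
    (h : ∀ᵐ t, a ≤ t → ∀ k D, HasDerivAt (f k) D t → K < f k t → (∀ l, f l t ≤ f k t) → D ≤ 0) :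
    ∀ t ≥ a, ∀ k, f k t ≤ K := by
  have hg : ∀ k, LocallyAC (fun t => f k t - K) a := fun k => (hf k).sub (const K)
  have hanti := (LocallyAC.posSup hg).antitoneOn (by
    filter_upwards [h, posSup_hasDerivAt_cases hg] with t h1 h2 hat D hD
    rcases h2 hat D hD with ⟨_, rfl⟩ | ⟨k, _, hk, hl, hkD⟩
    · exact le_rfl
    · refine h1 hat k D (by simpa using hkD.add_const K) (by linarith) fun l => ?_
      have := hl l
      linarith)
  intro t ht k
  have h1 := hanti self_mem_Ici ht ht
  have h2 : _root_.posSup (fun k t => f k t - K) a = 0 := by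
    rcases posSup_eq (fun k t => f k t - K) a with h | ⟨k, _, hk⟩
    · exact h
    · have := h0 k
      linarith
  have h3 := le_posSup (fun k t => f k t - K) t k
  linarith

/-- A finite family whose maximum decreases above the level `K` at a nonintegrable rate is
eventually below `K`. -/
theorem LocallyAC.eventually_le {f : κ → ℝ → ℝ} {a K c : ℝ} {γ : ℝ → ℝ}
    (hf : ∀ k, LocallyAC (f k) a) (hc : 0 < c) (hγ : ∀ t ≥ a, 0 ≤ γ t)
    (hint : ∀ t ≥ a, IntervalIntegrable γ volume a t)
    (hlim : Tendsto (fun T => ∫ t in a..T, γ t) atTop atTop)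
    (h : ∀ᵐ t, a ≤ t → ∀ k D, HasDerivAt (f k) D t → K < f k t → (∀ l, f l t ≤ f k t) →
      D ≤ - (c * γ t)) :
    ∀ᶠ t in atTop, ∀ k, f k t ≤ K := by
  have hg : ∀ k, LocallyAC (fun t => f k t - K) a := fun k => (hf k).sub (const K)
  set p := _root_.posSup (fun k t => f k t - K) with hp
  have hpac : LocallyAC p a := LocallyAC.posSup hg
  have hder : ∀ᵐ t, a ≤ t → ∀ D, HasDerivAt p D t →
      (p t = 0 ∧ D = 0) ∨ D ≤ -(c * γ t) := by
    filter_upwards [h, posSup_hasDerivAt_cases hg] with t h1 h2 hat D hD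
    rcases h2 hat D hD with h3 | ⟨k, _, hk, hl, hkD⟩
    · exact .inl h3
    · refine .inr (h1 hat k D (by simpa using hkD.add_const K) (by linarith) fun l => ?_)
      have := hl l
      linarith
  have hanti : AntitoneOn p (Ici a) := hpac.antitoneOn (by
    filter_upwards [hder] with t h1 hat D hD
    rcases h1 hat D hD with ⟨_, rfl⟩ | h2
    · exact le_rfl
    · have := mul_nonneg hc.le (hγ t hat)
      linarith)
  -- While `p` is positive it loses at least `c * γ` per unit of time, and the total loss would
  -- exceed `p a` in finite time. Once `p` reaches zero it stays there, being nonnegative and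
  -- nonincreasing.
  have hex : ∃ t ≥ a, p t = 0 := by
    by_contra! hne
    obtain ⟨T, hT1, hT2⟩ := ((hlim.eventually (eventually_gt_atTop (p a / c))).and
      (eventually_ge_atTop a)).exists
    have := hpac.sub_le_integral le_rfl hT2 (g := fun t => -(c * γ t))
      ((hint T hT2).const_mul c).neg (by
        filter_upwards [hder] with t h1 hat D hD
        rcases h1 hat D hD with ⟨h2, _⟩ | h2
        · exact absurd h2 (hne t hat)
        · exact h2)
    rw [intervalIntegral.integral_neg, intervalIntegral.integral_const_mul] at this
    have h0 := posSup_nonneg (fun k t => f k t - K) T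
    rw [← hp] at h0
    rw [div_lt_iff₀ hc] at hT1
    linarith
  obtain ⟨t₀, ht₀, hpt₀⟩ := hex
  filter_upwards [eventually_ge_atTop t₀] with t ht k
  have h1 := hanti ht₀ (ht₀.le.trans ht : a ≤ t) ht
  have h2 := le_posSup (fun k t => f k t - K) t k
  rw [← hp] at h2
  linarith

end PosSup

/-- Barbalat's lemma. -/
theorem LocallyAC.tendsto_zero_of_le_deriv {f g : ℝ → ℝ} {a C L : ℝ} (hf : LocallyAC f a)
    (hg0 : ∀ t ≥ a, 0 ≤ g t) (hg : ∀ s ≥ a, ∀ t ≥ a, |g s - g t| ≤ L * |s - t|)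
    (hbdd : ∀ t ≥ a, f t ≤ C)
    (h : ∀ᵐ t, a ≤ t → ∀ D, HasDerivAt f D t → g t ≤ D) :
    Tendsto g atTop (𝓝 0) := by
  have hmono : MonotoneOn f (Ici a) := hf.monotoneOn (by
    filter_upwards [h] with t h1 hat D hD using (hg0 t hat).trans (h1 hat D hD))
  rw [Metric.tendsto_atTop]
  intro η hη
  -- If `g` is at least `η` at some time, the Lipschitz bound keeps it above `η / 2` for a further
  -- time `d`, so `f` rises by `d * (η / 2)`.
  set d : ℝ := η / (2 * (|L| + 1)) with hd
  have hL : 0 < |L| + 1 := by positivity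
  have hdpos : 0 < d := by positivity
  have hLd : |L| * d ≤ η / 2 := by
    rw [hd, mul_div_assoc', div_le_iff₀ (by positivity)]
    nlinarith [abs_nonneg L]
  -- the increments of `f` over steps of length `d` are eventually small
  have hne : (f '' Ici a).Nonempty := ⟨f a, a, self_mem_Ici, rfl⟩
  have hba : BddAbove (f '' Ici a) := ⟨C, by rintro _ ⟨t, ht, rfl⟩; exact hbdd t ht⟩
  obtain ⟨_, ⟨t₀, ht₀, rfl⟩, hlt⟩ := exists_lt_of_lt_csSup hne
    (show sSup (f '' Ici a) - d * (η / 2) < sSup (f '' Ici a) by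
      have : 0 < d * (η / 2) := by positivity
      linarith)
  refine ⟨t₀, fun t ht => ?_⟩
  have hat : a ≤ t := le_trans ht₀ ht
  rw [Real.dist_eq, sub_zero, abs_of_nonneg (hg0 t hat)]
  by_contra! hge
  have hup : f (t + d) ≤ sSup (f '' Ici a) :=
    le_csSup hba ⟨t + d, (by have := hdpos.le; exact le_trans hat (by linarith)), rfl⟩
  have hlo : f t₀ ≤ f t := hmono ht₀ hat ht
  -- The derivative bound is required at almost every later time, whereas the bound `η / 2` holds
  -- only up to `t + d`; hence the cut-off, which falls back on `0 ≤ g`.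
  have hint := (hf.neg.mono hat).sub_le_integral (s := t) (t := t + d) le_rfl (by linarith)
    (g := fun τ => -(if τ ≤ t + d then η / 2 else 0)) (by
      refine IntervalIntegrable.neg ?_
      refine (intervalIntegrable_const (c := η / 2)).congr (fun τ hτ => ?_)
      rw [uIoc_of_le (by linarith)] at hτ
      simp [hτ.2]) (by
      filter_upwards [h] with τ h1 htτ D hD
      have h2 := h1 (hat.trans htτ) (-D) (by simpa using hD.fun_neg)
      split_ifs with h3
      · have h4 := hg t hat τ (hat.trans htτ)
        have h5 : |t - τ| ≤ d := by rw [abs_le]; constructor <;> linarith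
        have h6 : L * |t - τ| ≤ |L| * d :=
          mul_le_mul (le_abs_self L) h5 (abs_nonneg _) (abs_nonneg _)
        have h7 := (abs_le.1 h4).2
        linarith
      · have := hg0 τ (hat.trans htτ)
        linarith)
  rw [intervalIntegral.integral_neg] at hint
  have hcongr : ∫ τ in t..(t + d), (if τ ≤ t + d then η / 2 else 0) = d * (η / 2) := by
    rw [intervalIntegral.integral_congr (g := fun _ => η / 2)]
    · simp [mul_div_assoc]
    · intro τ hτ
      rw [uIcc_of_le (by linarith)] at hτ
      simp [hτ.2]
  rw [hcongr] at hint
  linarith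

/-! ### Mixed profiles and multilinear extensions -/

section Static

variable {I : Type*} [Fintype I] [DecidableEq I] {A : I → Type*} [∀ i, Fintype (A i)]

theorem mixedProfiles_eq_pi : mixedProfiles A = Set.pi univ fun i => stdSimplex ℝ (A i) := by
  ext x; simp [mixedProfiles]

theorem isCompact_mixedProfiles : IsCompact (mixedProfiles A) := by
  rw [mixedProfiles_eq_pi]
  exact isCompact_univ_pi fun i => isCompact_stdSimplex ℝ (A i)

theorem convex_mixedProfiles : Convex ℝ (mixedProfiles A) := by
  rw [mixedProfiles_eq_pi]
  exact convex_pi fun i _ => convex_stdSimplex ℝ (A i)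

theorem update_mem_mixedProfiles {x : ∀ i, A i → ℝ} (hx : x ∈ mixedProfiles A) {i : I}
    {y : A i → ℝ} (hy : y ∈ stdSimplex ℝ (A i)) : Function.update x i y ∈ mixedProfiles A := by
  intro j
  rcases eq_or_ne j i with rfl | hj
  · simpa using hy
  · simpa [hj] using hx j

theorem mixedProfiles_le_one {x : ∀ i, A i → ℝ} (hx : x ∈ mixedProfiles A) (i : I) (a : A i) :
    x i a ≤ 1 := by
  rw [← (hx i).2]
  exact Finset.single_le_sum (fun b _ => (hx i).1 b) (Finset.mem_univ a)

theorem profileProb_nonneg {x : ∀ i, A i → ℝ} (hx : x ∈ mixedProfiles A) (a : ∀ i, A i) :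
    0 ≤ profileProb x a := Finset.prod_nonneg fun i _ => (hx i).1 _

theorem profileProb_le_one {x : ∀ i, A i → ℝ} (hx : x ∈ mixedProfiles A) (a : ∀ i, A i) :
    profileProb x a ≤ 1 :=
  Finset.prod_le_one (fun i _ => (hx i).1 _) fun i _ => mixedProfiles_le_one hx i _

theorem sum_profileProb {x : ∀ i, A i → ℝ} (hx : x ∈ mixedProfiles A) :
    ∑ a, profileProb x a = 1 := by
  have := Finset.prod_univ_sum (fun i => (Finset.univ : Finset (A i))) (fun i b => x i b)
  simp only [(hx _).2, Finset.prod_const_one, Fintype.piFinset_univ] at this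
  exact this.symm

theorem mixedExt_mono {f g : (∀ i, A i) → ℝ} (hfg : ∀ a, f a ≤ g a) {x : ∀ i, A i → ℝ}
    (hx : x ∈ mixedProfiles A) : mixedExt f x ≤ mixedExt g x :=
  Finset.sum_le_sum fun a _ => mul_le_mul_of_nonneg_left (hfg a) (profileProb_nonneg hx a)

theorem mixedExt_const (c : ℝ) {x : ∀ i, A i → ℝ} (hx : x ∈ mixedProfiles A) :
    mixedExt (fun _ => c) x = c := by
  rw [mixedExt, ← Finset.sum_mul, sum_profileProb hx, one_mul]

theorem mixedExt_add (f g : (∀ i, A i) → ℝ) (x : ∀ i, A i → ℝ) :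
    mixedExt (fun a => f a + g a) x = mixedExt f x + mixedExt g x := by
  simp [mixedExt, mul_add, Finset.sum_add_distrib]

theorem mixedExt_sub (f g : (∀ i, A i) → ℝ) (x : ∀ i, A i → ℝ) :
    mixedExt (fun a => f a - g a) x = mixedExt f x - mixedExt g x := by
  simp [mixedExt, mul_sub, Finset.sum_sub_distrib]

theorem mixedExt_const_mul (c : ℝ) (f : (∀ i, A i) → ℝ) (x : ∀ i, A i → ℝ) :
    mixedExt (fun a => c * f a) x = c * mixedExt f x := by
  simp only [mixedExt, Finset.mul_sum]
  exact Finset.sum_congr rfl fun a _ => by ring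

theorem mixedExt_le {f : (∀ i, A i) → ℝ} {c : ℝ} (hf : ∀ a, f a ≤ c) {x : ∀ i, A i → ℝ}
    (hx : x ∈ mixedProfiles A) : mixedExt f x ≤ c :=
  (mixedExt_mono hf hx).trans (mixedExt_const c hx).le

theorem le_mixedExt {f : (∀ i, A i) → ℝ} {c : ℝ} (hf : ∀ a, c ≤ f a) {x : ∀ i, A i → ℝ}
    (hx : x ∈ mixedProfiles A) : c ≤ mixedExt f x :=
  (mixedExt_const c hx).ge.trans (mixedExt_mono hf hx)

theorem abs_mixedExt_le {f : (∀ i, A i) → ℝ} {c : ℝ} (hf : ∀ a, |f a| ≤ c) {x : ∀ i, A i → ℝ}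
    (hx : x ∈ mixedProfiles A) : |mixedExt f x| ≤ c :=
  abs_le.2 ⟨le_mixedExt (fun a => (abs_le.1 (hf a)).1) hx,
    mixedExt_le (fun a => (abs_le.1 (hf a)).2) hx⟩

theorem profileProb_update (x : ∀ i, A i → ℝ) (i : I) (y : A i → ℝ) (a : ∀ i, A i) :
    profileProb (Function.update x i y) a = y (a i) * ∏ j ∈ Finset.univ.erase i, x j (a j) := by
  rw [profileProb, ← Finset.mul_prod_erase _ _ (Finset.mem_univ i)]
  simp only [Function.update_self]
  congr 1
  refine Finset.prod_congr rfl fun j hj => ?_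
  rw [Function.update_of_ne (Finset.ne_of_mem_erase hj)]

theorem mixedExt_update_combo (f : (∀ i, A i) → ℝ) (x : ∀ i, A i → ℝ) (i : I) (y z : A i → ℝ)
    (p q : ℝ) : mixedExt f (Function.update x i (p • y + q • z)) =
      p * mixedExt f (Function.update x i y) + q * mixedExt f (Function.update x i z) := by
  simp only [mixedExt, profileProb_update, Finset.mul_sum, ← Finset.sum_add_distrib]
  refine Finset.sum_congr rfl fun a _ => ?_
  simp only [Pi.add_apply, Pi.smul_apply, smul_eq_mul]
  ring

theorem contDiff_profileProb (a : ∀ i, A i) :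
    ContDiff ℝ 1 (fun x : ∀ i, A i → ℝ => profileProb x a) :=
  contDiff_prod fun i _ => contDiff_pi.1 (contDiff_pi.1 contDiff_id i) (a i)

theorem contDiff_mixedExt (f : (∀ i, A i) → ℝ) : ContDiff ℝ 1 (mixedExt f) :=
  ContDiff.sum fun a _ => (contDiff_profileProb a).mul contDiff_const

theorem dist_profile_le (x y : ∀ i, A i → ℝ) :
    dist x y ≤ ∑ k : Σ i, A i, |x k.1 k.2 - y k.1 k.2| := by
  have h0 : 0 ≤ ∑ k : Σ i, A i, |x k.1 k.2 - y k.1 k.2| :=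
    Finset.sum_nonneg fun _ _ => abs_nonneg _
  refine (dist_pi_le_iff h0).2 fun i => (dist_pi_le_iff h0).2 fun a => ?_
  exact Finset.single_le_sum (f := fun k : Σ i, A i => |x k.1 k.2 - y k.1 k.2|)
    (fun _ _ => abs_nonneg _) (Finset.mem_univ (⟨i, a⟩ : Σ i, A i))

-- Profile probabilities are polynomial, hence Lipschitz on the compact convex set of mixed
-- profiles. Splitting the difference as (x - y)f + y(f - g) separates the change of profile from
-- the change of payoff, with `K` independent of the payoffs.
variable (A) in
theorem exists_mixedExt_sub_le : ∃ K : ℝ, 0 ≤ K ∧ ∀ (f g : (∀ i, A i) → ℝ) (M : ℝ),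
    (∀ a, |f a| ≤ M) → ∀ x ∈ mixedProfiles A, ∀ y ∈ mixedProfiles A,
      |mixedExt f x - mixedExt g y| ≤ M * K * dist x y + ∑ a, |f a - g a| := by
  have hL : ∀ a : ∀ i, A i, ∃ K, LipschitzOnWith K (fun x : ∀ i, A i → ℝ => profileProb x a)
      (mixedProfiles A) := fun a =>
    (contDiff_profileProb a).contDiffOn.exists_lipschitzOnWith one_ne_zero convex_mixedProfiles
      isCompact_mixedProfiles
  choose K hK using hL
  refine ⟨∑ a, (K a : ℝ), Finset.sum_nonneg fun _ _ => NNReal.coe_nonneg _, ?_⟩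
  intro f g M hf x hx y hy
  have h1 : mixedExt f x - mixedExt g y =
      ∑ a, ((profileProb x a - profileProb y a) * f a + profileProb y a * (f a - g a)) := by
    simp only [mixedExt, ← Finset.sum_sub_distrib]
    exact Finset.sum_congr rfl fun a _ => by ring
  rw [h1]
  refine (Finset.abs_sum_le_sum_abs _ _).trans ?_
  rw [Finset.mul_sum, Finset.sum_mul, ← Finset.sum_add_distrib]
  refine Finset.sum_le_sum fun a _ => (abs_add_le _ _).trans (add_le_add ?_ ?_)
  · rw [abs_mul]
    have h2 := (hK a).dist_le_mul x hx y hy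
    rw [Real.dist_eq] at h2
    calc _ ≤ (K a * dist x y) * M := mul_le_mul h2 (hf a) (abs_nonneg _) (by positivity)
      _ = _ := by ring
  · rw [abs_mul, abs_of_nonneg (profileProb_nonneg hy a)]
    exact mul_le_of_le_one_left (abs_nonneg _) (profileProb_le_one hy a)

/-! ### Best responses -/

/-- The best payoff that player `i` can achieve against the other components of `x`. -/
def bestPayoff (F : (∀ i, A i → ℝ) → ℝ) (i : I) (x : ∀ i, A i → ℝ) : ℝ :=
  sSup ((fun y => F (Function.update x i y)) '' stdSimplex ℝ (A i))

theorem IsBestResponse.bestPayoff_eq {F : (∀ i, A i → ℝ) → ℝ} {i : I} {x : ∀ i, A i → ℝ}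
    {y : A i → ℝ} (hy : IsBestResponse F i x y) :
    bestPayoff F i x = F (Function.update x i y) :=
  IsGreatest.csSup_eq ⟨⟨y, hy.1, rfl⟩, by rintro _ ⟨z, hz, rfl⟩; exact hy.2 z hz⟩

theorem exists_isBestResponse {F : (∀ i, A i → ℝ) → ℝ} (hF : ContinuousOn F (mixedProfiles A))
    (i : I) {x : ∀ i, A i → ℝ} (hx : x ∈ mixedProfiles A) : ∃ y, IsBestResponse F i x y := by
  have hc : ContinuousOn (fun y => F (Function.update x i y)) (stdSimplex ℝ (A i)) :=
    hF.comp (by fun_prop) fun y hy => update_mem_mixedProfiles hx hy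
  obtain ⟨y, hy, hmax⟩ := (isCompact_stdSimplex ℝ (A i)).exists_isMaxOn ⟨x i, hx i⟩ hc
  exact ⟨y, hy, fun z hz => hmax hz⟩

theorem le_bestPayoff {F : (∀ i, A i → ℝ) → ℝ} (hF : ContinuousOn F (mixedProfiles A))
    {i : I} {x : ∀ i, A i → ℝ} (hx : x ∈ mixedProfiles A) {y : A i → ℝ}
    (hy : y ∈ stdSimplex ℝ (A i)) : F (Function.update x i y) ≤ bestPayoff F i x := by
  obtain ⟨b, hb⟩ := exists_isBestResponse hF i hx
  rw [hb.bestPayoff_eq]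
  exact hb.2 y hy

theorem self_le_bestPayoff {F : (∀ i, A i → ℝ) → ℝ} (hF : ContinuousOn F (mixedProfiles A))
    (i : I) {x : ∀ i, A i → ℝ} (hx : x ∈ mixedProfiles A) : F x ≤ bestPayoff F i x := by
  simpa using le_bestPayoff hF hx (hx i)

/-! ### Differentiability inside the simplex -/

/-- Positivity is an open condition; the constraint that weights sum to one is not, and has to come
from the path. This lets derivatives within the relative interior be composed with paths. -/
theorem eventually_mem_interiorProfiles {γ : ℝ → ∀ i, A i → ℝ} {t : ℝ}
    (hγ : ContinuousAt γ t) (ht : γ t ∈ interiorProfiles A)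
    (hsum : ∀ᶠ τ in 𝓝 t, ∀ i, ∑ a, γ τ i a = 1) : ∀ᶠ τ in 𝓝 t, γ τ ∈ interiorProfiles A := by
  have hpos : ∀ᶠ τ in 𝓝 t, ∀ i, ∀ a, 0 < γ τ i a := by
    refine eventually_all.2 fun i => eventually_all.2 fun a => ?_
    have hc : ContinuousAt (fun τ => γ τ i a) t :=
      (show Continuous fun x : ∀ i, A i → ℝ => x i a by fun_prop).continuousAt.comp hγ
    exact hc.eventually (lt_mem_nhds (ht.2 i a))
  filter_upwards [hpos, hsum] with τ h1 h2
  exact ⟨fun i => ⟨fun a => (h1 i a).le, h2 i⟩, h1⟩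

theorem add_smul_single_eq_update (x : ∀ i, A i → ℝ) (i : I) (w : A i → ℝ) (θ : ℝ) :
    x + θ • (Pi.single i (w - x i) : ∀ j, A j → ℝ) = Function.update x i ((1 - θ) • x i + θ • w) := by
  funext j
  rcases eq_or_ne j i with rfl | hj
  · simp only [Pi.add_apply, Pi.smul_apply, Pi.single_eq_same, Function.update_self]
    module
  · simp [hj]

theorem hasDerivAt_line {Φ : (∀ i, A i → ℝ) → ℝ} {L : (∀ i, A i → ℝ) →L[ℝ] ℝ}
    {x : ∀ i, A i → ℝ} (hx : x ∈ interiorProfiles A)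
    (hL : HasFDerivWithinAt Φ L (interiorProfiles A) x) {v : ∀ i, A i → ℝ}
    (hv : ∀ i, ∑ a, v i a = 0) : HasDerivAt (fun θ : ℝ => Φ (x + θ • v)) (L v) 0 := by
  have hγ : HasDerivAt (fun θ : ℝ => x + θ • v) v 0 := by
    simpa using ((hasDerivAt_id (0 : ℝ)).smul_const v).const_add x
  refine hL.comp_hasDerivAt_of_eq (0 : ℝ) hγ (eventually_mem_interiorProfiles hγ.continuousAt
    (by simpa using hx) (Eventually.of_forall fun θ i => ?_)) (by simp)
  simp [Finset.sum_add_distrib, ← Finset.mul_sum, hv, (hx.1 i).2]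

/-- By concavity every difference quotient on the segment towards `w` dominates the full increment;
then the step tends to zero. Only concavity in the action of player `i` enters. -/
theorem sub_le_fderiv_of_concaveOn {Φ : (∀ i, A i → ℝ) → ℝ} {L : (∀ i, A i → ℝ) →L[ℝ] ℝ}
    {x : ∀ i, A i → ℝ} (hx : x ∈ interiorProfiles A)
    (hL : HasFDerivWithinAt Φ L (interiorProfiles A) x) {i : I}
    (hc : ConcaveOn ℝ (stdSimplex ℝ (A i)) fun y => Φ (Function.update x i y))
    {w : A i → ℝ} (hw : w ∈ stdSimplex ℝ (A i)) :
    Φ (Function.update x i w) - Φ x ≤ L (Pi.single i (w - x i)) := by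
  have hd := hasDerivAt_line hx hL (v := Pi.single i (w - x i)) (fun j => by
    rcases eq_or_ne j i with rfl | hj
    · simp [hw.2, (hx.1 j).2]
    · simp [hj])
  have ht := hd.tendsto_slope_zero_right
  refine ge_of_tendsto ht ?_
  have hmem : Ioc (0 : ℝ) 1 ∈ 𝓝[>] (0 : ℝ) := Ioc_mem_nhdsGT one_pos
  filter_upwards [hmem] with θ hθ
  have h1 := hc.2 (hx.1 i) hw (sub_nonneg.2 hθ.2) hθ.1.le (by ring)
  simp only [smul_eq_mul, zero_add, zero_smul, add_zero, Function.update_eq_self] at h1 ⊢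
  rw [add_smul_single_eq_update, inv_mul_eq_div, le_div_iff₀ hθ.1]
  linarith

theorem fderiv_le_sub_of_convexOn {Φ : (∀ i, A i → ℝ) → ℝ} {L : (∀ i, A i → ℝ) →L[ℝ] ℝ}
    {x : ∀ i, A i → ℝ} (hx : x ∈ interiorProfiles A)
    (hL : HasFDerivWithinAt Φ L (interiorProfiles A) x) {i : I}
    (hc : ConvexOn ℝ (stdSimplex ℝ (A i)) fun y => Φ (Function.update x i y))
    {w : A i → ℝ} (hw : w ∈ stdSimplex ℝ (A i)) :
    L (Pi.single i (w - x i)) ≤ Φ (Function.update x i w) - Φ x := by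
  have := sub_le_fderiv_of_concaveOn hx hL.fun_neg (i := i) hc.neg hw
  simp only [neg_apply] at this
  linarith

/-! ### Steep regularizers -/

namespace IsRegularizer

variable {h : I → (∀ i, A i → ℝ) → ℝ}

theorem exists_bound (hreg : IsRegularizer h) :
    ∃ H : ℝ, 0 ≤ H ∧ ∀ i, ∀ x ∈ mixedProfiles A, |h i x| ≤ H := by
  have : ∀ i, ∃ C, ∀ x ∈ mixedProfiles A, ‖h i x‖ ≤ C := fun i =>
    isCompact_mixedProfiles.exists_bound_of_continuousOn (hreg.continuousOn i)
  choose C hC using this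
  refine ⟨∑ i, |C i|, Finset.sum_nonneg fun _ _ => abs_nonneg _, fun i x hx => ?_⟩
  exact ((hC i x hx).trans (le_abs_self _)).trans
    (Finset.single_le_sum (f := fun i => |C i|) (fun _ _ => abs_nonneg _) (Finset.mem_univ i))

theorem exists_hasFDerivWithinAt (hreg : IsRegularizer h) (i : I) {x : ∀ i, A i → ℝ}
    (hx : x ∈ interiorProfiles A) :
    ∃ L : (∀ i, A i → ℝ) →L[ℝ] ℝ, HasFDerivWithinAt (h i) L (interiorProfiles A) x :=
  ((hreg.contDiffOn i).differentiableOn one_ne_zero) x hx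

/-- Profiles with all weights at least `ρ` form a compact convex subset of the interior, on which C¹
functions are Lipschitz. Steepness rules out a bound on the whole of the simplices. -/
theorem exists_lipschitz (hreg : IsRegularizer h) {ρ : ℝ} (hρ : 0 < ρ) :
    ∃ C : ℝ, 0 ≤ C ∧ ∀ i, ∀ x ∈ mixedProfiles A, (∀ j a, ρ ≤ x j a) →
      ∀ y ∈ mixedProfiles A, (∀ j a, ρ ≤ y j a) → |h i x - h i y| ≤ C * dist x y := by
  set K : Set (∀ i, A i → ℝ) := mixedProfiles A ∩ {x | ∀ j a, ρ ≤ x j a} with hK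
  have hcl : IsClosed {x : ∀ i, A i → ℝ | ∀ j a, ρ ≤ x j a} := by
    simp only [Set.ofPred_forall]
    exact isClosed_iInter fun j => isClosed_iInter fun a =>
      isClosed_le continuous_const (by fun_prop)
  have hconv : Convex ℝ {x : ∀ i, A i → ℝ | ∀ j a, ρ ≤ x j a} := by
    intro x hx y hy p q hp hq hpq j a
    have h1 := mul_le_mul_of_nonneg_left (hx j a) hp
    have h2 := mul_le_mul_of_nonneg_left (hy j a) hq
    simp only [Pi.add_apply, Pi.smul_apply, smul_eq_mul]
    calc ρ = p * ρ + q * ρ := by rw [← add_mul, hpq, one_mul]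
      _ ≤ _ := add_le_add h1 h2
  have hLip : ∀ i, ∃ C, LipschitzOnWith C (h i) K := fun i =>
    ((hreg.contDiffOn i).mono fun x hx => ⟨hx.1, fun j a => hρ.trans_le (hx.2 j a)⟩)
      |>.exists_lipschitzOnWith one_ne_zero ((convex_mixedProfiles (A := A)).inter hconv)
        (isCompact_mixedProfiles.inter_right hcl)
  choose C hC using hLip
  refine ⟨∑ i, (C i : ℝ), Finset.sum_nonneg fun _ _ => NNReal.coe_nonneg _, ?_⟩
  intro i x hx hx' y hy hy'
  have h1 := (hC i).dist_le_mul x ⟨hx, hx'⟩ y ⟨hy, hy'⟩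
  rw [Real.dist_eq] at h1
  refine h1.trans (mul_le_mul_of_nonneg_right ?_ dist_nonneg)
  exact Finset.single_le_sum (f := fun i => (C i : ℝ)) (fun _ _ => NNReal.coe_nonneg _)
    (Finset.mem_univ i)

/-- The scale is the inverse of the number of actions because coordinates of `v` are at most one.
The point lies opposite to a steep direction `v`, seen from the center. -/
theorem _root_.uniform_sub_smul_mem_stdSimplex {B : Type*} [Fintype B] [Nonempty B] {v : B → ℝ}
    (hv : ∑ a, v a = 0) (hv1 : ‖v‖ ≤ 1) :
    (fun _ : B => (Fintype.card B : ℝ)⁻¹) - (Fintype.card B : ℝ)⁻¹ • v ∈ stdSimplex ℝ B := by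
  have hn : 0 < (Fintype.card B : ℝ) := by exact_mod_cast Fintype.card_pos
  constructor
  · intro a
    have h1 : v a ≤ 1 := (le_abs_self _).trans ((norm_le_pi_norm v a).trans hv1)
    simp only [Pi.sub_apply, Pi.smul_apply, smul_eq_mul]
    have := mul_le_mul_of_nonneg_left h1 (inv_nonneg.2 hn.le)
    linarith
  · simp [Finset.sum_sub_distrib, ← Finset.mul_sum, hv, hn.ne']

/-- Near the boundary, moving towards the center of the simplex increases a steep regularizer at
an arbitrarily large rate. -/
theorem exists_inward_gain (hreg : IsRegularizer h) (i : I) {K : ℝ} (hK : 0 ≤ K) :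
    ∃ ρ > 0, ∀ x ∈ mixedProfiles A, (∃ a, x i a < ρ) → ∃ c ∈ stdSimplex ℝ (A i),
      ∃ θ : ℝ, 0 < θ ∧ θ ≤ 1 ∧
        h i x + θ * K ≤ h i (Function.update x i ((1 - θ) • x i + θ • c)) := by
  obtain ⟨H, hH0, hH⟩ := hreg.exists_bound
  set n : ℝ := (Fintype.card (A i) : ℝ) with hn
  obtain ⟨ρ₀, hρ₀, hsteep⟩ := hreg.steep i (n * (K + 2 * H))
  -- `θ` serves both as threshold and as step length: a weight below `θ` stays below `2θ ≤ ρ₀` after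
  -- the step, so the end point is still in the steep region.
  set θ : ℝ := min ρ₀ 1 / 2 with hθ
  have hθ0 : 0 < θ := by positivity
  have hθ1 : θ ≤ 1 / 2 := by rw [hθ]; linarith [min_le_right ρ₀ 1]
  have hθ2 : θ + θ ≤ ρ₀ := by rw [hθ]; linarith [min_le_left ρ₀ 1]
  refine ⟨θ, hθ0, fun x hx ⟨a, ha⟩ => ?_⟩
  have hne : ∀ j, Nonempty (A j) := fun j => by
    by_contra hem
    rw [not_nonempty_iff] at hem
    simpa using (hx j).2
  have hn0 : 0 < n := by rw [hn]; exact_mod_cast Fintype.card_pos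
  set C : ∀ j, A j → ℝ := fun j _ => (Fintype.card (A j) : ℝ)⁻¹ with hC
  have hCpos : ∀ j b, 0 < C j b := fun j b => by simp [hC, Fintype.card_pos]
  have hCmem : C ∈ mixedProfiles A := fun j => by
    simpa using uniform_sub_smul_mem_stdSimplex (B := A j) (v := 0) (by simp) (by simp)
  refine ⟨C i, hCmem i, θ, hθ0, by linarith, ?_⟩
  set bθ : A i → ℝ := (1 - θ) • x i + θ • C i with hbθ
  have hbθmem : bθ ∈ stdSimplex ℝ (A i) :=
    convex_stdSimplex ℝ (A i) (hx i) (hCmem i) (by linarith) hθ0.le (by ring)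
  have hbθpos : ∀ b, 0 < bθ b := fun b => by
    have h1 := mul_nonneg (show 0 ≤ 1 - θ by linarith) ((hx i).1 b)
    have h2 := mul_pos hθ0 (hCpos i b)
    simp only [hbθ, Pi.add_apply, Pi.smul_apply, smul_eq_mul]
    linarith
  have hbθa : bθ a < ρ₀ := by
    have h1 := mul_nonneg hθ0.le ((hx i).1 a)
    have h2 := mul_le_mul_of_nonneg_left (mixedProfiles_le_one hCmem i a) hθ0.le
    simp only [hbθ, Pi.add_apply, Pi.smul_apply, smul_eq_mul]
    linarith
  -- approximation of the other components by interior points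
  set y : ℝ → ∀ j, A j → ℝ := fun μ => (1 - μ) • x + μ • C with hy
  have hymem : ∀ μ ∈ Ioo (0 : ℝ) 1, y μ ∈ mixedProfiles A := fun μ hμ =>
    convex_mixedProfiles hx hCmem (by linarith [hμ.2]) hμ.1.le (by ring)
  have key : ∀ μ ∈ Ioo (0 : ℝ) 1, h i (Function.update (y μ) i (x i)) + θ * K ≤
      h i (Function.update (y μ) i bθ) := by
    intro μ hμ
    set z := Function.update (y μ) i bθ with hz
    have hzi : z i = bθ := by simp [hz]
    have hzint : z ∈ interiorProfiles A := by
      refine ⟨update_mem_mixedProfiles (hymem μ hμ) hbθmem, fun j b => ?_⟩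
      rcases eq_or_ne j i with rfl | hj
      · rw [hzi]; exact hbθpos b
      · have h1 := mul_nonneg (show 0 ≤ 1 - μ by linarith [hμ.2]) ((hx j).1 b)
        have h2 := mul_pos hμ.1 (hCpos j b)
        simp only [hz, hy, Function.update_of_ne hj, Pi.add_apply, Pi.smul_apply, smul_eq_mul]
        linarith
    obtain ⟨L, hL⟩ := hreg.exists_hasFDerivWithinAt i hzint
    obtain ⟨v, hv0, hv1, hvM⟩ := hsteep z hzint ⟨a, by rw [hzi]; exact hbθa⟩
    have hLv : lineDeriv ℝ (h i) z (Pi.single i v) = L (Pi.single i v : ∀ j, A j → ℝ) :=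
      (hasDerivAt_line hzint hL (fun j => by
        rcases eq_or_ne j i with rfl | hj
        · simp [hv0]
        · simp [hj])).deriv
    rw [hLv] at hvM
    have hconc := (hreg.strictConcave i z hzint.1).concaveOn
    -- Two tangent inequalities at the end point `z` of the step. Towards the point opposite to `v`,
    -- the increment is at least `-2H`, so the slope towards the center is at least `(K + 2H) - 2H =
    -- K`. Towards `x i`, which lies exactly backwards, this slope becomes the gain.
    have h1 := sub_le_fderiv_of_concaveOn hzint hL hconc
      (uniform_sub_smul_mem_stdSimplex hv0 hv1)
    have h2 := sub_le_fderiv_of_concaveOn hzint hL hconc (hx i)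
    rw [hzi] at h1 h2
    have e1 : (Pi.single i ((fun _ : A i => (Fintype.card (A i) : ℝ)⁻¹) -
        (Fintype.card (A i) : ℝ)⁻¹ • v - bθ) : ∀ j, A j → ℝ) =
        Pi.single i (C i - bθ) - n⁻¹ • (Pi.single i v : ∀ j, A j → ℝ) := by
      rw [← Pi.single_smul, ← Pi.single_sub]
      congr 1
      simp only [hC, hn]
      abel
    have e2 : (Pi.single i (x i - bθ) : ∀ j, A j → ℝ) =
        -((θ / (1 - θ)) • Pi.single i (C i - bθ)) := by
      rw [← Pi.single_smul, ← Pi.single_neg]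
      congr 1
      funext b
      simp only [hbθ, Pi.add_apply, Pi.sub_apply, Pi.neg_apply, Pi.smul_apply, smul_eq_mul]
      have : 1 - θ ≠ 0 := by linarith
      field_simp
      ring
    rw [e1, map_sub, map_smul, smul_eq_mul] at h1
    rw [e2, map_neg, map_smul, smul_eq_mul, hz, Function.update_idem, ← hz] at h2
    rw [hz, Function.update_idem, ← hz] at h1
    have h3 := abs_le.1 (hH i _ hzint.1)
    have h4 := abs_le.1 (hH i _ (update_mem_mixedProfiles (hymem μ hμ)
      (uniform_sub_smul_mem_stdSimplex hv0 hv1)))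
    have h5 : K + 2 * H ≤ n⁻¹ * L (Pi.single i v : ∀ j, A j → ℝ) := by
      rw [inv_mul_eq_div, le_div_iff₀ hn0]
      linarith
    have h6 : K ≤ L (Pi.single i (C i - bθ) : ∀ j, A j → ℝ) := by linarith [h3.2, h4.1]
    have h7 : θ ≤ θ / (1 - θ) := by
      rw [le_div_iff₀ (by linarith)]
      nlinarith
    have h8 : θ * K ≤ θ / (1 - θ) * L (Pi.single i (C i - bθ) : ∀ j, A j → ℝ) :=
      mul_le_mul h7 h6 hK (hθ0.le.trans h7)
    linarith
  -- passage to the limit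
  have hlim : ∀ w ∈ stdSimplex ℝ (A i), Tendsto (fun μ => h i (Function.update (y μ) i w))
      (𝓝[>] 0) (𝓝 (h i (Function.update x i w))) := by
    intro w hw
    have h1 : Tendsto (fun μ : ℝ => Function.update (y μ) i w) (𝓝[>] 0)
        (𝓝 (Function.update x i w)) := by
      have : Continuous fun μ : ℝ => Function.update (y μ) i w := by
        simp only [hy]; fun_prop
      have h2 := this.tendsto 0
      simp only [hy, sub_zero, one_smul, zero_smul, add_zero] at h2
      exact h2.mono_left nhdsWithin_le_nhds
    refine (hreg.continuousOn i _ (update_mem_mixedProfiles hx hw)).tendsto.comp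
      (tendsto_nhdsWithin_iff.2 ⟨h1, ?_⟩)
    filter_upwards [Ioo_mem_nhdsGT one_pos] with μ hμ
    exact update_mem_mixedProfiles (hymem μ hμ) hw
  have hfin := le_of_tendsto_of_tendsto ((hlim (x i) (hx i)).add_const (θ * K)) (hlim bθ hbθmem)
    (by filter_upwards [Ioo_mem_nhdsGT one_pos] with μ hμ using key μ hμ)
  simpa using hfin

/-- Regularized best responses against bounded payoffs stay away from the boundary. -/
theorem exists_le_bestResponse (hreg : IsRegularizer h) {ε : ℝ} (hε : 0 < ε) (M : ℝ) :
    ∃ ρ > 0, ∀ i, ∀ f : (∀ i, A i) → ℝ, (∀ a, |f a| ≤ M) → ∀ x ∈ mixedProfiles A, ∀ b,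
      IsBestResponse (fun x => mixedExt f x + ε * h i x) i x b → ∀ a, ρ ≤ b a := by
  have main : ∀ i, ∃ ρ > 0, ∀ f : (∀ i, A i) → ℝ, (∀ a, |f a| ≤ M) → ∀ x ∈ mixedProfiles A,
      ∀ b, IsBestResponse (fun x => mixedExt f x + ε * h i x) i x b → ∀ a, ρ ≤ b a := by
    intro i
    -- The unregularized payoff is affine in the own action, so a step of size `θ` costs at most
    -- `2θ|M|`, while the regularization term gains `θ(2|M| + 1)`.
    obtain ⟨ρ, hρ, hgain⟩ := hreg.exists_inward_gain i (K := (2 * |M| + 1) / ε) (by positivity)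
    refine ⟨ρ, hρ, fun f hf x hx b hb a => ?_⟩
    by_contra! hlt
    have hx' := update_mem_mixedProfiles hx hb.1
    obtain ⟨c, hc, θ, hθ0, hθ1, hg⟩ := hgain _ hx' ⟨a, by simpa using hlt⟩
    have hmax := hb.2 ((1 - θ) • b + θ • c)
      (convex_stdSimplex ℝ (A i) hb.1 hc (by linarith) hθ0.le (by ring))
    simp only [Function.update_self, Function.update_idem] at hg
    simp only [mixedExt_update_combo] at hmax
    have hf' : ∀ a, |f a| ≤ |M| := fun a => (hf a).trans (le_abs_self M)
    have h1 := abs_le.1 (abs_mixedExt_le hf' hx')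
    have h2 := abs_le.1 (abs_mixedExt_le hf' (update_mem_mixedProfiles hx hc))
    have h3 := mul_le_mul_of_nonneg_left hg hε.le
    have h4 : ε * (θ * ((2 * |M| + 1) / ε)) = θ * (2 * |M| + 1) := by field_simp
    rw [mul_add, h4] at h3
    nlinarith [mul_le_mul_of_nonneg_left h1.2 hθ0.le, mul_le_mul_of_nonneg_left h2.1 hθ0.le]
  choose ρ hρ hmain using main
  rcases isEmpty_or_nonempty I with hI | hI
  · exact ⟨1, one_pos, fun i => hI.elim i⟩
  · refine ⟨⨅ i, ρ i, ?_, fun i f hf x hx b hb a =>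
      (ciInf_le (Set.finite_range ρ).bddBelow i).trans (hmain i f hf x hx b hb a)⟩
    obtain ⟨i, hi⟩ := exists_eq_ciInf_of_finite (f := ρ)
    rw [← hi]
    exact hρ i

end IsRegularizer

end Static

/-! ### Discounted payoffs and one-stage comparisons -/

namespace StochasticGame

variable {S : Type*} [Fintype S] {I : Type*} [Fintype I] [DecidableEq I]
  {A : I → Type*} [∀ i, Fintype (A i)]

theorem sum_trans_mul_le {p f : S → ℝ} {c : ℝ} (hp : p ∈ stdSimplex ℝ S) (hf : ∀ s, f s ≤ c) :
    ∑ s, p s * f s ≤ c := by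
  calc ∑ s, p s * f s ≤ ∑ s, p s * c :=
        Finset.sum_le_sum fun s _ => mul_le_mul_of_nonneg_left (hf s) (hp.1 s)
    _ = c := by rw [← Finset.sum_mul, hp.2, one_mul]

theorem le_sum_trans_mul {p f : S → ℝ} {c : ℝ} (hp : p ∈ stdSimplex ℝ S) (hf : ∀ s, c ≤ f s) :
    c ≤ ∑ s, p s * f s := by
  have := sum_trans_mul_le (f := fun s => - f s) (c := -c) hp fun s => neg_le_neg (hf s)
  simp only [mul_neg, Finset.sum_neg_distrib] at this
  linarith

theorem abs_sum_trans_mul_le {p f : S → ℝ} {c : ℝ} (hp : p ∈ stdSimplex ℝ S)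
    (hf : ∀ s, |f s| ≤ c) : |∑ s, p s * f s| ≤ c :=
  abs_le.2 ⟨le_sum_trans_mul hp fun s => (abs_le.1 (hf s)).1,
    sum_trans_mul_le hp fun s => (abs_le.1 (hf s)).2⟩

variable (G : StochasticGame S I A) {g : S → (∀ i, A i → ℝ) → ℝ}
  {σ : List (S × (∀ i, A i)) → S → (∀ i, A i → ℝ)}

theorem expStagePayoff_neg (n : ℕ) (hist : List (S × (∀ i, A i))) (s : S) :
    G.expStagePayoff (fun s x => - g s x) σ n hist s = - G.expStagePayoff g σ n hist s := by
  induction n generalizing hist s with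
  | zero => rfl
  | succ n ih => simp [expStagePayoff, ih]

theorem expStagePayoff_succ (n : ℕ) (hist : List (S × (∀ i, A i))) (s : S) :
    G.expStagePayoff g σ (n + 1) hist s = mixedExt (fun a => ∑ s', G.trans s a s' *
      G.expStagePayoff g σ n (hist ++ [(s, a)]) s') (σ hist s) := rfl

theorem abs_expStagePayoff_le {B : ℝ} (hσ : ∀ hist s, σ hist s ∈ mixedProfiles A)
    (hg : ∀ s, ∀ x ∈ mixedProfiles A, |g s x| ≤ B) (n : ℕ) (hist : List (S × (∀ i, A i)))
    (s : S) : |G.expStagePayoff g σ n hist s| ≤ B := by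
  induction n generalizing hist s with
  | zero => exact hg s _ (hσ hist s)
  | succ n ih =>
    rw [expStagePayoff_succ]
    exact abs_mixedExt_le (fun a => abs_sum_trans_mul_le (G.trans_mem s a) fun s' => ih _ _)
      (hσ hist s)

/-- Iteration of a Bellman inequality with an error `c` per stage. The induction peels off the first
stage, hence the arbitrary history; `B` accounts for dropping the continuation after stage `N` and
disappears as `N` grows. -/
theorem sum_expStagePayoff_le {U : S → ℝ} {c B : ℝ}
    (hσ : ∀ hist s, σ hist s ∈ mixedProfiles A) (hU : ∀ s, -U s ≤ B)
    (hstep : ∀ hist s, g s (σ hist s) +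
      G.disc * mixedExt (fun a => ∑ s', G.trans s a s' * U s') (σ hist s) ≤ U s + c)
    (N : ℕ) (hist : List (S × (∀ i, A i))) (s : S) :
    ∑ n ∈ Finset.range N, G.disc ^ n * G.expStagePayoff g σ n hist s ≤
      U s + c * (1 - G.disc ^ N) / (1 - G.disc) + G.disc ^ N * B := by
  have hδ0 := G.disc_mem.1
  have hδ1 : 0 < 1 - G.disc := sub_pos.2 G.disc_mem.2
  induction N generalizing hist s with
  | zero => simpa using by linarith [hU s]
  | succ N ih =>
    set C : ℝ := c * (1 - G.disc ^ N) / (1 - G.disc) + G.disc ^ N * B with hC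
    have h1 : ∑ n ∈ Finset.range (N + 1), G.disc ^ n * G.expStagePayoff g σ n hist s =
        g s (σ hist s) + G.disc * mixedExt (fun a => ∑ s', G.trans s a s' *
          ∑ n ∈ Finset.range N, G.disc ^ n *
            G.expStagePayoff g σ n (hist ++ [(s, a)]) s') (σ hist s) := by
      rw [Finset.sum_range_succ', add_comm]
      congr 1
      · simp [expStagePayoff]
      · simp only [expStagePayoff_succ, mixedExt, Finset.mul_sum]
        rw [Finset.sum_comm]
        refine Finset.sum_congr rfl fun a _ => ?_
        rw [Finset.sum_comm]
        refine Finset.sum_congr rfl fun s' _ => Finset.sum_congr rfl fun n _ => ?_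
        ring
    have h2 : mixedExt (fun a => ∑ s', G.trans s a s' * ∑ n ∈ Finset.range N, G.disc ^ n *
            G.expStagePayoff g σ n (hist ++ [(s, a)]) s') (σ hist s) ≤
        mixedExt (fun a => ∑ s', G.trans s a s' * U s' + C) (σ hist s) := by
      refine mixedExt_mono (fun a => ?_) (hσ hist s)
      have : ∑ s', G.trans s a s' * U s' + C = ∑ s', G.trans s a s' * (U s' + C) := by
        simp only [mul_add, Finset.sum_add_distrib, ← Finset.sum_mul, (G.trans_mem s a).2, one_mul]
      rw [this]
      refine Finset.sum_le_sum fun s' _ =>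
        mul_le_mul_of_nonneg_left ?_ ((G.trans_mem s a).1 s')
      rw [hC, ← add_assoc]
      exact ih _ _
    rw [mixedExt_add, mixedExt_const _ (hσ hist s)] at h2
    have h3 := mul_le_mul_of_nonneg_left h2 hδ0.le
    have h4 := hstep hist s
    have h5 : G.disc * C + c = c * (1 - G.disc ^ (N + 1)) / (1 - G.disc) + G.disc ^ (N + 1) * B := by
      rw [hC]
      field_simp
      ring
    rw [h1]
    linarith

theorem summable_discounted {B : ℝ} (hσ : ∀ hist s, σ hist s ∈ mixedProfiles A)
    (hg : ∀ s, ∀ x ∈ mixedProfiles A, |g s x| ≤ B) (s : S) :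
    Summable fun n => G.disc ^ n * G.expStagePayoff g σ n [] s := by
  refine Summable.of_norm_bounded (g := fun n => G.disc ^ n * B)
    ((summable_geometric_of_lt_one G.disc_mem.1.le G.disc_mem.2).mul_right B) fun n => ?_
  rw [Real.norm_eq_abs, abs_mul, abs_of_nonneg (pow_nonneg G.disc_mem.1.le n)]
  exact mul_le_mul_of_nonneg_left (G.abs_expStagePayoff_le hσ hg n [] s)
    (pow_nonneg G.disc_mem.1.le n)

theorem discountedPayoff_le {U : S → ℝ} {c B : ℝ}
    (hσ : ∀ hist s, σ hist s ∈ mixedProfiles A)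
    (hg : ∀ s, ∀ x ∈ mixedProfiles A, |g s x| ≤ B)
    (hstep : ∀ hist s, g s (σ hist s) +
      G.disc * mixedExt (fun a => ∑ s', G.trans s a s' * U s') (σ hist s) ≤ U s + c) (s : S) :
    G.discountedPayoff g σ s ≤ U s + c / (1 - G.disc) := by
  have hU : ∀ s, -U s ≤ ∑ s, |U s| := fun s => (neg_le_abs _).trans
    (Finset.single_le_sum (f := fun s => |U s|) (fun _ _ => abs_nonneg _) (Finset.mem_univ s))
  have hpow := tendsto_pow_atTop_nhds_zero_of_lt_one G.disc_mem.1.le G.disc_mem.2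
  have hlim : Tendsto (fun N : ℕ => U s + c * (1 - G.disc ^ N) / (1 - G.disc) +
      G.disc ^ N * ∑ s, |U s|) atTop (𝓝 (U s + c / (1 - G.disc))) := by
    have := ((((hpow.const_sub 1).const_mul c).div_const (1 - G.disc)).const_add (U s)).add
      (hpow.mul_const (∑ s, |U s|))
    simpa using this
  exact le_of_tendsto_of_tendsto' (G.summable_discounted hσ hg s).hasSum.tendsto_sum_nat hlim
    fun N => G.sum_expStagePayoff_le hσ hU hstep N [] s

theorem le_discountedPayoff {U : S → ℝ} {c B : ℝ}
    (hσ : ∀ hist s, σ hist s ∈ mixedProfiles A)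
    (hg : ∀ s, ∀ x ∈ mixedProfiles A, |g s x| ≤ B)
    (hstep : ∀ hist s, U s - c ≤ g s (σ hist s) +
      G.disc * mixedExt (fun a => ∑ s', G.trans s a s' * U s') (σ hist s)) (s : S) :
    U s - c / (1 - G.disc) ≤ G.discountedPayoff g σ s := by
  have h := G.discountedPayoff_le (g := fun s x => - g s x) (U := fun s => - U s) (c := c) hσ
    (B := B) (fun s x hx => by rw [abs_neg]; exact hg s x hx) (fun hist s => by
      have h1 := mixedExt_const_mul (-1) (fun a => ∑ s', G.trans s a s' * U s') (σ hist s)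
      simp only [neg_mul, one_mul] at h1
      simp only [mul_neg, Finset.sum_neg_distrib, h1]
      linarith [hstep hist s]) s
  have h2 : G.discountedPayoff (fun s x => - g s x) σ s = - G.discountedPayoff g σ s := by
    simp [discountedPayoff, expStagePayoff_neg, tsum_neg]
  linarith

/-- The regularized auxiliary payoff of player `i` in state `s` with continuation payoffs `u`. -/
def regAux (G : StochasticGame S I A) (h : I → (∀ i, A i → ℝ) → ℝ) (ε : ℝ) (u : S → ℝ) (i : I)
    (s : S) (x : ∀ i, A i → ℝ) : ℝ :=
  auxPayoff G.disc (G.reward i s) (G.trans s) u x + ε * h i x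

/-- Change of normalization: the dynamics weight stage rewards by `1 - δ`, so `u` corresponds to `1
- δ` times a total discounted payoff, and the weight `ε` of the regularizer becomes `ε / (1 - δ)`.
-/
theorem regAux_eq (h : I → (∀ i, A i → ℝ) → ℝ) (ε : ℝ) (u : S → ℝ) (i : I) (s : S)
    (x : ∀ i, A i → ℝ) : G.regAux h ε u i s x = (1 - G.disc) *
      (G.perturbedPayoff h (ε / (1 - G.disc)) i s x +
        G.disc * mixedExt (fun a => ∑ s', G.trans s a s' * (u s' / (1 - G.disc))) x) := by
  have hδ1 : 1 - G.disc ≠ 0 := (sub_pos.2 G.disc_mem.2).ne'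
  have h1 : mixedExt (fun a => ∑ s', G.trans s a s' * (u s' / (1 - G.disc))) x =
      (1 - G.disc)⁻¹ * mixedExt (fun a => ∑ s', G.trans s a s' * u s') x := by
    rw [← mixedExt_const_mul]
    congr 1
    funext a
    rw [Finset.mul_sum]
    exact Finset.sum_congr rfl fun s' _ => by ring
  rw [regAux, auxPayoff, mixedExt_add, mixedExt_const_mul, mixedExt_const_mul, h1, perturbedPayoff]
  field_simp
  ring

/-- A stationary profile whose components are approximate equilibria of the auxiliary games and
whose auxiliary payoffs are close to the continuation payoffs is an approximate equilibrium. -/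
theorem mem_regularizedEquilibria {h : I → (∀ i, A i → ℝ) → ℝ} (hreg : IsRegularizer h) {ε κ : ℝ}
    {x : S → ∀ i, A i → ℝ} (hx : ∀ s, x s ∈ mixedProfiles A) {u : I → S → ℝ} {κ₁ κ₂ : ℝ}
    (h1 : ∀ i s, ∀ y ∈ stdSimplex ℝ (A i),
      G.regAux h ε (u i) i s (Function.update (x s) i y) ≤ u i s + κ₁)
    (h2 : ∀ i s, u i s - κ₂ ≤ G.regAux h ε (u i) i s (x s))
    (hκ : (κ₁ + κ₂) / (1 - G.disc) ^ 2 ≤ κ) :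
    x ∈ G.regularizedEquilibria h (ε / (1 - G.disc)) κ := by
  have hδ1 : 0 < 1 - G.disc := sub_pos.2 G.disc_mem.2
  refine ⟨hx, fun i τ hτ s₀ => ?_⟩
  obtain ⟨H, hH0, hH⟩ := hreg.exists_bound
  have hg : ∀ s, ∀ x ∈ mixedProfiles A, |G.perturbedPayoff h (ε / (1 - G.disc)) i s x| ≤
      (∑ s, ∑ a, |G.reward i s a|) + |ε / (1 - G.disc)| * H := by
    intro s x hx
    refine (abs_add_le _ _).trans (add_le_add (abs_mixedExt_le (fun a => ?_) hx) ?_)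
    · refine (Finset.single_le_sum (f := fun a => |G.reward i s a|) (fun _ _ => abs_nonneg _)
        (Finset.mem_univ a)).trans ?_
      exact Finset.single_le_sum (f := fun s => ∑ a, |G.reward i s a|)
        (fun _ _ => Finset.sum_nonneg fun _ _ => abs_nonneg _) (Finset.mem_univ s)
    · rw [abs_mul]
      exact mul_le_mul_of_nonneg_left (hH i x hx) (abs_nonneg _)
  -- One factor `1 - δ` in the denominator comes from the normalization of the payoffs, the other
  -- from summing the error per stage over all stages.
  have hup := G.discountedPayoff_le (U := fun s => u i s / (1 - G.disc)) (c := κ₁ / (1 - G.disc))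
    (σ := fun hist s => Function.update (x s) i (τ hist s))
    (fun hist s => update_mem_mixedProfiles (hx s) (hτ hist s)) hg (fun hist s => by
      have := h1 i s _ (hτ hist s)
      rw [regAux_eq] at this
      rw [← add_div, le_div_iff₀ hδ1]
      linarith) s₀
  have hlo := G.le_discountedPayoff (U := fun s => u i s / (1 - G.disc)) (c := κ₂ / (1 - G.disc))
    (σ := fun _ s => x s) (fun _ s => hx s) hg (fun hist s => by
      have := h2 i s
      rw [regAux_eq] at this
      rw [← sub_div, div_le_iff₀ hδ1]
      linarith) s₀
  have e1 : (κ₁ + κ₂) / (1 - G.disc) ^ 2 =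
      κ₁ / (1 - G.disc) / (1 - G.disc) + κ₂ / (1 - G.disc) / (1 - G.disc) := by
    field_simp
  linarith

end StochasticGame

/-! ### Exponential decay and two-sided barriers -/

theorem exists_abs_le_of_finite {κ : Type*} [Finite κ] (f : κ → ℝ) :
    ∃ C : ℝ, 0 ≤ C ∧ ∀ k, |f k| ≤ C := by
  have := Fintype.ofFinite κ
  exact ⟨∑ k, |f k|, Finset.sum_nonneg fun _ _ => abs_nonneg _, fun k =>
    Finset.single_le_sum (f := fun k => |f k|) (fun _ _ => abs_nonneg _) (Finset.mem_univ k)⟩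

namespace LocallyAC

theorem of_lipschitz {f : ℝ → ℝ} {a L : ℝ} (h : ∀ s ≥ a, ∀ t ≥ a, |f s - f t| ≤ L * |s - t|) :
    LocallyAC f a := by
  refine of_abs_sub_le (ι := Unit) (f := fun _ t => t) (fun _ => of_contDiff contDiff_id)
    fun b _ => ⟨L, fun s hs t ht => ?_⟩
  simpa using h s hs.1 t ht.1

/-- The square of `e`, multiplied by the exponential of `2c(t - a)`, is nonincreasing. The rate `k`
is chosen separately at each time, with no regularity; for `c = 0` the conclusion is that the error
never exceeds its initial size. -/
theorem abs_le_exp {e : ℝ → ℝ} {a c : ℝ} (he : LocallyAC e a)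
    (h : ∀ᵐ t, a ≤ t → ∃ k ≥ c, HasDerivAt e (-(k * e t)) t) :
    ∀ t ≥ a, |e t| ≤ |e a| * Real.exp (-(c * (t - a))) := by
  have hac : LocallyAC (fun t => e t * e t * Real.exp (2 * c * (t - a))) a :=
    (he.mul he).mul (of_contDiff (by fun_prop))
  have hanti := hac.antitoneOn (by
    filter_upwards [h] with t ht hat D hD
    obtain ⟨k, hk, hd⟩ := ht hat
    have h1 : HasDerivAt (fun t => Real.exp (2 * c * (t - a)))
        (Real.exp (2 * c * (t - a)) * (2 * c * 1)) t :=
      (((hasDerivAt_id t).sub_const a).const_mul (2 * c)).exp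
    have h2 := (hd.fun_mul hd).fun_mul h1
    rw [hD.unique h2]
    have h3 : 0 ≤ e t * e t * Real.exp (2 * c * (t - a)) * (k - c) :=
      mul_nonneg (mul_nonneg (mul_self_nonneg _) (Real.exp_pos _).le) (sub_nonneg.2 hk)
    linarith)
  intro t ht
  have h1 := hanti self_mem_Ici ht ht
  simp only [sub_self, mul_zero, Real.exp_zero, mul_one] at h1
  refine abs_le_of_sq_le_sq ?_ (by positivity)
  have h2 : (|e a| * Real.exp (-(c * (t - a)))) ^ 2 =
      e a * e a * Real.exp (-(2 * c * (t - a))) := by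
    rw [mul_pow, sq_abs, ← Real.exp_nat_mul, pow_two]
    congr 2
    push_cast
    ring
  rw [h2, Real.exp_neg, ← div_eq_mul_inv, le_div_iff₀ (Real.exp_pos _), pow_two]
  exact h1

variable {κ : Type*} [Finite κ]

/-- Doubling the family by signs reduces bounds on absolute values to the one-sided barriers. The
products `f k t * D` in the next lemmas state the inward drift for both signs at once. -/
theorem signed {f : κ → ℝ → ℝ} {a : ℝ} (hf : ∀ k, LocallyAC (f k) a) (k : κ × Bool) :
    LocallyAC (fun t => cond k.2 (f k.1 t) (-f k.1 t)) a := by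
  obtain ⟨k, _ | _⟩ := k
  · exact (hf k).neg
  · exact hf k

theorem signed_deriv_le {f : κ → ℝ → ℝ} {t K m : ℝ} (hK : 0 ≤ K)
    (h : ∀ k D, HasDerivAt (f k) D t → K < |f k t| →
      (∀ l, |f l t| ≤ |f k t|) → f k t * D ≤ -(m * |f k t|))
    (k : κ × Bool) (D : ℝ) (hD : HasDerivAt (fun t => cond k.2 (f k.1 t) (-f k.1 t)) D t)
    (hk : K < cond k.2 (f k.1 t) (-f k.1 t))
    (hl : ∀ l : κ × Bool, cond l.2 (f l.1 t) (-f l.1 t) ≤ cond k.2 (f k.1 t) (-f k.1 t)) :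
    D ≤ - m := by
  have hl' : ∀ l, |f l t| ≤ cond k.2 (f k.1 t) (-f k.1 t) := fun l =>
    abs_le'.2 ⟨hl (l, true), hl (l, false)⟩
  obtain ⟨k, _ | _⟩ := k
  · simp only [cond_false] at hD hk hl'
    have habs : |f k t| = - f k t := abs_of_nonpos (by linarith)
    have := h k (-D) (by simpa using hD.fun_neg) (by rwa [habs]) (by rwa [habs])
    rw [habs] at this
    have h0 : 0 < - f k t := by linarith
    by_contra! hlt
    nlinarith
  · simp only [cond_true] at hD hk hl'
    have habs : |f k t| = f k t := abs_of_nonneg (by linarith)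
    have := h k D hD (by rwa [habs]) (by rwa [habs])
    rw [habs] at this
    have h0 : 0 < f k t := by linarith
    by_contra! hlt
    nlinarith

theorem abs_le_of_barrier {f : κ → ℝ → ℝ} {a K : ℝ} (hf : ∀ k, LocallyAC (f k) a) (hK : 0 ≤ K)
    (h0 : ∀ k, |f k a| ≤ K)
    (h : ∀ᵐ t, a ≤ t → ∀ k D, HasDerivAt (f k) D t → K < |f k t| →
      (∀ l, |f l t| ≤ |f k t|) → f k t * D ≤ 0) :
    ∀ t ≥ a, ∀ k, |f k t| ≤ K := by
  have := le_of_barrier (K := K) (signed hf)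
    (by
      rintro ⟨k, _ | _⟩
      · exact (neg_le_abs _).trans (h0 k)
      · exact (le_abs_self _).trans (h0 k))
    (by
      filter_upwards [h] with t ht hat k D hD hk hl
      simpa using signed_deriv_le (m := 0) hK (by simpa using ht hat) k D hD hk hl)
  exact fun t ht k => abs_le'.2 ⟨this t ht (k, true), this t ht (k, false)⟩

theorem eventually_abs_le {f : κ → ℝ → ℝ} {a K c : ℝ} {γ : ℝ → ℝ}
    (hf : ∀ k, LocallyAC (f k) a) (hK : 0 ≤ K) (hc : 0 < c) (hγ : ∀ t ≥ a, 0 ≤ γ t)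
    (hint : ∀ t ≥ a, IntervalIntegrable γ volume a t)
    (hlim : Tendsto (fun T => ∫ t in a..T, γ t) atTop atTop)
    (h : ∀ᵐ t, a ≤ t → ∀ k D, HasDerivAt (f k) D t → K < |f k t| →
      (∀ l, |f l t| ≤ |f k t|) → f k t * D ≤ -(c * γ t * |f k t|)) :
    ∀ᶠ t in atTop, ∀ k, |f k t| ≤ K := by
  have := eventually_le (K := K) (signed hf) hc hγ hint hlim (by
    filter_upwards [h] with t ht hat k D hD hk hl
    exact signed_deriv_le hK (ht hat) k D hD hk hl)
  filter_upwards [this] with t ht k using abs_le'.2 ⟨ht (k, true), ht (k, false)⟩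

end LocallyAC

/-! ### The value update rate -/

namespace IsValueRate

variable {β : ℝ → ℝ}

theorem intervalIntegrable (hβ : IsValueRate β) {s t : ℝ} (hs : 0 ≤ s) (hst : s ≤ t) :
    IntervalIntegrable β volume s t := by
  refine AntitoneOn.intervalIntegrable (hβ.antitone.mono ?_)
  rw [uIcc_of_le hst]
  exact fun τ hτ => hs.trans hτ.1

theorem tendsto_integral (hβ : IsValueRate β) {s : ℝ} (hs : 0 ≤ s) :
    Tendsto (fun T => ∫ t in s..T, β t) atTop atTop := by
  have h1 := tendsto_atTop_add_const_right atTop (-∫ t in (0 : ℝ)..s, β t) hβ.integral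
  refine h1.congr' ?_
  filter_upwards [eventually_ge_atTop s] with T hT
  rw [← intervalIntegral.integral_add_adjacent_intervals (hβ.intervalIntegrable le_rfl hs)
    (hβ.intervalIntegrable hs hT)]
  ring

theorem le_zero (hβ : IsValueRate β) {t : ℝ} (ht : 0 ≤ t) : β t ≤ β 0 :=
  hβ.antitone self_mem_Ici ht ht

end IsValueRate

/-! ### Regularized payoffs along a path of profiles -/

section

variable {I : Type*} [Fintype I] [DecidableEq I] {A : I → Type*} [∀ i, Fintype (A i)]

/-- Derivative along a path of a regularized payoff whose stage payoffs depend on time. -/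
theorem hasDerivAt_mixedExt_add {g : ℝ → (∀ i, A i) → ℝ} {g' : (∀ i, A i) → ℝ} {t ε : ℝ}
    {k : (∀ i, A i → ℝ) → ℝ} {γ : ℝ → ∀ i, A i → ℝ} {w : ∀ i, A i → ℝ}
    {L : (∀ i, A i → ℝ) →L[ℝ] ℝ} (hg : ∀ a, HasDerivAt (fun τ => g τ a) (g' a) t)
    (hγ : HasDerivAt γ w t) (hev : ∀ᶠ τ in 𝓝 t, γ τ ∈ interiorProfiles A)
    (hL : HasFDerivWithinAt (fun x => mixedExt (g t) x + ε * k x) L (interiorProfiles A) (γ t)) :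
    HasDerivAt (fun τ => mixedExt (g τ) (γ τ) + ε * k (γ τ)) (mixedExt g' (γ t) + L w) t := by
  have h1 := hL.comp_hasDerivAt t hγ hev
  -- Subtracting the stage payoffs frozen at time `t` separates the two variations: here the motion
  -- of the profile meets a factor vanishing at `t`, and it is accounted for by `L` alone.
  have h2 : HasDerivAt (fun τ => ∑ a, profileProb (γ τ) a * (g τ a - g t a))
      (mixedExt g' (γ t)) t := by
    refine HasDerivAt.fun_sum fun a _ => ?_
    have h3 := ((contDiff_profileProb a).differentiable one_ne_zero (γ t)).hasFDerivAt
      |>.comp_hasDerivAt t hγ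
    simpa using h3.fun_mul ((hg a).sub_const (g t a))
  refine (h2.fun_add h1).congr_of_eventuallyEq (Eventually.of_forall fun τ => ?_)
  simp only [mixedExt, Function.comp_apply, mul_sub, Finset.sum_sub_distrib]
  ring

theorem exists_hasFDerivWithinAt_regularized {h : I → (∀ i, A i → ℝ) → ℝ} (hreg : IsRegularizer h)
    (f : (∀ i, A i) → ℝ) (ε : ℝ) (i : I) {x : ∀ i, A i → ℝ} (hx : x ∈ interiorProfiles A) :
    ∃ L : (∀ i, A i → ℝ) →L[ℝ] ℝ,
      HasFDerivWithinAt (fun x => mixedExt f x + ε * h i x) L (interiorProfiles A) x := by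
  obtain ⟨L, hL⟩ := hreg.exists_hasFDerivWithinAt i hx
  exact ⟨_, ((contDiff_mixedExt f).differentiable one_ne_zero x).hasFDerivAt.hasFDerivWithinAt.fun_add
    (hL.const_mul ε)⟩

theorem concaveOn_regularized {k : (∀ i, A i → ℝ) → ℝ} (f : (∀ i, A i) → ℝ) {ε : ℝ} (hε : 0 ≤ ε)
    {x : ∀ i, A i → ℝ} {j : I}
    (hk : ConcaveOn ℝ (stdSimplex ℝ (A j)) fun y => k (Function.update x j y)) :
    ConcaveOn ℝ (stdSimplex ℝ (A j)) fun y =>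
      mixedExt f (Function.update x j y) + ε * k (Function.update x j y) := by
  refine ConcaveOn.add ⟨convex_stdSimplex ℝ (A j), fun y _ z _ p q _ _ _ => ?_⟩ (hk.smul hε)
  simp only [mixedExt_update_combo, smul_eq_mul, le_refl]

theorem convexOn_regularized {k : (∀ i, A i → ℝ) → ℝ} (f : (∀ i, A i) → ℝ) {ε : ℝ} (hε : 0 ≤ ε)
    {x : ∀ i, A i → ℝ} {j : I}
    (hk : ConvexOn ℝ (stdSimplex ℝ (A j)) fun y => k (Function.update x j y)) :
    ConvexOn ℝ (stdSimplex ℝ (A j)) fun y =>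
      mixedExt f (Function.update x j y) + ε * k (Function.update x j y) := by
  refine ConvexOn.add ⟨convex_stdSimplex ℝ (A j), fun y _ z _ p q _ _ _ => ?_⟩ (hk.smul hε)
  simp only [mixedExt_update_combo, smul_eq_mul, le_refl]

end

theorem abs_combination_le {S : Type*} [Fintype S] {δ r R m : ℝ} (hδ0 : 0 ≤ δ) (hδ1 : δ ≤ 1)
    {p w : S → ℝ} (hp : p ∈ stdSimplex ℝ S) (hr : |r| ≤ R) (hw : ∀ s, |w s| ≤ m) :
    |(1 - δ) * r + δ * ∑ s, p s * w s| ≤ (1 - δ) * R + δ * m := by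
  refine (abs_add_le _ _).trans (add_le_add ?_ ?_)
  · rw [abs_mul, abs_of_nonneg (sub_nonneg.2 hδ1)]
    exact mul_le_mul_of_nonneg_left hr (sub_nonneg.2 hδ1)
  · rw [abs_mul, abs_of_nonneg hδ0]
    exact mul_le_mul_of_nonneg_left (StochasticGame.abs_sum_trans_mul_le hp hw) hδ0

/-! ### A priori estimates -/

/-- Pure-profile payoffs of the estimated auxiliary game. -/
def MBRDPath.auxStage {S I : Type*} {A : I → Type*} [Fintype S] [Fintype I] [DecidableEq I]
    [∀ i, Fintype (A i)] (z : MBRDPath S I A) (G : StochasticGame S I A)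
    (t : ℝ) (i : I) (s : S) (a : ∀ i, A i) : ℝ :=
  (1 - G.disc) * z.estReward t i s a + G.disc * ∑ s', z.estTrans t s a s' * z.val t i s'

namespace MBRDPath

variable {S : Type*} [Fintype S] {I : Type*} [Fintype I] [DecidableEq I]
  {A : I → Type*} [∀ i, Fintype (A i)]
  {G : StochasticGame S I A} {h : I → (∀ i, A i → ℝ) → ℝ} {ε αmin : ℝ} {β : ℝ → ℝ}
  {z : MBRDPath S I A}

theorem regPayoff_eq (t : ℝ) (i : I) (s : S) (x : ∀ i, A i → ℝ) :
    z.regPayoff G h ε t i s x = mixedExt (z.auxStage G t i s) x + ε * h i x := rfl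

theorem continuousOn_regPayoff (hreg : IsRegularizer h) (t : ℝ) (i : I) (s : S) :
    ContinuousOn (z.regPayoff G h ε t i s) (mixedProfiles A) :=
  (contDiff_mixedExt _).continuous.continuousOn.add
    (continuousOn_const.mul (hreg.continuousOn i))

namespace IsSolution

/-- The sampling rate is only known to be nonnegative here, which is enough for boundedness. A
positive lower bound on it comes from steepness, which in turn requires bounded payoffs. -/
theorem estReward_bound (hα : 0 < αmin) (hz : z.IsSolution G h ε αmin β) :
    ∃ R : ℝ, 0 ≤ R ∧ ∀ t ≥ 0, ∀ i s a, |z.estReward t i s a| ≤ R := by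
  obtain ⟨R₁, hR₁, hr₁⟩ := exists_abs_le_of_finite
    (fun k : I × S × (∀ i, A i) => G.reward k.1 k.2.1 k.2.2)
  obtain ⟨R₂, hR₂, hr₂⟩ := exists_abs_le_of_finite
    (fun k : I × S × (∀ i, A i) =>
      z.estReward 0 k.1 k.2.1 k.2.2 - G.reward k.1 k.2.1 k.2.2)
  refine ⟨R₁ + R₂, by positivity, fun t ht i s a => ?_⟩
  have hac : LocallyAC (fun t => z.estReward t i s a - G.reward i s a) 0 :=
    LocallyAC.sub (fun T hT => hz.estReward_ac T hT i s a) (LocallyAC.const _)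
  have h1 := hac.abs_le_exp (c := 0) (by
    filter_upwards [hz.inclusion] with t h1 ht
    obtain ⟨α, b, hαb, hb, -, -, -, hr⟩ := h1 ht
    refine ⟨α s * profileProb (b s) a, ?_, ?_⟩
    · exact mul_nonneg (hα.le.trans (hαb s).1) (profileProb_nonneg (fun i => (hb s i).1) a)
    · exact ((hr i s a).sub_const (G.reward i s a)).congr_deriv (by ring)) t ht
  have h2 := hr₁ (i, s, a)
  have h3 := hr₂ (i, s, a)
  simp only [zero_mul, neg_zero, Real.exp_zero, mul_one] at h1 h2 h3
  have h4 := abs_add_le (z.estReward t i s a - G.reward i s a) (G.reward i s a)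
  rw [sub_add_cancel] at h4
  linarith

/-- If rewards are at most `R` and the continuation payoffs at most `m`, then so are the
auxiliary payoffs, up to the weights. -/
theorem abs_auxStage_le (hz : z.IsSolution G h ε αmin β) {t : ℝ} (ht : 0 ≤ t) {i : I} {R m : ℝ}
    {s : S} (hR : ∀ a, |z.estReward t i s a| ≤ R) (hm : ∀ s, |z.val t i s| ≤ m)
    (a : ∀ i, A i) : |z.auxStage G t i s a| ≤ (1 - G.disc) * R + G.disc * m :=
  abs_combination_le G.disc_mem.1.le G.disc_mem.2.le (hz.estTrans_mem t ht s a) (hR a) hm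

theorem abs_regPayoff_le (hε : 0 < ε) (hz : z.IsSolution G h ε αmin β) {H : ℝ}
    (hH : ∀ i, ∀ x ∈ mixedProfiles A, |h i x| ≤ H) {t : ℝ} (ht : 0 ≤ t) {i : I} {R m : ℝ} {s : S}
    (hR : ∀ a, |z.estReward t i s a| ≤ R) (hm : ∀ s, |z.val t i s| ≤ m)
    {x : ∀ i, A i → ℝ} (hx : x ∈ mixedProfiles A) :
    |z.regPayoff G h ε t i s x| ≤ (1 - G.disc) * R + G.disc * m + ε * H := by
  rw [regPayoff_eq]
  refine (abs_add_le _ _).trans (add_le_add ?_ ?_)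
  · exact abs_mixedExt_le (hz.abs_auxStage_le ht hR hm) hx
  · rw [abs_mul, abs_of_pos hε]
    exact mul_le_mul_of_nonneg_left (hH i x hx) hε.le

theorem val_locallyAC (hz : z.IsSolution G h ε αmin β) (i : I) (s : S) :
    LocallyAC (fun t => z.val t i s) 0 := fun T hT => hz.val_ac T hT i s

/-- Above the level at which the payoffs balance, the largest continuation payoff decreases. -/
theorem val_mul_deriv_le (hε : 0 < ε) (hz : z.IsSolution G h ε αmin β)
    (hβ : IsValueRate β) {H : ℝ} (hH : ∀ i, ∀ x ∈ mixedProfiles A, |h i x| ≤ H) {t : ℝ}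
    (ht : 0 ≤ t) {R : ℝ} (hR : ∀ i s a, |z.estReward t i s a| ≤ R) {k : I × S}
    (hl : ∀ l : I × S, |z.val t l.1 l.2| ≤ |z.val t k.1 k.2|) :
    z.val t k.1 k.2 * (β t * (z.regPayoff G h ε t k.1 k.2 (z.act t k.2) - z.val t k.1 k.2)) ≤
      -(((1 - G.disc) * |z.val t k.1 k.2| - ((1 - G.disc) * R + ε * H)) * β t *
        |z.val t k.1 k.2|) := by
  have h1 := hz.abs_regPayoff_le hε hH ht (hR k.1 k.2) (fun s => hl (k.1, s)) (hz.act_mem t ht k.2)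
  set Γ := z.regPayoff G h ε t k.1 k.2 (z.act t k.2)
  set u := z.val t k.1 k.2
  have h2 : u * Γ ≤ |u| * ((1 - G.disc) * R + G.disc * |u| + ε * H) := by
    refine (le_abs_self _).trans ?_
    rw [abs_mul]
    exact mul_le_mul_of_nonneg_left h1 (abs_nonneg _)
  have h3 : |u| * |u| = u * u := abs_mul_abs_self u
  have h4 := mul_le_mul_of_nonneg_left h2 (hβ.nonneg t ht)
  have h5 : β t * (|u| * |u|) = β t * (u * u) := by rw [h3]
  linarith

theorem val_bound (hreg : IsRegularizer h) (hε : 0 < ε) (hα : 0 < αmin) (hβ : IsValueRate β)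
    (hz : z.IsSolution G h ε αmin β) :
    ∃ M : ℝ, 0 ≤ M ∧ ∀ t ≥ 0, ∀ i s, |z.val t i s| ≤ M := by
  obtain ⟨H, hH0, hH⟩ := hreg.exists_bound
  obtain ⟨R, hR0, hR⟩ := hz.estReward_bound hα
  obtain ⟨U, hU0, hU⟩ := exists_abs_le_of_finite (fun k : I × S => z.val 0 k.1 k.2)
  have hδ1 : 0 < 1 - G.disc := sub_pos.2 G.disc_mem.2
  have hC : 0 ≤ ((1 - G.disc) * R + ε * H) / (1 - G.disc) := by positivity
  have := LocallyAC.abs_le_of_barrier (f := fun (k : I × S) t => z.val t k.1 k.2) (a := 0)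
    (K := U + ((1 - G.disc) * R + ε * H) / (1 - G.disc)) (fun k => hz.val_locallyAC k.1 k.2)
    (by positivity) (fun k => by linarith [hU k]) (by
      filter_upwards [hz.inclusion] with t h1 ht k D hD hk hl
      obtain ⟨α, b, -, -, hu, -⟩ := h1 ht
      rw [hD.unique (hu k.1 k.2)]
      refine (hz.val_mul_deriv_le hε hβ hH ht (hR t ht) hl).trans ?_
      have h2 : (1 - G.disc) * R + ε * H ≤ (1 - G.disc) * |z.val t k.1 k.2| := by
        rw [← div_le_iff₀' hδ1]
        linarith
      have h3 := mul_nonneg (mul_nonneg (sub_nonneg.2 h2) (hβ.nonneg t ht))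
        (abs_nonneg (z.val t k.1 k.2))
      linarith)
  exact ⟨_, by positivity, fun t ht i s => this t ht (i, s)⟩

/-- Uniform a priori bounds along a solution. -/
theorem exists_bounds (hreg : IsRegularizer h) (hε : 0 < ε) (hα : 0 < αmin) (hβ : IsValueRate β)
    (hz : z.IsSolution G h ε αmin β) :
    ∃ M : ℝ, 0 ≤ M ∧ ∀ t ≥ 0, ∀ i s, |z.val t i s| ≤ M ∧
      (∀ a, |z.auxStage G t i s a| ≤ M) ∧
      (∀ x ∈ mixedProfiles A, |z.regPayoff G h ε t i s x| ≤ M) := by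
  obtain ⟨H, hH0, hH⟩ := hreg.exists_bound
  obtain ⟨R, hR0, hR⟩ := hz.estReward_bound hα
  obtain ⟨U, hU0, hU⟩ := hz.val_bound hreg hε hα hβ
  have hδ0 := G.disc_mem.1
  have hδ1 : 0 < 1 - G.disc := sub_pos.2 G.disc_mem.2
  have hp : 0 ≤ (1 - G.disc) * R + G.disc * U := by positivity
  have hq : 0 ≤ ε * H := by positivity
  refine ⟨U + ((1 - G.disc) * R + G.disc * U + ε * H), by positivity,
    fun t ht i s => ⟨by linarith [hU t ht i s], fun a => ?_, fun x hx => ?_⟩⟩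
  · exact (hz.abs_auxStage_le ht (hR t ht i s) (hU t ht i) a).trans (by linarith)
  · exact (hz.abs_regPayoff_le hε hH ht (hR t ht i s) (hU t ht i) hx).trans (by linarith)

/-- Best responses along a solution stay away from the boundary of the simplex. -/
theorem exists_le_bestResponse (hreg : IsRegularizer h) (hε : 0 < ε) (hα : 0 < αmin)
    (hβ : IsValueRate β) (hz : z.IsSolution G h ε αmin β) :
    ∃ ρ > 0, ∀ t ≥ 0, ∀ i s b,
      IsBestResponse (z.regPayoff G h ε t i s) i (z.act t s) b → ∀ a, ρ ≤ b a := by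
  obtain ⟨M, -, hM⟩ := hz.exists_bounds hreg hε hα hβ
  obtain ⟨ρ, hρ, hb⟩ := hreg.exists_le_bestResponse hε M
  exact ⟨ρ, hρ, fun t ht i s b hbr =>
    hb i _ (hM t ht i s).2.1 _ (hz.act_mem t ht s) b hbr⟩

/-- Mixed actions along a solution stay away from the boundary after time `1`. -/
theorem exists_le_act (hreg : IsRegularizer h) (hε : 0 < ε) (hα : 0 < αmin)
    (hβ : IsValueRate β) (hz : z.IsSolution G h ε αmin β) :
    ∃ ρ > 0, (∀ t ≥ 1, ∀ s i a, ρ ≤ z.act t s i a) ∧ ∀ t ≥ 0, ∀ i s b,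
      IsBestResponse (z.regPayoff G h ε t i s) i (z.act t s) b → ∀ a, ρ ≤ b a := by
  obtain ⟨ρ, hρ, hb⟩ := hz.exists_le_bestResponse hreg hε hα hβ
  have hexp : Real.exp (-αmin) < 1 := by simpa using hα
  -- A weight below `ρ` is pulled at rate at least `αmin` towards a best-response weight above `ρ`,
  -- so its deficit at time `t` is at most `ρ * exp (-αmin * t)`; the constant is its complement at
  -- time `1`.
  refine ⟨ρ * (1 - Real.exp (-αmin)), mul_pos hρ (by linarith), fun t ht s i a => ?_,
    fun t ht i s b hbr a => ?_⟩
  · have hac : LocallyAC (fun t => (ρ - z.act t s i a) * Real.exp (αmin * t)) 0 :=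
      ((LocallyAC.const ρ).sub fun T hT => hz.act_ac T hT s i a).mul
        (LocallyAC.of_contDiff (by fun_prop))
    have h1 := LocallyAC.le_of_barrier (κ := Unit) (K := ρ) (fun _ => hac)
      (fun _ => by simpa using (hz.act_mem 0 le_rfl s i).1 a) (by
        filter_upwards [hz.inclusion] with t h1 ht _ D hD hlt _
        obtain ⟨α, b, hαb, hbr, -, hx, -⟩ := h1 ht
        have h2 : HasDerivAt (fun t => Real.exp (αmin * t))
            (Real.exp (αmin * t) * (αmin * 1)) t := ((hasDerivAt_id t).const_mul αmin).exp
        have h3 := ((hx s i a).const_sub ρ).fun_mul h2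
        rw [hD.unique h3]
        have h4 : 0 < ρ - z.act t s i a := by
          by_contra! hle
          have := mul_nonpos_of_nonpos_of_nonneg hle (Real.exp_pos (αmin * t)).le
          linarith
        have h5 := hb t ht i s _ (hbr s i) a
        have h6 : αmin * (ρ - z.act t s i a) ≤ α s * (b s i a - z.act t s i a) :=
          mul_le_mul (hαb s).1 (by linarith) h4.le (hα.le.trans (hαb s).1)
        have h7 := mul_nonneg (sub_nonneg.2 h6) (Real.exp_pos (αmin * t)).le
        linarith) t (by linarith) ()
    have h2 : ρ - z.act t s i a ≤ ρ * Real.exp (-(αmin * t)) := by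
      rw [Real.exp_neg, ← div_eq_mul_inv, le_div_iff₀ (Real.exp_pos _)]
      exact h1
    have h3 : Real.exp (-(αmin * t)) ≤ Real.exp (-αmin) := Real.exp_le_exp.2 (by nlinarith)
    have h4 := mul_le_mul_of_nonneg_left h3 hρ.le
    linarith
  · refine le_trans ?_ (hb t ht i s b hbr a)
    have := mul_pos hρ (Real.exp_pos (-αmin))
    linarith

/-- The estimates of the rewards and of the transitions converge exponentially fast. -/
theorem exists_exp_estimates (hreg : IsRegularizer h) (hε : 0 < ε) (hα : 0 < αmin)
    (hβ : IsValueRate β) (hz : z.IsSolution G h ε αmin β) :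
    ∃ c > 0, ∃ C : ℝ, 0 ≤ C ∧ ∀ t ≥ 0, ∀ s a,
      (∀ i, |z.estReward t i s a - G.reward i s a| ≤ C * Real.exp (-(c * t))) ∧
      (∀ s', |z.estTrans t s a s' - G.trans s a s'| ≤ C * Real.exp (-(c * t))) := by
  obtain ⟨ρ, hρ, hb⟩ := hz.exists_le_bestResponse hreg hε hα hβ
  obtain ⟨C₁, hC₁, h₁⟩ := exists_abs_le_of_finite
    (fun k : I × S × (∀ i, A i) => z.estReward 0 k.1 k.2.1 k.2.2 - G.reward k.1 k.2.1 k.2.2)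
  obtain ⟨C₂, hC₂, h₂⟩ := exists_abs_le_of_finite
    (fun k : S × (∀ i, A i) × S => z.estTrans 0 k.1 k.2.1 k.2.2 - G.trans k.1 k.2.1 k.2.2)
  -- Best responses put weight at least `ρ` on every action, hence at least `ρ ^ card I` on every
  -- pure profile: this is the exploration that makes the estimates converge.
  have hprob : ∀ᵐ t, (0 : ℝ) ≤ t → ∀ (α : S → ℝ) (b : S → ∀ i, A i → ℝ),
      (∀ s, α s ∈ Icc αmin 1) →
      (∀ s i, IsBestResponse (z.regPayoff G h ε t i s) i (z.act t s) (b s i)) →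
      ∀ s a, αmin * ρ ^ Fintype.card I ≤ α s * profileProb (b s) a := by
    refine Eventually.of_forall fun t ht α b hαb hbr s a => ?_
    refine mul_le_mul (hαb s).1 ?_ (by positivity) (hα.le.trans (hαb s).1)
    rw [profileProb, ← Finset.card_univ, ← Finset.prod_const]
    exact Finset.prod_le_prod (fun i _ => hρ.le) fun i _ => hb t ht i s _ (hbr s i) (a i)
  refine ⟨αmin * ρ ^ Fintype.card I, by positivity, C₁ + C₂, by positivity,
    fun t ht s a => ⟨fun i => ?_, fun s' => ?_⟩⟩
  · have hac : LocallyAC (fun t => z.estReward t i s a - G.reward i s a) 0 :=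
      LocallyAC.sub (fun T hT => hz.estReward_ac T hT i s a) (LocallyAC.const _)
    have h1 := hac.abs_le_exp (c := αmin * ρ ^ Fintype.card I) (by
      filter_upwards [hz.inclusion, hprob] with t h1 hp ht
      obtain ⟨α, b, hαb, hb, -, -, -, hr⟩ := h1 ht
      refine ⟨α s * profileProb (b s) a, hp ht α b hαb hb s a, ?_⟩
      exact ((hr i s a).sub_const (G.reward i s a)).congr_deriv (by ring)) t ht
    rw [sub_zero] at h1
    refine h1.trans (mul_le_mul_of_nonneg_right ?_ (Real.exp_pos _).le)
    linarith [h₁ (i, s, a)]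
  · have hac : LocallyAC (fun t => z.estTrans t s a s' - G.trans s a s') 0 :=
      LocallyAC.sub (fun T hT => hz.estTrans_ac T hT s a s') (LocallyAC.const _)
    have h1 := hac.abs_le_exp (c := αmin * ρ ^ Fintype.card I) (by
      filter_upwards [hz.inclusion, hprob] with t h1 hp ht
      obtain ⟨α, b, hαb, hb, -, -, hP, -⟩ := h1 ht
      refine ⟨α s * profileProb (b s) a, hp ht α b hαb hb s a, ?_⟩
      exact ((hP s a s').sub_const (G.trans s a s')).congr_deriv (by ring)) t ht
    rw [sub_zero] at h1
    refine h1.trans (mul_le_mul_of_nonneg_right ?_ (Real.exp_pos _).le)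
    linarith [h₂ (s, a, s')]

end IsSolution
end MBRDPath

/-! ### Current and optimal payoffs along a solution -/

namespace MBRDPath

variable {S : Type*} [Fintype S] {I : Type*} [Fintype I] [DecidableEq I]
  {A : I → Type*} [∀ i, Fintype (A i)]
  {G : StochasticGame S I A} {h : I → (∀ i, A i → ℝ) → ℝ} {ε αmin : ℝ} {β : ℝ → ℝ}
  {z : MBRDPath S I A}

/-- The estimated payoff of player `i` at the current profile. -/
def curPayoff (z : MBRDPath S I A) (G : StochasticGame S I A) (h : I → (∀ i, A i → ℝ) → ℝ)
    (ε : ℝ) (i : I) (s : S) (t : ℝ) : ℝ := z.regPayoff G h ε t i s (z.act t s)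

/-- The estimated payoff of a best response of player `i` to the current profile. -/
def optPayoff (z : MBRDPath S I A) (G : StochasticGame S I A) (h : I → (∀ i, A i → ℝ) → ℝ)
    (ε : ℝ) (i : I) (s : S) (t : ℝ) : ℝ := bestPayoff (z.regPayoff G h ε t i s) i (z.act t s)

namespace IsSolution

theorem curPayoff_le_optPayoff (hreg : IsRegularizer h) (hz : z.IsSolution G h ε αmin β) {t : ℝ}
    (ht : 0 ≤ t) (i : I) (s : S) : z.curPayoff G h ε i s t ≤ z.optPayoff G h ε i s t :=
  self_le_bestPayoff (continuousOn_regPayoff hreg t i s) i (hz.act_mem t ht s)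

theorem estTrans_locallyAC (hz : z.IsSolution G h ε αmin β) (s : S) (a : ∀ i, A i) (s' : S) :
    LocallyAC (fun t => z.estTrans t s a s') 0 := fun T hT => hz.estTrans_ac T hT s a s'

theorem estReward_locallyAC (hz : z.IsSolution G h ε αmin β) (i : I) (s : S) (a : ∀ i, A i) :
    LocallyAC (fun t => z.estReward t i s a) 0 := fun T hT => hz.estReward_ac T hT i s a

theorem act_locallyAC (hz : z.IsSolution G h ε αmin β) (s : S) (i : I) (a : A i) :
    LocallyAC (fun t => z.act t s i a) 0 := fun T hT => hz.act_ac T hT s i a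

theorem exists_lipschitz (hreg : IsRegularizer h) (hε : 0 < ε) (hα : 0 < αmin)
    (hβ : IsValueRate β) (hz : z.IsSolution G h ε αmin β) :
    ∃ L : ℝ, 0 ≤ L ∧ ∀ t ≥ 0, ∀ t' ≥ 0, ∀ s,
      (∀ i, |z.val t i s - z.val t' i s| ≤ L * |t - t'|) ∧
      (∀ a s', |z.estTrans t s a s' - z.estTrans t' s a s'| ≤ L * |t - t'|) ∧
      (∀ i a, |z.estReward t i s a - z.estReward t' i s a| ≤ L * |t - t'|) ∧
      (∀ i a, |z.act t s i a - z.act t' s i a| ≤ L * |t - t'|) := by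
  obtain ⟨M, hM0, hM⟩ := hz.exists_bounds hreg hε hα hβ
  obtain ⟨c, hc, C, hC0, hC⟩ := hz.exists_exp_estimates hreg hε hα hβ
  have hβ0 := hβ.nonneg 0 le_rfl
  have hexp : ∀ t, 0 ≤ t → C * Real.exp (-(c * t)) ≤ C := fun t ht =>
    mul_le_of_le_one_right hC0 (Real.exp_le_one_iff.2 (by nlinarith))
  have hrate : ∀ {p q : ℝ}, p ∈ Icc αmin 1 → 0 ≤ q → q ≤ 1 → |p * q| ≤ 1 := fun hp h0 h1 => by
    rw [abs_of_nonneg (mul_nonneg (hα.le.trans hp.1) h0)]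
    exact mul_le_one₀ hp.2 h0 h1
  -- Bounds on the speeds: `1` for the mixed actions, `C` for the estimates, `2 * β 0 * M` for the
  -- continuation payoffs.
  refine ⟨1 + C + β 0 * (M + M), by positivity, fun t ht t' ht' s => ⟨fun i => ?_, fun a s' => ?_,
    fun i a => ?_, fun i a => ?_⟩⟩
  · refine (hz.val_locallyAC i s).abs_sub_le ?_ ht ht'
    filter_upwards [hz.inclusion] with t h1 ht D hD
    obtain ⟨α, b, -, -, hu, -⟩ := h1 ht
    rw [hD.unique (hu i s), abs_mul, abs_of_nonneg (hβ.nonneg t ht)]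
    have h2 := (abs_sub (z.regPayoff G h ε t i s (z.act t s)) (z.val t i s)).trans
      (add_le_add ((hM t ht i s).2.2 _ (hz.act_mem t ht s)) (hM t ht i s).1)
    have := mul_le_mul (hβ.le_zero ht) h2 (abs_nonneg _) hβ0
    linarith
  · refine (hz.estTrans_locallyAC s a s').abs_sub_le ?_ ht ht'
    filter_upwards [hz.inclusion] with t h1 ht D hD
    obtain ⟨α, b, hα', hb, -, -, hP, -⟩ := h1 ht
    have hbm : b s ∈ mixedProfiles A := fun i => (hb s i).1
    rw [hD.unique (hP s a s'), abs_mul, abs_sub_comm]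
    have h3 := mul_le_mul (hrate (hα' s) (profileProb_nonneg hbm a) (profileProb_le_one hbm a))
      (((hC t ht s a).2 s').trans (hexp t ht)) (abs_nonneg _) zero_le_one
    have : 0 ≤ β 0 * (M + M) := by positivity
    linarith
  · refine (hz.estReward_locallyAC i s a).abs_sub_le ?_ ht ht'
    filter_upwards [hz.inclusion] with t h1 ht D hD
    obtain ⟨α, b, hα', hb, -, -, -, hr⟩ := h1 ht
    have hbm : b s ∈ mixedProfiles A := fun i => (hb s i).1
    rw [hD.unique (hr i s a), abs_mul, abs_sub_comm]
    have h3 := mul_le_mul (hrate (hα' s) (profileProb_nonneg hbm a) (profileProb_le_one hbm a))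
      (((hC t ht s a).1 i).trans (hexp t ht)) (abs_nonneg _) zero_le_one
    have : 0 ≤ β 0 * (M + M) := by positivity
    linarith
  · refine (hz.act_locallyAC s i a).abs_sub_le ?_ ht ht'
    filter_upwards [hz.inclusion] with t h1 ht D hD
    obtain ⟨α, b, hα', hb, -, hx, -⟩ := h1 ht
    have hbm : b s ∈ mixedProfiles A := fun i => (hb s i).1
    have hxm := hz.act_mem t ht s
    rw [hD.unique (hx s i a), abs_mul, abs_of_nonneg (hα.le.trans (hα' s).1)]
    have h2 : |b s i a - z.act t s i a| ≤ 1 := by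
      rw [abs_le]
      constructor <;> linarith [mixedProfiles_le_one hbm i a, mixedProfiles_le_one hxm i a,
        (hbm i).1 a, (hxm i).1 a]
    have h3 := mul_le_mul (hα' s).2 h2 (abs_nonneg _) zero_le_one
    have : 0 ≤ β 0 * (M + M) := by positivity
    linarith

/-- The current and optimal payoffs are Lipschitz functions of time. -/
theorem exists_lipschitz_payoff (hreg : IsRegularizer h) (hε : 0 < ε) (hα : 0 < αmin)
    (hβ : IsValueRate β) (hz : z.IsSolution G h ε αmin β) :
    ∃ L : ℝ, 0 ≤ L ∧ ∀ i s, ∀ t ≥ 1, ∀ t' ≥ 1,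
      |z.curPayoff G h ε i s t - z.curPayoff G h ε i s t'| ≤ L * |t - t'| ∧
      |z.optPayoff G h ε i s t - z.optPayoff G h ε i s t'| ≤ L * |t - t'| := by
  obtain ⟨M, hM0, hM⟩ := hz.exists_bounds hreg hε hα hβ
  obtain ⟨L, hL0, hL⟩ := hz.exists_lipschitz hreg hε hα hβ
  obtain ⟨ρ, hρ, hact, hbr⟩ := hz.exists_le_act hreg hε hα hβ
  obtain ⟨Ch, hCh0, hCh⟩ := hreg.exists_lipschitz hρ
  obtain ⟨K, hK0, hK⟩ := exists_mixedExt_sub_le A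
  have hδ0 := G.disc_mem.1.le
  have hδ1 : 0 ≤ 1 - G.disc := (sub_pos.2 G.disc_mem.2).le
  set La : ℝ := (1 - G.disc) * L + G.disc * ∑ _s : S, (L * M + L) with hLa
  have haux : ∀ t ≥ 0, ∀ t' ≥ 0, ∀ i s a,
      |z.auxStage G t i s a - z.auxStage G t' i s a| ≤ La * |t - t'| := by
    intro t ht t' ht' i s a
    have h1 : z.auxStage G t i s a - z.auxStage G t' i s a =
        (1 - G.disc) * (z.estReward t i s a - z.estReward t' i s a) +
        G.disc * ∑ s', ((z.estTrans t s a s' - z.estTrans t' s a s') * z.val t i s' +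
          z.estTrans t' s a s' * (z.val t i s' - z.val t' i s')) := by
      simp only [auxStage, sub_mul, mul_sub, Finset.sum_add_distrib, Finset.sum_sub_distrib]
      ring
    rw [h1, hLa, add_mul]
    refine (abs_add_le _ _).trans (add_le_add ?_ ?_)
    · rw [abs_mul, abs_of_nonneg hδ1, mul_assoc]
      exact mul_le_mul_of_nonneg_left ((hL t ht t' ht' s).2.2.1 i a) hδ1
    · rw [abs_mul, abs_of_nonneg hδ0, mul_assoc, Finset.sum_mul]
      refine mul_le_mul_of_nonneg_left ((Finset.abs_sum_le_sum_abs _ _).trans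
        (Finset.sum_le_sum fun s' _ => ?_)) hδ0
      refine (abs_add_le _ _).trans ?_
      rw [abs_mul, abs_mul, abs_of_nonneg ((hz.estTrans_mem t' ht' s a).1 s')]
      have h2 := mul_le_mul ((hL t ht t' ht' s).2.1 a s') (hM t ht i s').1 (abs_nonneg _)
        (by positivity)
      have h3 : z.estTrans t' s a s' ≤ 1 := by
        rw [← (hz.estTrans_mem t' ht' s a).2]
        exact Finset.single_le_sum (fun s' _ => (hz.estTrans_mem t' ht' s a).1 s')
          (Finset.mem_univ s')
      have h4 := mul_le_mul h3 ((hL t ht t' ht' s').1 i) (abs_nonneg _) zero_le_one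
      linarith
  have hLa0 : 0 ≤ La := by positivity
  have hdist : ∀ t ≥ 0, ∀ t' ≥ 0, ∀ s, dist (z.act t s) (z.act t' s) ≤
      (∑ _k : Σ i, A i, L) * |t - t'| := by
    intro t ht t' ht' s
    refine (dist_profile_le _ _).trans ?_
    rw [Finset.sum_mul]
    exact Finset.sum_le_sum fun k _ => (hL t ht t' ht' s).2.2.2 k.1 k.2
  set Lx : ℝ := ∑ _k : Σ i, A i, L with hLx
  have hLx0 : 0 ≤ Lx := Finset.sum_nonneg fun _ _ => hL0
  set Lf : ℝ := (M * K + ε * Ch) * Lx + ∑ _a : ∀ i, A i, La with hLf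
  have hLf0 : 0 ≤ Lf := by positivity
  have key : ∀ i s, ∀ t ≥ 0, ∀ t' ≥ 0, ∀ y ∈ mixedProfiles A, (∀ j a, ρ ≤ y j a) →
      ∀ y' ∈ mixedProfiles A, (∀ j a, ρ ≤ y' j a) → dist y y' ≤ Lx * |t - t'| →
      |z.regPayoff G h ε t i s y - z.regPayoff G h ε t' i s y'| ≤ Lf * |t - t'| := by
    intro i s t ht t' ht' y hy hyρ y' hy' hyρ' hd
    rw [regPayoff_eq, regPayoff_eq, add_sub_add_comm, ← mul_sub]
    have h1 := hK _ (z.auxStage G t' i s) M (hM t ht i s).2.1 y hy y' hy'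
    have h2 := mul_le_mul_of_nonneg_left (hCh i y hy hyρ y' hy' hyρ') hε.le
    have h3 : ∑ a, |z.auxStage G t i s a - z.auxStage G t' i s a| ≤
        (∑ _a : ∀ i, A i, La) * |t - t'| := by
      rw [Finset.sum_mul]
      exact Finset.sum_le_sum fun a _ => haux t ht t' ht' i s a
    have h4 := mul_le_mul_of_nonneg_left hd (show 0 ≤ M * K + ε * Ch by positivity)
    refine (abs_add_le _ _).trans ?_
    rw [abs_mul, abs_of_pos hε, hLf]
    linarith
  refine ⟨Lf, hLf0, fun i s t ht t' ht' => ⟨?_, ?_⟩⟩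
  · have h0 : (0 : ℝ) ≤ t := by linarith
    have h0' : (0 : ℝ) ≤ t' := by linarith
    exact key i s t h0 t' h0' _ (hz.act_mem t h0 s) (fun j a => hact t ht s j a) _
      (hz.act_mem t' h0' s) (fun j a => hact t' ht' s j a) (hdist t h0 t' h0' s)
  -- The best response at time `t` is a test action at time `t'`; its weights are at least `ρ`, so
  -- the Lipschitz estimate applies. Exchanging the times gives the other inequality.
  · have hone : ∀ t ≥ (1 : ℝ), ∀ t' ≥ (1 : ℝ),
        z.optPayoff G h ε i s t - z.optPayoff G h ε i s t' ≤ Lf * |t - t'| := by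
      intro t ht t' ht'
      have h0 : (0 : ℝ) ≤ t := by linarith
      have h0' : (0 : ℝ) ≤ t' := by linarith
      obtain ⟨b, hb⟩ := exists_isBestResponse (continuousOn_regPayoff hreg t i s) i
        (hz.act_mem t h0 s)
      have hbρ := hbr t h0 i s b hb
      have hmem : ∀ τ ≥ (1 : ℝ), Function.update (z.act τ s) i b ∈ mixedProfiles A ∧
          ∀ j a, ρ ≤ Function.update (z.act τ s) i b j a := fun τ hτ =>
        ⟨update_mem_mixedProfiles (hz.act_mem τ (by linarith) s) hb.1, fun j a => by
          rcases eq_or_ne j i with rfl | hj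
          · simpa using hbρ a
          · simpa [hj] using hact τ hτ s j a⟩
      have hd : dist (Function.update (z.act t s) i b) (Function.update (z.act t' s) i b) ≤
          Lx * |t - t'| := by
        refine le_trans ?_ (hdist t h0 t' h0' s)
        refine (dist_pi_le_iff dist_nonneg).2 fun j => ?_
        rcases eq_or_ne j i with rfl | hj
        · simp
        · simpa [hj] using dist_le_pi_dist (z.act t s) (z.act t' s) j
      have h1 := (abs_le.1 (key i s t h0 t' h0' _ (hmem t ht).1 (hmem t ht).2 _ (hmem t' ht').1
        (hmem t' ht').2 hd)).2
      have h2 := le_bestPayoff (continuousOn_regPayoff (z := z) (G := G) (ε := ε) hreg t' i s) (i := i)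
        (hz.act_mem t' h0' s) hb.1
      rw [optPayoff, optPayoff, hb.bestPayoff_eq]
      linarith
    rw [abs_le]
    have h1 := hone t ht t' ht'
    have h2 := hone t' ht' t ht
    rw [abs_sub_comm] at h2
    constructor <;> linarith

theorem curPayoff_locallyAC (hreg : IsRegularizer h) (hε : 0 < ε) (hα : 0 < αmin)
    (hβ : IsValueRate β) (hz : z.IsSolution G h ε αmin β) (i : I) (s : S) :
    LocallyAC (z.curPayoff G h ε i s) 1 := by
  obtain ⟨L, -, hL⟩ := hz.exists_lipschitz_payoff hreg hε hα hβ
  exact LocallyAC.of_lipschitz fun t ht t' ht' => (hL i s t ht t' ht').1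

theorem optPayoff_locallyAC (hreg : IsRegularizer h) (hε : 0 < ε) (hα : 0 < αmin)
    (hβ : IsValueRate β) (hz : z.IsSolution G h ε αmin β) (i : I) (s : S) :
    LocallyAC (z.optPayoff G h ε i s) 1 := by
  obtain ⟨L, -, hL⟩ := hz.exists_lipschitz_payoff hreg hε hα hβ
  exact LocallyAC.of_lipschitz fun t ht t' ht' => (hL i s t ht t' ht').2

/-- The differential inclusion, with the derivatives of the auxiliary payoffs up to an
exponentially small error. -/
theorem ae_inclusion (hreg : IsRegularizer h) (hε : 0 < ε) (hα : 0 < αmin)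
    (hβ : IsValueRate β) (hz : z.IsSolution G h ε αmin β) :
    ∃ c > 0, ∃ C : ℝ, 0 ≤ C ∧ ∀ᵐ t, 0 ≤ t → ∃ (α : S → ℝ) (b : S → ∀ i, A i → ℝ)
      (g' : I → S → (∀ i, A i) → ℝ),
      (∀ s, α s ∈ Icc αmin 1) ∧
      (∀ s i, IsBestResponse (z.regPayoff G h ε t i s) i (z.act t s) (b s i)) ∧
      (∀ i s, HasDerivAt (fun τ => z.val τ i s)
        (β t * (z.curPayoff G h ε i s t - z.val t i s)) t) ∧
      (∀ s, HasDerivAt (fun τ => z.act τ s) (α s • (b s - z.act t s)) t) ∧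
      (∀ i s a, HasDerivAt (fun τ => z.auxStage G τ i s a) (g' i s a) t) ∧
      (∀ i s a, |g' i s a - G.disc * ∑ s', z.estTrans t s a s' *
        (β t * (z.curPayoff G h ε i s' t - z.val t i s'))| ≤ C * Real.exp (-(c * t))) := by
  obtain ⟨M, hM0, hM⟩ := hz.exists_bounds hreg hε hα hβ
  obtain ⟨c, hc, C, hC0, hC⟩ := hz.exists_exp_estimates hreg hε hα hβ
  have hδ0 := G.disc_mem.1.le
  have hδ1 : 0 ≤ 1 - G.disc := (sub_pos.2 G.disc_mem.2).le
  refine ⟨c, hc, (1 - G.disc) * C + G.disc * ∑ _s : S, C * M, by positivity, ?_⟩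
  filter_upwards [hz.inclusion] with t h1 ht
  obtain ⟨α, b, hα', hb, hu, hx, hP, hr⟩ := h1 ht
  have hbm : ∀ s, b s ∈ mixedProfiles A := fun s i => (hb s i).1
  refine ⟨α, b, fun i s a => (1 - G.disc) *
      (α s * profileProb (b s) a * (G.reward i s a - z.estReward t i s a)) +
    G.disc * ∑ s', (α s * profileProb (b s) a * (G.trans s a s' - z.estTrans t s a s') *
      z.val t i s' + z.estTrans t s a s' * (β t * (z.curPayoff G h ε i s' t - z.val t i s'))),
    hα', hb, hu, fun s => ?_, fun i s a => ?_, fun i s a => ?_⟩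
  · exact hasDerivAt_pi.2 fun i => hasDerivAt_pi.2 fun a => hx s i a
  · exact ((hr i s a).const_mul _).add
      ((HasDerivAt.fun_sum fun s' _ => (hP s a s').fun_mul (hu i s')).const_mul _)
  · beta_reduce
    rw [Finset.sum_add_distrib, mul_add, ← add_assoc, add_sub_cancel_right]
    have hrate : |α s * profileProb (b s) a| ≤ 1 := by
      rw [abs_of_nonneg (mul_nonneg (hα.le.trans (hα' s).1) (profileProb_nonneg (hbm s) a))]
      exact mul_le_one₀ (hα' s).2 (profileProb_nonneg (hbm s) a) (profileProb_le_one (hbm s) a)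
    rw [add_mul]
    refine (abs_add_le _ _).trans (add_le_add ?_ ?_)
    · rw [abs_mul, abs_of_nonneg hδ1, mul_assoc (1 - G.disc) C]
      refine mul_le_mul_of_nonneg_left ?_ hδ1
      rw [abs_mul, abs_sub_comm (G.reward i s a)]
      have := mul_le_mul hrate ((hC t ht s a).1 i) (abs_nonneg _) zero_le_one
      linarith
    · rw [abs_mul, abs_of_nonneg hδ0, mul_assoc G.disc, Finset.sum_mul]
      refine mul_le_mul_of_nonneg_left ((Finset.abs_sum_le_sum_abs _ _).trans
        (Finset.sum_le_sum fun s' _ => ?_)) hδ0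
      rw [abs_mul, abs_mul, abs_sub_comm (G.trans s a s')]
      have h2 := mul_le_mul hrate ((hC t ht s a).2 s') (abs_nonneg _) zero_le_one
      have h3 := mul_le_mul h2 (hM t ht i s').1 (abs_nonneg _) (by positivity)
      linarith

theorem eventually_sum_act (hz : z.IsSolution G h ε αmin β) {t : ℝ} (ht : 1 ≤ t) (s : S) :
    ∀ᶠ τ in 𝓝 t, ∀ i, ∑ a, z.act τ s i a = 1 := by
  filter_upwards [lt_mem_nhds (show (0 : ℝ) < t by linarith)] with τ hτ i
  exact (hz.act_mem τ hτ.le s i).2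

/-- The derivative of the current payoff of player `i` when the payoff is concave in the action of
every player. -/
theorem curPayoff_deriv_ge (hreg : IsRegularizer h) (hε : 0 < ε)
    (hz : z.IsSolution G h ε αmin β) {t : ℝ} (ht : 1 ≤ t) {i : I} {s : S}
    (hconc : ∀ j, ConcaveOn ℝ (stdSimplex ℝ (A j))
      fun y => h i (Function.update (z.act t s) j y))
    (hpos : ∀ j a, 0 < z.act t s j a) {α : ℝ} (hα : 0 ≤ α) {b : ∀ i, A i → ℝ}
    (hb : b ∈ mixedProfiles A) {g' : (∀ i, A i) → ℝ}
    (hx : HasDerivAt (fun τ => z.act τ s) (α • (b - z.act t s)) t)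
    (hg : ∀ a, HasDerivAt (fun τ => z.auxStage G τ i s a) (g' a) t) {m : ℝ} (hm : ∀ a, m ≤ g' a)
    {D : ℝ} (hD : HasDerivAt (z.curPayoff G h ε i s) D t) :
    m + α * ∑ j, (z.regPayoff G h ε t i s (Function.update (z.act t s) j (b j)) -
      z.curPayoff G h ε i s t) ≤ D := by
  have hmem := hz.act_mem t (by linarith) s
  have hint : z.act t s ∈ interiorProfiles A := ⟨hmem, hpos⟩
  obtain ⟨L, hL⟩ := exists_hasFDerivWithinAt_regularized hreg (z.auxStage G t i s) ε i hint
  have hd := hasDerivAt_mixedExt_add hg hx (eventually_mem_interiorProfiles hx.continuousAt hint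
    (hz.eventually_sum_act ht s)) hL
  rw [hD.unique hd, map_smul, smul_eq_mul]
  refine add_le_add (le_mixedExt hm hmem) (mul_le_mul_of_nonneg_left ?_ hα)
  -- The derivative is linear, so the velocity splits by players and separate concavity suffices;
  -- joint concavity is not available.
  rw [← Finset.univ_sum_single (b - z.act t s), map_sum]
  exact Finset.sum_le_sum fun j _ => sub_le_fderiv_of_concaveOn hint hL
    (concaveOn_regularized _ hε.le (hconc j)) (hb j)

/-- The derivative of the optimal payoff of player `i` when the payoff is convex in the action of
the only opponent `j`. -/
theorem optPayoff_deriv_le (hreg : IsRegularizer h) (hε : 0 < ε)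
    (hz : z.IsSolution G h ε αmin β) {t : ℝ} (ht : 1 ≤ t) {i j : I} (hij : i ≠ j)
    (htwo : ∀ k, k = i ∨ k = j) {s : S} {b : ∀ i, A i → ℝ}
    (hconv : ConvexOn ℝ (stdSimplex ℝ (A j))
      fun y => h i (Function.update (Function.update (z.act t s) i (b i)) j y))
    (hpos : ∀ j a, 0 < z.act t s j a) (hbpos : ∀ a, 0 < b i a) {α : ℝ} (hα : 0 ≤ α)
    (hb : b ∈ mixedProfiles A)
    (hbr : IsBestResponse (z.regPayoff G h ε t i s) i (z.act t s) (b i)) {g' : (∀ i, A i) → ℝ}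
    (hx : HasDerivAt (fun τ => z.act τ s) (α • (b - z.act t s)) t)
    (hg : ∀ a, HasDerivAt (fun τ => z.auxStage G τ i s a) (g' a) t) {m : ℝ} (hm : ∀ a, g' a ≤ m)
    {D : ℝ} (hD : HasDerivAt (z.optPayoff G h ε i s) D t) :
    D ≤ m + α * (z.regPayoff G h ε t i s b - z.optPayoff G h ε i s t) := by
  have hmem := hz.act_mem t (by linarith) s
  set y := Function.update (z.act t s) i (b i) with hy
  have hymem : y ∈ mixedProfiles A := update_mem_mixedProfiles hmem (hb i)
  have hint : y ∈ interiorProfiles A := ⟨hymem, fun k a => by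
    rcases eq_or_ne k i with rfl | hk
    · simpa [hy] using hbpos a
    · simpa [hy, hk] using hpos k a⟩
  obtain ⟨L, hL⟩ := exists_hasFDerivWithinAt_regularized hreg (z.auxStage G t i s) ε i hint
  have hyj : y j = z.act t s j := by simp [hy, hij.symm]
  -- Envelope argument: with the best response frozen at time `t`, the payoff along this path lies
  -- below the optimal payoff and touches it at `t`, so the derivatives agree and only the motion of
  -- the opponent contributes.
  have hγ : HasDerivAt (fun τ => Function.update (z.act τ s) i (b i))
      (α • (Pi.single j (b j - y j) : ∀ k, A k → ℝ)) t := by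
    refine hasDerivAt_pi.2 fun k => ?_
    rcases htwo k with rfl | rfl
    · simpa [hij] using hasDerivAt_const t (b k)
    · have := hasDerivAt_pi.1 hx k
      simpa [hij.symm, hyj] using this
  have hev := eventually_mem_interiorProfiles hγ.continuousAt hint (by
    filter_upwards [hz.eventually_sum_act ht s] with τ hτ k
    rcases eq_or_ne k i with rfl | hk
    · simpa using (hb k).2
    · simpa [hk] using hτ k)
  have hd := hasDerivAt_mixedExt_add hg hγ hev hL
  have heq : D = _ := hD.unique_of_le hd (by
    filter_upwards [lt_mem_nhds (show (0 : ℝ) < t by linarith)] with τ hτ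
    exact le_bestPayoff (continuousOn_regPayoff hreg τ i s) (hz.act_mem τ hτ.le s) (hb i))
    hbr.bestPayoff_eq
  rw [heq, map_smul, smul_eq_mul]
  refine add_le_add (mixedExt_le hm hymem) (mul_le_mul_of_nonneg_left ?_ hα)
  have h1 := fderiv_le_sub_of_convexOn hint hL (convexOn_regularized _ hε.le hconv) (hb j)
  have hyb : Function.update y j (b j) = b := by
    funext k
    rcases htwo k with rfl | rfl
    · simp [hij, hy]
    · simp
  rw [hyb] at h1
  rw [optPayoff, hbr.bestPayoff_eq]
  exact h1

/-- Convergence to the set of approximate equilibria from asymptotic bounds on the gains from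
one-stage deviations and on the errors of the continuation payoffs. -/
theorem convergesToSet_regularizedEquilibria (hreg : IsRegularizer h) (hε : 0 < ε) (hα : 0 < αmin)
    (hβ : IsValueRate β) (hz : z.IsSolution G h ε αmin β) {κ₁ κ₂ κ : ℝ}
    (hopt : ∀ η > 0, ∀ᶠ t in atTop, ∀ i s, z.optPayoff G h ε i s t ≤ z.val t i s + κ₁ + η)
    (hcur : ∀ η > 0, ∀ᶠ t in atTop, ∀ i s, z.val t i s - κ₂ - η ≤ z.curPayoff G h ε i s t)
    (hκ : (κ₁ + κ₂) / (1 - G.disc) ^ 2 ≤ κ) :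
    ConvergesToSet z.act (G.regularizedEquilibria h (ε / (1 - G.disc)) κ) := by
  intro η hη
  by_contra hfreq
  rw [not_eventually] at hfreq
  obtain ⟨M, hM0, hM⟩ := hz.exists_bounds hreg hε hα hβ
  obtain ⟨c, hc, C, hC0, hC⟩ := hz.exists_exp_estimates hreg hε hα hβ
  -- Profiles and continuation payoffs are extracted jointly along times when the profile is far
  -- from the set. The estimates converge, so the asymptotic bounds pass to the true auxiliary
  -- games, and the limit profile belongs to the set, a contradiction.
  obtain ⟨T, hT, hfar⟩ := exists_seq_forall_of_frequently
    (hfreq.and_eventually (eventually_ge_atTop 0))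
  have hcompact : IsCompact ((Set.pi univ fun _ : S => mixedProfiles A) ×ˢ
      (Metric.closedBall (0 : I → S → ℝ) M)) :=
    (isCompact_univ_pi fun _ => isCompact_mixedProfiles).prod (isCompact_closedBall _ _)
  obtain ⟨⟨x, u⟩, hxu, σ, hσ, hlim⟩ := hcompact.tendsto_subseq
    (x := fun n => (z.act (T n), z.val (T n))) (fun n => ⟨fun s _ => hz.act_mem _ (hfar n).2 s, by
      rw [mem_closedBall_zero_iff]
      exact (pi_norm_le_iff_of_nonneg hM0).2 fun i => (pi_norm_le_iff_of_nonneg hM0).2 fun s =>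
        (hM _ (hfar n).2 i s).1⟩)
  have hx : ∀ s, x s ∈ mixedProfiles A := fun s => hxu.1 s (mem_univ s)
  have hTσ : Tendsto (fun n => T (σ n)) atTop atTop := hT.comp hσ.tendsto_atTop
  have hxlim : Tendsto (fun n => z.act (T (σ n))) atTop (𝓝 x) :=
    (continuous_fst.tendsto _).comp hlim
  have hulim : Tendsto (fun n => z.val (T (σ n))) atTop (𝓝 u) :=
    (continuous_snd.tendsto _).comp hlim
  have hexp : Tendsto (fun n => C * Real.exp (-(c * T (σ n)))) atTop (𝓝 0) := by
    have : Tendsto (fun n => Real.exp (-(c * T (σ n)))) atTop (𝓝 0) :=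
      Real.tendsto_exp_neg_atTop_nhds_zero.comp (hTσ.const_mul_atTop hc)
    simpa using this.const_mul C
  have hr : ∀ i s a, Tendsto (fun n => z.estReward (T (σ n)) i s a) atTop
      (𝓝 (G.reward i s a)) := fun i s a => by
    rw [tendsto_iff_dist_tendsto_zero]
    exact squeeze_zero (fun _ => dist_nonneg) (fun n => (hC _ (hfar (σ n)).2 s a).1 i) hexp
  have hP : ∀ s a s', Tendsto (fun n => z.estTrans (T (σ n)) s a s') atTop
      (𝓝 (G.trans s a s')) := fun s a s' => by
    rw [tendsto_iff_dist_tendsto_zero]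
    exact squeeze_zero (fun _ => dist_nonneg) (fun n => (hC _ (hfar (σ n)).2 s a).2 s') hexp
  have hF : ∀ i s, ∀ y : ℕ → ∀ i, A i → ℝ, (∀ n, y n ∈ mixedProfiles A) →
      ∀ y' ∈ mixedProfiles A, Tendsto y atTop (𝓝 y') →
      Tendsto (fun n => z.regPayoff G h ε (T (σ n)) i s (y n)) atTop
        (𝓝 (G.regAux h ε (u i) i s y')) := by
    intro i s y hy y' hy' hlim
    refine Tendsto.add (tendsto_finsetSum _ fun a _ => Tendsto.mul ?_ ?_) (Tendsto.const_mul _ ?_)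
    · exact ((contDiff_profileProb a).continuous.tendsto y').comp hlim
    · refine ((hr i s a).const_mul _).add (Tendsto.const_mul _ (tendsto_finsetSum _ fun s' _ =>
        (hP s a s').mul ?_))
      exact tendsto_pi_nhds.1 (tendsto_pi_nhds.1 hulim i) s'
    · exact (hreg.continuousOn i y' hy').tendsto.comp
        (tendsto_nhdsWithin_iff.2 ⟨hlim, Eventually.of_forall hy⟩)
  have hus : ∀ i s, Tendsto (fun n => z.val (T (σ n)) i s) atTop (𝓝 (u i s)) := fun i s =>
    tendsto_pi_nhds.1 (tendsto_pi_nhds.1 hulim i) s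
  have hxs : ∀ s, Tendsto (fun n => z.act (T (σ n)) s) atTop (𝓝 (x s)) := fun s =>
    tendsto_pi_nhds.1 hxlim s
  have hmem : x ∈ G.regularizedEquilibria h (ε / (1 - G.disc)) κ := by
    refine G.mem_regularizedEquilibria hreg hx (u := u) (κ₁ := κ₁) (κ₂ := κ₂) (fun i s y hy => ?_)
      (fun i s => ?_) hκ
    · refine le_of_forall_pos_le_add fun ζ hζ => ?_
      have hupd : Tendsto (fun n => Function.update (z.act (T (σ n)) s) i y) atTop
          (𝓝 (Function.update (x s) i y)) :=
        ((continuous_id.update i continuous_const).tendsto (x s)).comp (hxs s)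
      refine le_of_tendsto_of_tendsto (hF i s _ (fun n => update_mem_mixedProfiles
        (hz.act_mem _ (hfar (σ n)).2 s) hy) _ (update_mem_mixedProfiles (hx s) hy) hupd)
        (((hus i s).add_const κ₁).add_const ζ) ?_
      filter_upwards [hTσ.eventually (hopt ζ hζ)] with n hn
      exact (le_bestPayoff (continuousOn_regPayoff hreg _ i s) (hz.act_mem _ (hfar (σ n)).2 s)
        hy).trans (hn i s)
    · refine le_of_forall_pos_le_add fun ζ hζ => ?_
      rw [← sub_le_iff_le_add]
      refine le_of_tendsto_of_tendsto (((hus i s).sub_const κ₂).sub_const ζ)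
        (hF i s _ (fun n => hz.act_mem _ (hfar (σ n)).2 s) _ (hx s) (hxs s)) ?_
      filter_upwards [hTσ.eventually (hcur ζ hζ)] with n hn using hn i s
  obtain ⟨n, hn⟩ := ((Metric.tendsto_nhds.1 hxlim η hη)).exists
  exact (hfar (σ n)).1 ⟨x, hmem, hn⟩

end IsSolution
end MBRDPath

/-! ### Bounded functions of time -/

theorem MonotoneOn.exists_tendsto_atTop {f : ℝ → ℝ} {a C : ℝ} (hf : MonotoneOn f (Ici a))
    (hC : ∀ t ≥ a, f t ≤ C) : ∃ l, Tendsto f atTop (𝓝 l) := by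
  have hmono : Monotone fun t => f (max a t) := fun s t hst =>
    hf (le_max_left a s) (le_max_left a t) (max_le_max_left a hst)
  refine ⟨_, (tendsto_atTop_ciSup hmono ⟨C, ?_⟩).congr' ?_⟩
  · rintro _ ⟨t, rfl⟩
    exact hC _ (le_max_left a t)
  · filter_upwards [eventually_ge_atTop a] with t ht
    rw [max_eq_right ht]

/-- A bounded function cannot decrease forever at a nonintegrable rate. -/
theorem LocallyAC.not_deriv_le {f : ℝ → ℝ} {a c M : ℝ} {γ : ℝ → ℝ} (hf : LocallyAC f a)
    (hc : 0 < c) (hγ : ∀ t ≥ a, 0 ≤ γ t) (hint : ∀ t ≥ a, IntervalIntegrable γ volume a t)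
    (hlim : Tendsto (fun T => ∫ t in a..T, γ t) atTop atTop) (hM : ∀ t ≥ a, -M ≤ f t)
    (h : ∀ᵐ t, a ≤ t → ∀ D, HasDerivAt f D t → D ≤ -(c * γ t)) : False := by
  have h1 := LocallyAC.eventually_le (κ := Unit) (f := fun _ => f) (K := -M - 1) (fun _ => hf) hc hγ
    hint hlim (by filter_upwards [h] with t h1 hat _ D hD _ _ using h1 hat D hD)
  obtain ⟨t, h2, h3⟩ := (h1.and (eventually_ge_atTop a)).exists
  have := hM t h3
  have := h2 ()
  linarith

namespace MBRDPath

variable {S : Type*} [Fintype S] {I : Type*} [Fintype I] [DecidableEq I]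
  {A : I → Type*} [∀ i, Fintype (A i)]
  {G : StochasticGame S I A} {h : I → (∀ i, A i → ℝ) → ℝ} {ε αmin : ℝ} {β : ℝ → ℝ}
  {z : MBRDPath S I A}

namespace IsSolution

/-! ### Identical interest -/

/-- All players observe the same sampled profile, so the difference of two estimates solves a
homogeneous linear equation with zero initial value. -/
theorem estReward_eq (hα : 0 < αmin) (hz : z.IsSolution G h ε αmin β)
    (hG : G.IsIdenticalInterest) (h0 : ∀ i j, z.estReward 0 i = z.estReward 0 j) (i j : I) {t : ℝ}
    (ht : 0 ≤ t) : z.estReward t i = z.estReward t j := by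
  funext s a
  have hac : LocallyAC (fun t => z.estReward t i s a - z.estReward t j s a) 0 :=
    (hz.estReward_locallyAC i s a).sub (hz.estReward_locallyAC j s a)
  have h1 := hac.abs_le_exp (c := 0) (by
    filter_upwards [hz.inclusion] with t h1 ht
    obtain ⟨α, b, hαb, hb, -, -, -, hr⟩ := h1 ht
    refine ⟨α s * profileProb (b s) a, ?_, ?_⟩
    · exact mul_nonneg (hα.le.trans (hαb s).1) (profileProb_nonneg (fun i => (hb s i).1) a)
    · refine ((hr i s a).sub (hr j s a)).congr_deriv ?_
      rw [hG i j s a]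
      ring) t ht
  rw [h0 i j] at h1
  simp only [sub_self, abs_zero, zero_mul, abs_nonpos_iff] at h1
  exact sub_eq_zero.1 h1

/-- Barrier at level zero: where the difference of the continuation payoffs is largest, the payoffs
of the two players differ by at most `δ` times as much, so the difference cannot grow. -/
theorem val_eq (hα : 0 < αmin) (hβ : IsValueRate β) (hz : z.IsSolution G h ε αmin β)
    (hG : G.IsIdenticalInterest) (hh : ∀ i j, ∀ x ∈ mixedProfiles A, h i x = h j x)
    (h0 : ∀ i j, z.val 0 i = z.val 0 j ∧ z.estReward 0 i = z.estReward 0 j) (i j : I) {t : ℝ}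
    (ht : 0 ≤ t) : z.val t i = z.val t j := by
  have hδ0 := G.disc_mem.1.le
  have hδ1 := G.disc_mem.2.le
  have key := LocallyAC.abs_le_of_barrier (f := fun s t => z.val t i s - z.val t j s) (a := 0)
    (K := 0) (fun s => (hz.val_locallyAC i s).sub (hz.val_locallyAC j s)) le_rfl
    (fun s => by simp [(h0 i j).1]) (by
      filter_upwards [hz.inclusion] with t h1 ht s D hD _ hl
      obtain ⟨α, b, -, -, hu, -⟩ := h1 ht
      rw [hD.unique ((hu i s).sub (hu j s))]
      have hx := hz.act_mem t ht s
      have e1 : z.regPayoff G h ε t i s (z.act t s) - z.regPayoff G h ε t j s (z.act t s) =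
          mixedExt (fun a => (1 - G.disc) * 0 + G.disc * ∑ s', z.estTrans t s a s' *
            (z.val t i s' - z.val t j s')) (z.act t s) := by
        rw [regPayoff_eq, regPayoff_eq, hh i j _ hx, add_sub_add_right_eq_sub, ← mixedExt_sub]
        congr 1
        funext a
        simp only [auxStage, hz.estReward_eq hα hG (fun i j => (h0 i j).2) i j ht, mul_sub,
          Finset.sum_sub_distrib]
        ring
      have h2 := abs_mixedExt_le (fun a => abs_combination_le (r := 0) (R := 0) hδ0 hδ1
        (hz.estTrans_mem t ht s a) (by simp) hl) hx
      rw [← e1] at h2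
      set d := z.val t i s - z.val t j s
      set e := z.regPayoff G h ε t i s (z.act t s) - z.regPayoff G h ε t j s (z.act t s) with he
      have h3 : d * e ≤ d * d := by
        refine (le_abs_self _).trans ?_
        rw [abs_mul, ← abs_mul_abs_self d]
        refine mul_le_mul_of_nonneg_left (h2.trans ?_) (abs_nonneg d)
        have := mul_le_mul_of_nonneg_right hδ1 (abs_nonneg d)
        linarith
      have h4 := mul_nonneg (hβ.nonneg t ht) (sub_nonneg.2 h3)
      have h5 : d * (β t * (z.regPayoff G h ε t i s (z.act t s) - z.val t i s) -
          β t * (z.regPayoff G h ε t j s (z.act t s) - z.val t j s)) =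
          -(β t * (d * d - d * e)) := by
        simp only [d, e]
        ring
      linarith) t ht
  funext s
  exact sub_eq_zero.1 (abs_nonpos_iff.1 (key s))

theorem regPayoff_eq_of_identical (hα : 0 < αmin) (hβ : IsValueRate β)
    (hz : z.IsSolution G h ε αmin β)
    (hG : G.IsIdenticalInterest) (hh : ∀ i j, ∀ x ∈ mixedProfiles A, h i x = h j x)
    (h0 : ∀ i j, z.val 0 i = z.val 0 j ∧ z.estReward 0 i = z.estReward 0 j) (i j : I) {t : ℝ}
    (ht : 0 ≤ t) (s : S) {x : ∀ i, A i → ℝ} (hx : x ∈ mixedProfiles A) :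
    z.regPayoff G h ε t i s x = z.regPayoff G h ε t j s x := by
  have h1 : z.auxStage G t i s = z.auxStage G t j s := by
    funext a
    simp only [auxStage, hz.estReward_eq hα hG (fun i j => (h0 i j).2) i j ht,
      hz.val_eq hα hβ hG hh h0 i j ht]
  rw [regPayoff_eq, regPayoff_eq, hh i j x hx, h1]

/-- In an identical interest game, the gains from deviations and the errors of the continuation
payoffs vanish asymptotically. -/
theorem tendsto_of_identical (hreg : IsRegularizer h) (hε : 0 < ε) (hα : 0 < αmin)
    (hβ : IsValueRate β) (hz : z.IsSolution G h ε αmin β)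
    (hG : G.IsIdenticalInterest) (hh : ∀ i j, ∀ x ∈ mixedProfiles A, h i x = h j x)
    (h0 : ∀ i j, z.val 0 i = z.val 0 j ∧ z.estReward 0 i = z.estReward 0 j) (i : I) (s : S) :
    Tendsto (fun t => z.curPayoff G h ε i s t - z.val t i s) atTop (𝓝 0) ∧
    ∀ j, Tendsto (fun t => z.optPayoff G h ε j s t - z.curPayoff G h ε i s t) atTop (𝓝 0) := by
  have hδ0 := G.disc_mem.1.le
  have hδ1 : 0 < 1 - G.disc := sub_pos.2 G.disc_mem.2
  obtain ⟨M, hM0, hM⟩ := hz.exists_bounds hreg hε hα hβ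
  obtain ⟨c, hc, C, hC0, hpack⟩ := hz.ae_inclusion hreg hε hα hβ
  obtain ⟨ρ, hρ, hact, -⟩ := hz.exists_le_act hreg hε hα hβ
  obtain ⟨L, hL0, hL⟩ := hz.exists_lipschitz_payoff hreg hε hα hβ
  have hcur : ∀ j s, ∀ t ≥ 0, z.curPayoff G h ε j s t = z.curPayoff G h ε i s t :=
    fun j s t ht => hz.regPayoff_eq_of_identical hα hβ hG hh h0 j i ht s (hz.act_mem t ht s)
  -- States with positive `q` are those whose continuation payoff is about to fall; only they can
  -- drag down the common payoffs of other states.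
  set q : S → ℝ → ℝ := fun s t => z.val t i s - z.curPayoff G h ε i s t with hq
  have hvac : ∀ s, LocallyAC (fun t => z.val t i s) 1 := fun s =>
    (hz.val_locallyAC i s).mono zero_le_one
  have hcac := hz.curPayoff_locallyAC hreg hε hα hβ
  have hqac : ∀ s, LocallyAC (q s) 1 := fun s => (hvac s).sub (hcac i s)
  set p := posSup q with hp
  have hpac : LocallyAC p 1 := LocallyAC.posSup hqac
  set gap : S → ℝ → ℝ := fun s t =>
    αmin * ∑ j, (z.optPayoff G h ε j s t - z.curPayoff G h ε i s t) with hgap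
  have hdiff0 : ∀ s, ∀ t ≥ 0, ∀ j, 0 ≤ z.optPayoff G h ε j s t - z.curPayoff G h ε i s t :=
    fun s t ht j => by
      have := hz.curPayoff_le_optPayoff hreg ht j s
      rw [hcur j s t ht] at this
      linarith
  have hgap0 : ∀ s, ∀ t ≥ 0, 0 ≤ gap s t := fun s t ht =>
    mul_nonneg hα.le (Finset.sum_nonneg fun j _ => hdiff0 s t ht j)
  -- lower bound on the derivative of the current payoff
  have hder : ∀ᵐ t, 1 ≤ t →
      (∀ s, HasDerivAt (fun τ => z.val τ i s) (-(β t * q s t)) t) ∧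
      ∀ s D, HasDerivAt (z.curPayoff G h ε i s) D t →
        -(G.disc * (β t * p t)) - C * Real.exp (-(c * t)) + gap s t ≤ D := by
    filter_upwards [hpack] with t h1 ht
    have ht0 : (0 : ℝ) ≤ t := by linarith
    obtain ⟨α, b, g', hαb, hb, hu, hx, hg, hg'⟩ := h1 ht0
    refine ⟨fun s => (hu i s).congr_deriv (by simp only [hq]; ring), fun s D hD => ?_⟩
    have hxm := hz.act_mem t ht0 s
    have hm : ∀ a, -(G.disc * (β t * p t)) - C * Real.exp (-(c * t)) ≤ g' i s a := by
      intro a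
      have h2 := (abs_le.1 (hg' i s a)).1
      have h3 : -(β t * p t) ≤ ∑ s', z.estTrans t s a s' *
          (β t * (z.curPayoff G h ε i s' t - z.val t i s')) := by
        refine StochasticGame.le_sum_trans_mul (hz.estTrans_mem t ht0 s a) fun s' => ?_
        have := mul_le_mul_of_nonneg_left (le_posSup q t s') (hβ.nonneg t ht0)
        simp only [hq, hp] at this ⊢
        linarith
      have h4 := mul_le_mul_of_nonneg_left h3 hδ0
      linarith
    have h5 := hz.curPayoff_deriv_ge hreg hε ht (i := i) (s := s) (α := α s) (b := b s)
      (fun j => ((hreg.strictConcave j _ hxm).concaveOn).congr fun y hy =>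
        hh j i _ (update_mem_mixedProfiles hxm hy))
      (fun j a => hρ.trans_le (hact t ht s j a)) (hα.le.trans (hαb s).1) (fun j => (hb s j).1)
      (hx s) (hg i s) hm hD
    have h6 : ∀ j, z.regPayoff G h ε t i s (Function.update (z.act t s) j (b s j)) =
        z.optPayoff G h ε j s t := fun j => by
      rw [optPayoff, (hb s j).bestPayoff_eq]
      exact hz.regPayoff_eq_of_identical hα hβ hG hh h0 i j ht0 s
        (update_mem_mixedProfiles hxm (hb s j).1)
    simp only [h6] at h5
    have h7 : gap s t ≤ α s * ∑ j, (z.optPayoff G h ε j s t - z.curPayoff G h ε i s t) :=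
      mul_le_mul_of_nonneg_right (hαb s).1 (Finset.sum_nonneg fun j _ => hdiff0 s t ht0 j)
    linarith
  -- the positive part of the errors decreases up to an integrable term
  have hpder : ∀ᵐ t, 1 ≤ t → ∀ D, HasDerivAt p D t →
      D ≤ -((1 - G.disc) * (β t * p t)) + C * Real.exp (-(c * t)) := by
    filter_upwards [hder, posSup_hasDerivAt_cases hqac] with t h1 h2 ht D hD
    have ht0 : (0 : ℝ) ≤ t := by linarith
    obtain ⟨hu, hΓ⟩ := h1 ht
    rcases h2 ht D hD with ⟨h3, rfl⟩ | ⟨s, h3, -, -, h4⟩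
    · rw [← hp] at h3
      rw [h3]
      have := mul_nonneg hC0 (Real.exp_pos (-(c * t))).le
      linarith
    · have h5 : HasDerivAt (z.curPayoff G h ε i s) (-(β t * q s t) - D) t := by
        refine ((hu s).fun_sub h4).congr_of_eventuallyEq (Eventually.of_forall fun τ => ?_)
        simp [hq]
      have h6 := hΓ s _ h5
      rw [← hp] at h3
      rw [← h3] at h6
      have := hgap0 s t ht0
      linarith
  have hexpd : ∀ t, HasDerivAt (fun t => C / c * Real.exp (-(c * t)))
      (-(C * Real.exp (-(c * t)))) t := fun t => by
    have h1 : HasDerivAt (fun t => Real.exp (-(c * t)))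
        (Real.exp (-(c * t)) * -(c * 1)) t := ((hasDerivAt_id t).const_mul c).fun_neg.exp
    refine (h1.const_mul (C / c)).congr_deriv ?_
    field_simp
  have hexpac : LocallyAC (fun t => C / c * Real.exp (-(c * t))) 1 :=
    LocallyAC.of_contDiff (by fun_prop)
  have hexplim : Tendsto (fun t => C / c * Real.exp (-(c * t))) atTop (𝓝 0) := by
    have : Tendsto (fun t => Real.exp (-(c * t))) atTop (𝓝 0) :=
      Real.tendsto_exp_neg_atTop_nhds_zero.comp (tendsto_id.const_mul_atTop hc)
    simpa using this.const_mul (C / c)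
  have hexp0 : ∀ t, 0 ≤ C / c * Real.exp (-(c * t)) := fun t => by positivity
  -- The added exponential is the integral of the estimation error from `t` on. The result is
  -- nonnegative and decreases at least at rate `β * p`, so `ψ t` bounds the integral of `β * p`
  -- after `t` and corrects other quantities into monotone ones.
  set ψ : ℝ → ℝ := fun t => (1 - G.disc)⁻¹ * (p t + C / c * Real.exp (-(c * t))) with hψ
  have hψac : LocallyAC ψ 1 := (hpac.add hexpac).const_mul _
  have hψ0 : ∀ t, 0 ≤ ψ t := fun t =>
    mul_nonneg (inv_nonneg.2 hδ1.le) (add_nonneg (posSup_nonneg q t) (hexp0 t))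
  have hψder : ∀ᵐ t, 1 ≤ t → ∃ D, HasDerivAt ψ D t ∧ D ≤ -(β t * p t) := by
    filter_upwards [hpder, hpac.ae_hasDerivAt] with t h1 h2 ht
    refine ⟨_, ((h2 ht).fun_add (hexpd t)).const_mul _, ?_⟩
    rw [inv_mul_le_iff₀ hδ1]
    linarith [h1 ht _ (h2 ht)]
  have hψanti : AntitoneOn ψ (Ici 1) := hψac.antitoneOn (by
    filter_upwards [hψder] with t h1 ht D hD
    obtain ⟨E, hE, hle⟩ := h1 ht
    rw [hD.unique hE]
    have := mul_nonneg (hβ.nonneg t (by linarith)) (posSup_nonneg q t)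
    linarith)
  obtain ⟨lψ, hlψ⟩ : ∃ l, Tendsto ψ atTop (𝓝 l) := by
    have hneg : MonotoneOn (fun t => - ψ t) (Ici 1) := fun s hs t ht hst =>
      neg_le_neg (hψanti hs ht hst)
    obtain ⟨l, hl⟩ := hneg.exists_tendsto_atTop (C := 0) fun t _ => neg_nonpos.2 (hψ0 t)
    exact ⟨-l, by simpa using hl.neg⟩
  -- the continuation payoffs converge
  obtain ⟨lu, hlu⟩ : ∃ l, Tendsto (fun t => z.val t i s) atTop (𝓝 l) := by
    -- The continuation payoff falls at rate at most `β * p`, and `ψ` falls at least that fast.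
    have hmono : MonotoneOn (fun t => z.val t i s - ψ t) (Ici 1) :=
      ((hvac s).sub hψac).monotoneOn (by
        filter_upwards [hψder, hder] with t h1 h2 ht D hD
        obtain ⟨E, hE, hle⟩ := h1 ht
        rw [hD.unique (((h2 ht).1 s).fun_sub hE)]
        have := mul_le_mul_of_nonneg_left (le_posSup q t s) (hβ.nonneg t (by linarith))
        linarith)
    obtain ⟨l, hl⟩ := hmono.exists_tendsto_atTop (C := M) fun t ht => by
      have := (abs_le.1 (hM t (le_trans zero_le_one ht) i s).1).2
      linarith [hψ0 t]
    exact ⟨l + lψ, by simpa using hl.add hlψ⟩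
  -- the current payoffs converge, and the gains are integrable
  set Ψ : ℝ → ℝ := fun t =>
    z.curPayoff G h ε i s t - (G.disc * ψ t + C / c * Real.exp (-(c * t))) with hΨ
  have hΨac : LocallyAC Ψ 1 := (hcac i s).sub ((hψac.const_mul _).add hexpac)
  have hΨder : ∀ᵐ t, 1 ≤ t → ∀ D, HasDerivAt Ψ D t → gap s t ≤ D := by
    filter_upwards [hψder, hder, (hcac i s).ae_hasDerivAt] with t h1 h2 h3 ht D hD
    obtain ⟨E, hE, hle⟩ := h1 ht
    rw [hD.unique ((h3 ht).fun_sub ((hE.const_mul G.disc).fun_add (hexpd t)))]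
    have h4 := (h2 ht).2 s _ (h3 ht)
    have h5 := mul_le_mul_of_nonneg_left hle hδ0
    linarith
  have hΨbd : ∀ t ≥ 1, Ψ t ≤ M := fun t ht => by
    have ht0 : (0 : ℝ) ≤ t := by linarith
    have h1 := (abs_le.1 ((hM t ht0 i s).2.2 _ (hz.act_mem t ht0 s))).2
    have h2 := mul_nonneg hδ0 (hψ0 t)
    have h3 := hexp0 t
    simp only [hΨ, curPayoff]
    linarith
  obtain ⟨lΓ, hlΓ⟩ : ∃ l, Tendsto (z.curPayoff G h ε i s) atTop (𝓝 l) := by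
    have hmono : MonotoneOn Ψ (Ici 1) := hΨac.monotoneOn (by
      filter_upwards [hΨder] with t h1 ht D hD
      exact (hgap0 s t (by linarith)).trans (h1 ht D hD))
    obtain ⟨l, hl⟩ := hmono.exists_tendsto_atTop hΨbd
    refine ⟨_, (hl.add ((hlψ.const_mul G.disc).add hexplim)).congr fun t => ?_⟩
    simp [hΨ]
  -- Were the limits different, the continuation payoff would eventually move in one direction at a
  -- speed at least a constant times `β`, which is not integrable, against its boundedness.
  have heq : lΓ = lu := by
    have hsub := hlΓ.sub hlu
    rcases lt_trichotomy lΓ lu with hlt | heq | hlt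
    · exfalso
      obtain ⟨T, hT⟩ := eventually_atTop.1 ((hsub.eventually (gt_mem_nhds
        (show lΓ - lu < (lΓ - lu) / 2 by linarith))).and (eventually_ge_atTop 1))
      have hT1 := (hT T le_rfl).2
      have hT0 : (0 : ℝ) ≤ T := by linarith
      refine ((hvac s).mono hT1).not_deriv_le (c := (lu - lΓ) / 2) (γ := β) (M := M) (by linarith)
        (fun t ht => hβ.nonneg t (hT0.trans ht)) (fun t ht => hβ.intervalIntegrable hT0 ht)
        (hβ.tendsto_integral hT0) (fun t ht => (abs_le.1 (hM t (hT0.trans ht) i s).1).1) ?_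
      filter_upwards [hder] with t h1 ht D hD
      rw [hD.unique ((h1 (hT1.trans ht)).1 s)]
      have h2 := mul_le_mul_of_nonneg_right (hT t ht).1.le (hβ.nonneg t (hT0.trans ht))
      simp only [hq]
      linarith
    · exact heq
    · exfalso
      obtain ⟨T, hT⟩ := eventually_atTop.1 ((hsub.eventually (lt_mem_nhds
        (show (lΓ - lu) / 2 < lΓ - lu by linarith))).and (eventually_ge_atTop 1))
      have hT1 := (hT T le_rfl).2
      have hT0 : (0 : ℝ) ≤ T := by linarith
      refine ((hvac s).mono hT1).neg.not_deriv_le (c := (lΓ - lu) / 2) (γ := β) (M := M)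
        (by linarith) (fun t ht => hβ.nonneg t (hT0.trans ht))
        (fun t ht => hβ.intervalIntegrable hT0 ht) (hβ.tendsto_integral hT0)
        (fun t ht => neg_le_neg (abs_le.1 (hM t (hT0.trans ht) i s).1).2) ?_
      filter_upwards [hder] with t h1 ht D hD
      rw [hD.unique ((h1 (hT1.trans ht)).1 s).fun_neg]
      have h2 := mul_le_mul_of_nonneg_right (hT t ht).1.le (hβ.nonneg t (hT0.trans ht))
      simp only [hq]
      linarith
  refine ⟨by simpa [heq] using hlΓ.sub hlu, fun j => ?_⟩
  -- the gains vanish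
  have hgaplim : Tendsto (gap s) atTop (𝓝 0) := by
    refine hΨac.tendsto_zero_of_le_deriv (L := αmin * ∑ _j : I, (L + L))
      (fun t ht => hgap0 s t (by linarith)) (fun t ht t' ht' => ?_) hΨbd hΨder
    simp only [hgap]
    rw [← mul_sub, ← Finset.sum_sub_distrib, abs_mul, abs_of_pos hα, mul_assoc, Finset.sum_mul]
    refine mul_le_mul_of_nonneg_left ((Finset.abs_sum_le_sum_abs _ _).trans
      (Finset.sum_le_sum fun j _ => ?_)) hα.le
    have h1 := (hL j s t ht t' ht').2
    have h2 := (hL i s t ht t' ht').1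
    rw [abs_le] at h1 h2 ⊢
    constructor <;> linarith [h1.1, h1.2, h2.1, h2.2]
  have hbd : ∀ᶠ t in atTop, z.optPayoff G h ε j s t - z.curPayoff G h ε i s t ≤
      αmin⁻¹ * gap s t := by
    filter_upwards [eventually_ge_atTop 0] with t ht
    simp only [hgap]
    rw [inv_mul_cancel_left₀ hα.ne']
    exact Finset.single_le_sum
      (f := fun j => z.optPayoff G h ε j s t - z.curPayoff G h ε i s t)
      (fun j _ => hdiff0 s t ht j) (Finset.mem_univ j)
  refine squeeze_zero' ?_ hbd (by simpa using hgaplim.const_mul αmin⁻¹)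
  filter_upwards [eventually_ge_atTop 0] with t ht using hdiff0 s t ht j

theorem convergesToSet_of_identical (hreg : IsRegularizer h) (hε : 0 < ε) (hα : 0 < αmin)
    (hβ : IsValueRate β) (hz : z.IsSolution G h ε αmin β)
    (hG : G.IsIdenticalInterest) (hh : ∀ i j, ∀ x ∈ mixedProfiles A, h i x = h j x)
    (h0 : ∀ i j, z.val 0 i = z.val 0 j ∧ z.estReward 0 i = z.estReward 0 j) :
    ConvergesToSet z.act (G.regularizedEquilibria h (ε / (1 - G.disc)) 0) := by
  have key := fun i s => hz.tendsto_of_identical hreg hε hα hβ hG hh h0 i s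
  refine hz.convergesToSet_regularizedEquilibria hreg hε hα hβ (κ₁ := 0) (κ₂ := 0)
    (fun η hη => eventually_all.2 fun i => eventually_all.2 fun s => ?_)
    (fun η hη => eventually_all.2 fun i => eventually_all.2 fun s => ?_) (by simp)
  · filter_upwards [(key i s).1.eventually (gt_mem_nhds (half_pos hη)),
      ((key i s).2 i).eventually (gt_mem_nhds (half_pos hη))] with t h1 h2
    linarith
  · filter_upwards [(key i s).1.eventually (lt_mem_nhds (neg_lt_zero.2 hη))] with t h1
    linarith

end IsSolution
end MBRDPath

theorem eventually_mul_exp_le {c : ℝ} (hc : 0 < c) (C : ℝ) {η : ℝ} (hη : 0 < η) :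
    ∀ᶠ t in atTop, C * Real.exp (-(c * t)) ≤ η := by
  have h1 : Tendsto (fun t => Real.exp (-(c * t))) atTop (𝓝 0) :=
    Real.tendsto_exp_neg_atTop_nhds_zero.comp (tendsto_id.const_mul_atTop hc)
  have h2 : Tendsto (fun t => C * Real.exp (-(c * t))) atTop (𝓝 0) := by
    simpa using h1.const_mul C
  filter_upwards [h2.eventually (gt_mem_nhds hη)] with t ht using ht.le

theorem IsValueRate.exists_tendsto {β : ℝ → ℝ} (hβ : IsValueRate β) :
    ∃ l, 0 ≤ l ∧ Tendsto β atTop (𝓝 l) := by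
  have hneg : MonotoneOn (fun t => - β t) (Ici 0) := fun s hs t ht hst =>
    neg_le_neg (hβ.antitone hs ht hst)
  obtain ⟨l, hl⟩ := hneg.exists_tendsto_atTop (C := 0) fun t ht => neg_nonpos.2 (hβ.nonneg t ht)
  have hl' : Tendsto β atTop (𝓝 (-l)) := by simpa using hl.neg
  refine ⟨-l, ge_of_tendsto hl' ?_, hl'⟩
  filter_upwards [eventually_ge_atTop 0] with t ht using hβ.nonneg t ht

/-! ### The maxmin value of a one-shot game -/

section Maxmin

variable {I : Type*} [Fintype I] [DecidableEq I] {A : I → Type*} [∀ i, Fintype (A i)]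

/-- The payoff that player `i` can guarantee in the one-shot game with payoff `F`. -/
def maxmin (F : (∀ i, A i → ℝ) → ℝ) (i : I) : ℝ :=
  sSup ((fun y => sInf ((fun x => F (Function.update x i y)) '' mixedProfiles A)) ''
    stdSimplex ℝ (A i))

variable {F F' : (∀ i, A i → ℝ) → ℝ} {i : I} {B m : ℝ}

/-- The bound `B` and nonemptiness are there because real suprema and infima take the default value
zero on unbounded or empty sets. -/
theorem le_maxmin (hF : ∀ x ∈ mixedProfiles A, |F x| ≤ B) {y : A i → ℝ}
    (hX : (mixedProfiles A).Nonempty) (hy : y ∈ stdSimplex ℝ (A i))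
    (hm : ∀ x ∈ mixedProfiles A, m ≤ F (Function.update x i y)) : m ≤ maxmin F i := by
  have hbdd : BddAbove ((fun y => sInf ((fun x => F (Function.update x i y)) '' mixedProfiles A)) ''
      stdSimplex ℝ (A i)) := by
    refine ⟨B, ?_⟩
    rintro _ ⟨y, hy, rfl⟩
    obtain ⟨x, hx⟩ := hX
    refine (csInf_le ⟨-B, ?_⟩ (mem_image_of_mem _ hx)).trans
      (abs_le.1 (hF _ (update_mem_mixedProfiles hx hy))).2
    rintro _ ⟨x, hx, rfl⟩
    exact (abs_le.1 (hF _ (update_mem_mixedProfiles hx hy))).1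
  refine le_trans (le_csInf (hX.image _) ?_) (le_csSup hbdd ⟨y, hy, rfl⟩)
  rintro _ ⟨x, hx, rfl⟩
  exact hm x hx

theorem maxmin_le (hF : ∀ x ∈ mixedProfiles A, |F x| ≤ B) {x : ∀ i, A i → ℝ}
    (hx : x ∈ mixedProfiles A)
    (hm : ∀ y ∈ stdSimplex ℝ (A i), F (Function.update x i y) ≤ m) : maxmin F i ≤ m := by
  refine csSup_le ⟨_, x i, hx i, rfl⟩ ?_
  rintro _ ⟨y, hy, rfl⟩
  refine (csInf_le ⟨-B, ?_⟩ (mem_image_of_mem _ hx)).trans (hm y hy)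
  rintro _ ⟨x, hx, rfl⟩
  exact (abs_le.1 (hF _ (update_mem_mixedProfiles hx hy))).1

theorem maxmin_le_maxmin_add (hX : (mixedProfiles A).Nonempty)
    (hF : ∀ x ∈ mixedProfiles A, |F x| ≤ B) (hF' : ∀ x ∈ mixedProfiles A, |F' x| ≤ B)
    (h : ∀ x ∈ mixedProfiles A, F x ≤ F' x + m) : maxmin F i ≤ maxmin F' i + m := by
  obtain ⟨x₀, hx₀⟩ := hX
  refine csSup_le ⟨_, x₀ i, hx₀ i, rfl⟩ ?_
  rintro _ ⟨y, hy, rfl⟩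
  rw [← sub_le_iff_le_add]
  refine le_maxmin hF' ⟨x₀, hx₀⟩ hy fun x hx => ?_
  rw [sub_le_iff_le_add]
  refine (csInf_le ⟨-B, ?_⟩ (mem_image_of_mem _ hx)).trans (h _ (update_mem_mixedProfiles hx hy))
  rintro _ ⟨x, hx, rfl⟩
  exact (abs_le.1 (hF _ (update_mem_mixedProfiles hx hy))).1

end Maxmin

/-! ### The regularized Shapley operator -/

namespace StochasticGame

variable {S : Type*} [Fintype S] {I : Type*} [Fintype I] [DecidableEq I]
  {A : I → Type*} [∀ i, Fintype (A i)] (G : StochasticGame S I A)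
  {h : I → (∀ i, A i → ℝ) → ℝ} {ε : ℝ}

theorem regAux_sub (u u' : S → ℝ) (i : I) (s : S) (x : ∀ i, A i → ℝ) :
    G.regAux h ε u i s x - G.regAux h ε u' i s x =
      mixedExt (fun a => G.disc * ∑ s', G.trans s a s' * (u s' - u' s')) x := by
  rw [regAux, regAux, auxPayoff, auxPayoff, add_sub_add_right_eq_sub, ← mixedExt_sub]
  congr 1
  funext a
  simp only [mul_sub, Finset.sum_sub_distrib]
  ring

theorem exists_abs_regAux_le (hreg : IsRegularizer h) (u : S → ℝ) (i : I) :
    ∃ B, ∀ s, ∀ x ∈ mixedProfiles A, |G.regAux h ε u i s x| ≤ B := by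
  obtain ⟨H, hH0, hH⟩ := hreg.exists_bound
  obtain ⟨R, hR0, hR⟩ := exists_abs_le_of_finite (fun k : S × (∀ i, A i) => G.reward i k.1 k.2)
  obtain ⟨U, hU0, hU⟩ := exists_abs_le_of_finite u
  refine ⟨((1 - G.disc) * R + G.disc * U) + |ε| * H, fun s x hx =>
    (abs_add_le _ _).trans (add_le_add (abs_mixedExt_le (fun a => ?_) hx) ?_)⟩
  · exact abs_combination_le G.disc_mem.1.le G.disc_mem.2.le (G.trans_mem s a) (hR (s, a)) hU
  · rw [abs_mul]
    exact mul_le_mul_of_nonneg_left (hH i x hx) (abs_nonneg _)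

theorem regAux_le_add {u u' : S → ℝ} {m : ℝ} (hm : ∀ s, |u s - u' s| ≤ m) (i : I) (s : S)
    {x : ∀ i, A i → ℝ} (hx : x ∈ mixedProfiles A) :
    G.regAux h ε u i s x ≤ G.regAux h ε u' i s x + G.disc * m := by
  rw [← sub_le_iff_le_add', regAux_sub]
  refine mixedExt_le (fun a => mul_le_mul_of_nonneg_left ?_ G.disc_mem.1.le) hx
  exact sum_trans_mul_le (G.trans_mem s a) fun s' => (le_abs_self _).trans (hm s')

/-- The regularized maxmin operator of player `i` on continuation payoffs. -/
def maxminOperator (G : StochasticGame S I A) (h : I → (∀ i, A i → ℝ) → ℝ) (ε : ℝ) (i : I)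
    (u : S → ℝ) (s : S) : ℝ := maxmin (G.regAux h ε u i s) i

/-- Continuation payoffs enter with weight `δ` through an average, and maxmin is monotone and
commutes with adding constants. -/
theorem abs_maxminOperator_sub_le (hreg : IsRegularizer h) (hX : (mixedProfiles A).Nonempty)
    {u u' : S → ℝ} {m : ℝ} (hm : ∀ s, |u s - u' s| ≤ m) (i : I) (s : S) :
    |G.maxminOperator h ε i u s - G.maxminOperator h ε i u' s| ≤ G.disc * m := by
  obtain ⟨B, hB⟩ := G.exists_abs_regAux_le (ε := ε) hreg u i
  obtain ⟨B', hB'⟩ := G.exists_abs_regAux_le (ε := ε) hreg u' i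
  have h1 := maxmin_le_maxmin_add (i := i) hX
    (fun x hx => (hB s x hx).trans (le_max_left B B'))
    (fun x hx => (hB' s x hx).trans (le_max_right B B'))
    fun x hx => G.regAux_le_add (h := h) (ε := ε) hm i s hx
  have h2 := maxmin_le_maxmin_add (i := i) hX
    (fun x hx => (hB' s x hx).trans (le_max_right B B'))
    (fun x hx => (hB s x hx).trans (le_max_left B B'))
    fun x hx => G.regAux_le_add (h := h) (ε := ε)
      (fun s => by rw [abs_sub_comm]; exact hm s) i s hx
  rw [abs_le]
  simp only [maxminOperator]
  constructor <;> linarith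

theorem exists_fixedPoint_maxminOperator (hreg : IsRegularizer h)
    (hX : (mixedProfiles A).Nonempty) (i : I) :
    ∃ u : S → ℝ, G.maxminOperator h ε i u = u := by
  have hlip : ContractingWith ⟨G.disc, G.disc_mem.1.le⟩ (G.maxminOperator h ε i) := by
    refine ⟨by exact_mod_cast G.disc_mem.2, LipschitzWith.of_dist_le_mul fun u u' => ?_⟩
    refine (dist_pi_le_iff (mul_nonneg G.disc_mem.1.le dist_nonneg)).2 fun s => ?_
    exact G.abs_maxminOperator_sub_le hreg hX (fun s => dist_le_pi_dist u u' s) i s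
  exact ⟨_, hlip.fixedPoint_isFixedPt⟩

end StochasticGame

namespace MBRDPath

variable {S : Type*} [Fintype S] {I : Type*} [Fintype I] [DecidableEq I]
  {A : I → Type*} [∀ i, Fintype (A i)]
  {G : StochasticGame S I A} {h : I → (∀ i, A i → ℝ) → ℝ} {ε αmin : ℝ} {β : ℝ → ℝ}
  {z : MBRDPath S I A}

namespace IsSolution

/-! ### Zero-sum games -/

/-- Asymptotic bounds on the payoffs which do not depend on the solution. -/
theorem eventually_payoffs_le (hreg : IsRegularizer h) (hε : 0 < ε) (hα : 0 < αmin)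
    (hβ : IsValueRate β) (hz : z.IsSolution G h ε αmin β) {R H : ℝ} (hR0 : 0 ≤ R) (hH0 : 0 ≤ H)
    (hR : ∀ i s a, |G.reward i s a| ≤ R) (hH : ∀ i, ∀ x ∈ mixedProfiles A, |h i x| ≤ H) :
    ∀ᶠ t in atTop, ∀ i s, |z.val t i s| ≤ R + ε * H / (1 - G.disc) + 1 ∧
      |z.curPayoff G h ε i s t| ≤ R + ε * H / (1 - G.disc) + 1 := by
  have hδ0 := G.disc_mem.1
  have hδ1 : 0 < 1 - G.disc := sub_pos.2 G.disc_mem.2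
  obtain ⟨c, hc, C, hC0, hC⟩ := hz.exists_exp_estimates hreg hε hα hβ
  -- Once the reward estimates are within `1 / 2` of the truth, the level `U + 1` leaves a margin
  -- `(1 - δ) / 2` of decrease, whatever the initial data; so the final constant depends on the game
  -- only.
  obtain ⟨T, hT⟩ := eventually_atTop.1 ((eventually_mul_exp_le hc C (half_pos one_pos)).and
    (eventually_ge_atTop 0))
  have hT0 := (hT T le_rfl).2
  have hr : ∀ t ≥ T, ∀ i s a, |z.estReward t i s a| ≤ R + 1 / 2 := by
    intro t ht i s a
    have h1 := ((hC t (hT0.trans ht) s a).1 i).trans (hT t ht).1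
    have h2 := abs_add_le (z.estReward t i s a - G.reward i s a) (G.reward i s a)
    rw [sub_add_cancel] at h2
    linarith [hR i s a]
  set U : ℝ := R + ε * H / (1 - G.disc) with hU
  have hU1 : (1 - G.disc) * U = (1 - G.disc) * R + ε * H := by
    rw [hU]; field_simp
  have hU0 : 0 ≤ U := by positivity
  have hval := LocallyAC.eventually_abs_le (f := fun (k : I × S) t => z.val t k.1 k.2) (a := T)
    (K := U + 1) (c := (1 - G.disc) / 2) (γ := β)
    (fun k => (hz.val_locallyAC k.1 k.2).mono hT0) (by positivity) (by positivity)
    (fun t ht => hβ.nonneg t (hT0.trans ht)) (fun t ht => hβ.intervalIntegrable hT0 ht)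
    (hβ.tendsto_integral hT0) (by
      filter_upwards [hz.inclusion] with t h1 ht k D hD hk hl
      have ht0 : 0 ≤ t := hT0.trans ht
      obtain ⟨α, b, -, -, hu, -⟩ := h1 ht0
      rw [hD.unique (hu k.1 k.2)]
      refine (hz.val_mul_deriv_le hε hβ hH ht0 (hr t ht) hl).trans ?_
      have h2 := mul_le_mul_of_nonneg_left hk.le hδ1.le
      have h3 : (1 - G.disc) / 2 ≤ (1 - G.disc) * |z.val t k.1 k.2| -
          ((1 - G.disc) * (R + 1 / 2) + ε * H) := by linarith
      have h4 := mul_le_mul_of_nonneg_right (mul_le_mul_of_nonneg_right h3 (hβ.nonneg t ht0))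
        (abs_nonneg (z.val t k.1 k.2))
      linarith)
  filter_upwards [hval, eventually_ge_atTop T] with t h1 ht i s
  refine ⟨h1 (i, s), ?_⟩
  have ht0 : 0 ≤ t := hT0.trans ht
  have h2 := hz.abs_regPayoff_le hε hH ht0 (hr t ht i s) (fun s => h1 (i, s)) (hz.act_mem t ht0 s)
  rw [curPayoff]
  linarith

theorem abs_regPayoff_add_le (hz : z.IsSolution G h ε αmin β) {t : ℝ} (ht : 0 ≤ t) {i j : I}
    {s : S} {R m : ℝ} (hR : ∀ a, |z.estReward t i s a + z.estReward t j s a| ≤ R)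
    (hm : ∀ s, |z.val t i s + z.val t j s| ≤ m) {x : ∀ i, A i → ℝ} (hx : x ∈ mixedProfiles A)
    (hh : h i x = - h j x) :
    |z.regPayoff G h ε t i s x + z.regPayoff G h ε t j s x| ≤
      (1 - G.disc) * R + G.disc * m := by
  have e1 : z.regPayoff G h ε t i s x + z.regPayoff G h ε t j s x =
      mixedExt (fun a => (1 - G.disc) * (z.estReward t i s a + z.estReward t j s a) +
        G.disc * ∑ s', z.estTrans t s a s' * (z.val t i s' + z.val t j s')) x := by
    have e2 : ∀ a, (1 - G.disc) * (z.estReward t i s a + z.estReward t j s a) +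
        G.disc * ∑ s', z.estTrans t s a s' * (z.val t i s' + z.val t j s') =
        z.auxStage G t i s a + z.auxStage G t j s a := fun a => by
      simp only [auxStage, mul_add, Finset.sum_add_distrib]
      ring
    simp only [e2, mixedExt_add]
    rw [regPayoff_eq, regPayoff_eq, hh]
    ring
  rw [e1]
  exact abs_mixedExt_le (fun a => abs_combination_le G.disc_mem.1.le G.disc_mem.2.le
    (hz.estTrans_mem t ht s a) (hR a) hm) hx

/-- In a zero-sum game, the estimated payoffs of the players are asymptotically opposite. -/
theorem eventually_regPayoff_add_le (hreg : IsRegularizer h) (hε : 0 < ε) (hα : 0 < αmin)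
    (hβ : IsValueRate β) (hz : z.IsSolution G h ε αmin β) {i j : I}
    (hG : ∀ s a, G.reward i s a = - G.reward j s a)
    (hh : ∀ x ∈ mixedProfiles A, h i x = - h j x) {η : ℝ} (hη : 0 < η) :
    ∀ᶠ t in atTop, ∀ s, ∀ x ∈ mixedProfiles A,
      |z.regPayoff G h ε t i s x + z.regPayoff G h ε t j s x| ≤ η := by
  have hδ0 := G.disc_mem.1
  have hδ1 : 0 < 1 - G.disc := sub_pos.2 G.disc_mem.2
  obtain ⟨c, hc, C, hC0, hC⟩ := hz.exists_exp_estimates hreg hε hα hβ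
  -- An error `η / 4` for each player makes the estimated rewards opposite up to `η / 2`; the other
  -- half of `η` is the drift that brings the sum of the continuation payoffs below `η`.
  obtain ⟨T, hT⟩ := eventually_atTop.1
    ((eventually_mul_exp_le hc C (show 0 < η / 4 by positivity)).and (eventually_ge_atTop 0))
  have hT0 := (hT T le_rfl).2
  have hr : ∀ t ≥ T, ∀ s a, |z.estReward t i s a + z.estReward t j s a| ≤ η / 2 := by
    intro t ht s a
    have h1 := ((hC t (hT0.trans ht) s a).1 i).trans (hT t ht).1
    have h2 := ((hC t (hT0.trans ht) s a).1 j).trans (hT t ht).1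
    have h3 := abs_add_le (z.estReward t i s a - G.reward i s a)
      (z.estReward t j s a - G.reward j s a)
    rw [hG s a] at h1 h3
    rw [show z.estReward t i s a - -G.reward j s a + (z.estReward t j s a - G.reward j s a) =
      z.estReward t i s a + z.estReward t j s a by ring] at h3
    linarith
  have hval := LocallyAC.eventually_abs_le (f := fun (s : S) t => z.val t i s + z.val t j s)
    (a := T) (K := η) (c := (1 - G.disc) * (η / 2)) (γ := β)
    (fun s => ((hz.val_locallyAC i s).add (hz.val_locallyAC j s)).mono hT0) hη.le (by positivity)
    (fun t ht => hβ.nonneg t (hT0.trans ht)) (fun t ht => hβ.intervalIntegrable hT0 ht)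
    (hβ.tendsto_integral hT0) (by
      filter_upwards [hz.inclusion] with t h1 ht s D hD hs hl
      have ht0 : 0 ≤ t := hT0.trans ht
      obtain ⟨α, b, -, -, hu, -⟩ := h1 ht0
      rw [hD.unique ((hu i s).fun_add (hu j s))]
      have hx := hz.act_mem t ht0 s
      have h2 := hz.abs_regPayoff_add_le ht0 (hr t ht s) hl hx (hh _ hx)
      set f := z.val t i s + z.val t j s with hf
      set e := z.regPayoff G h ε t i s (z.act t s) + z.regPayoff G h ε t j s (z.act t s) with he
      have h3 : f * e ≤ |f| * ((1 - G.disc) * (η / 2) + G.disc * |f|) := by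
        refine (le_abs_self _).trans ?_
        rw [abs_mul]
        exact mul_le_mul_of_nonneg_left h2 (abs_nonneg f)
      have h4 : |f| * |f| = f * f := abs_mul_abs_self f
      have h5 : (1 - G.disc) * (η * |f|) ≤ (1 - G.disc) * (|f| * |f|) :=
        mul_le_mul_of_nonneg_left (mul_le_mul_of_nonneg_right hs.le (abs_nonneg f)) hδ1.le
      have h6 : f * e - f * f ≤ -((1 - G.disc) * (η / 2) * |f|) := by linarith
      have h7 := mul_le_mul_of_nonneg_left h6 (hβ.nonneg t ht0)
      have h8 : f * (β t * (z.regPayoff G h ε t i s (z.act t s) - z.val t i s) +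
          β t * (z.regPayoff G h ε t j s (z.act t s) - z.val t j s)) =
          β t * (f * e - f * f) := by
        rw [he, hf]
        ring
      rw [h8]
      linarith)
  filter_upwards [hval, eventually_ge_atTop T] with t h1 ht s x hx
  refine (hz.abs_regPayoff_add_le (hT0.trans ht) (hr t ht s) h1 hx (hh x hx)).trans ?_
  have := mul_pos hδ1 hη
  linarith

/-- In a zero-sum game, the total gain from deviations is asymptotically controlled by the rate of
the updates of the continuation payoffs. -/
theorem eventually_optPayoff_add_le (hreg : IsRegularizer h) (hε : 0 < ε) (hα : 0 < αmin)
    (hβ : IsValueRate β) (hz : z.IsSolution G h ε αmin β) {i j : I} (hij : i ≠ j)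
    (htwo : ∀ k, k = i ∨ k = j) (hG : ∀ s a, G.reward i s a = - G.reward j s a)
    (hh : ∀ x ∈ mixedProfiles A, h i x = - h j x) {K βbar : ℝ} (hK : 0 < K)
    (hKu : ∀ᶠ t in atTop, ∀ i s, |z.curPayoff G h ε i s t - z.val t i s| ≤ K)
    (hβbar0 : 0 ≤ βbar) (hβbar : ∀ η > 0, ∀ᶠ t in atTop, β t ≤ βbar + η) {η : ℝ} (hη : 0 < η) :
    ∀ᶠ t in atTop, ∀ s,
      z.optPayoff G h ε i s t + z.optPayoff G h ε j s t ≤ 2 * K * βbar / αmin + η := by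
  have hδ0 := G.disc_mem.1.le
  obtain ⟨c, hc, C, hC0, hpack⟩ := hz.ae_inclusion hreg hε hα hβ
  obtain ⟨ρ, hρ, hact, hbr⟩ := hz.exists_le_act hreg hε hα hβ
  -- Above the target level the pull `αmin * V` exceeds `2 * K * βbar` by `αmin * η`. The excess of
  -- `β` over `βbar`, the estimation errors (each counted for two players) and the failure of the
  -- estimated game to be zero sum cost a quarter each, leaving the speed `αmin * η / 4`.
  obtain ⟨T, hT⟩ := eventually_atTop.1 (hKu.and <|
    (hβbar (αmin * η / (8 * K)) (by positivity)).and <|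
    (eventually_mul_exp_le hc C (show 0 < αmin * η / 8 by positivity)).and <|
    (hz.eventually_regPayoff_add_le hreg hε hα hβ hG hh
      (show 0 < αmin * η / 4 by positivity)).and <| eventually_ge_atTop 1)
  have hT1 : 1 ≤ T := (hT T le_rfl).2.2.2.2
  have hac := fun i s => (hz.optPayoff_locallyAC hreg hε hα hβ i s).mono hT1
  have hh' : ∀ x ∈ mixedProfiles A, h j x = - h i x := fun x hx => by rw [hh x hx, neg_neg]
  refine LocallyAC.eventually_le (f := fun (s : S) t =>
    z.optPayoff G h ε i s t + z.optPayoff G h ε j s t) (a := T) (c := αmin * η / 4)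
    (γ := fun _ => 1) (fun s => (hac i s).add (hac j s)) (by positivity) (fun _ _ => zero_le_one)
    (fun _ _ => by simp) ?_ ?_
  · simpa [sub_eq_add_neg] using tendsto_atTop_add_const_right atTop (-T) tendsto_id
  filter_upwards [hpack, ae_all_iff.2 fun s => (hac i s).ae_hasDerivAt,
    ae_all_iff.2 fun s => (hac j s).ae_hasDerivAt] with t h1 h2 h3 ht s D hD hlt _
  obtain ⟨hKt, hβt, hexpt, hsum, ht1⟩ := hT t ht
  have ht0 : (0 : ℝ) ≤ t := by linarith
  obtain ⟨α, b, g', hαb, hb, hu, hx, hg, hg'⟩ := h1 ht0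
  have hbm : b s ∈ mixedProfiles A := fun k => (hb s k).1
  have hxm := hz.act_mem t ht0 s
  have hm : ∀ i s a, g' i s a ≤ β t * K + C * Real.exp (-(c * t)) := by
    intro i s a
    have h4 := (abs_le.1 (hg' i s a)).2
    have h5 : ∑ s', z.estTrans t s a s' *
        (β t * (z.curPayoff G h ε i s' t - z.val t i s')) ≤ β t * K :=
      StochasticGame.sum_trans_mul_le (hz.estTrans_mem t ht0 s a) fun s' =>
        mul_le_mul_of_nonneg_left ((le_abs_self _).trans (hKt i s')) (hβ.nonneg t ht0)
    have h6 := mul_le_mul_of_nonneg_left h5 hδ0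
    have h7 := mul_le_mul_of_nonneg_right G.disc_mem.2.le
      (mul_nonneg (hβ.nonneg t ht0) hK.le)
    linarith
  -- The regularizer of one player is the opposite of a function concave in the opponent's action.
  have hconv : ∀ {i j : I}, (∀ x ∈ mixedProfiles A, h i x = - h j x) →
      ConvexOn ℝ (stdSimplex ℝ (A j))
        fun y => h i (Function.update (Function.update (z.act t s) i (b s i)) j y) := by
    intro i j hh
    have hxi := update_mem_mixedProfiles hxm (hb s i).1
    exact ((hreg.strictConcave j _ hxi).concaveOn.neg).congr fun y hy =>
      (hh _ (update_mem_mixedProfiles hxi hy)).symm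
  have hpos : ∀ k a, 0 < z.act t s k a := fun k a => hρ.trans_le (hact t ht1 s k a)
  have hbpos : ∀ k a, 0 < b s k a := fun k a => hρ.trans_le (hbr t ht0 k s _ (hb s k) a)
  have hα0 : 0 ≤ α s := hα.le.trans (hαb s).1
  have hDi := hz.optPayoff_deriv_le hreg hε ht1 hij htwo (hconv hh) hpos (hbpos i) hα0 hbm
    (hb s i) (hx s) (hg i s) (hm i s) (h2 s ht)
  have hDj := hz.optPayoff_deriv_le hreg hε ht1 hij.symm (fun k => (htwo k).symm) (hconv hh') hpos
    (hbpos j) hα0 hbm (hb s j) (hx s) (hg j s) (hm j s) (h3 s ht)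
  rw [hD.unique ((h2 s ht).fun_add (h3 s ht))]
  have hsb := (abs_le.1 (hsum s _ hbm)).2
  set V := z.optPayoff G h ε i s t + z.optPayoff G h ε j s t with hV
  have e1 : 2 * K * βbar / αmin * αmin = 2 * K * βbar := by field_simp
  have hV0 : 0 ≤ V := by
    have : 0 ≤ 2 * K * βbar / αmin := by positivity
    linarith
  have h4 : α s * (αmin * η / 4) ≤ αmin * η / 4 := mul_le_of_le_one_left (by positivity) (hαb s).2
  have h5 : αmin * V ≤ α s * V := mul_le_mul_of_nonneg_right (hαb s).1 hV0
  have h6 := mul_le_mul_of_nonneg_left hlt.le hα.le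
  have h7 := mul_le_mul_of_nonneg_left hsb hα0
  have h8 : β t * K ≤ βbar * K + αmin * η / 8 := by
    have := mul_le_mul_of_nonneg_right hβt hK.le
    have e2 : αmin * η / (8 * K) * K = αmin * η / 8 := by field_simp
    linarith
  linarith

/-- The estimated payoffs are asymptotically those of the auxiliary game with the true rewards and
transitions. -/
theorem eventually_regPayoff_sub_regAux_le (hreg : IsRegularizer h) (hε : 0 < ε) (hα : 0 < αmin)
    (hβ : IsValueRate β) (hz : z.IsSolution G h ε αmin β) {η : ℝ} (hη : 0 < η) :
    ∀ᶠ t in atTop, ∀ i s, ∀ x ∈ mixedProfiles A,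
      |z.regPayoff G h ε t i s x - G.regAux h ε (z.val t i) i s x| ≤ η := by
  have hδ0 := G.disc_mem.1.le
  have hδ1 : 0 ≤ 1 - G.disc := (sub_pos.2 G.disc_mem.2).le
  obtain ⟨c, hc, C, hC0, hC⟩ := hz.exists_exp_estimates hreg hε hα hβ
  obtain ⟨M, hM0, hM⟩ := hz.exists_bounds hreg hε hα hβ
  filter_upwards [eventually_mul_exp_le hc ((1 - G.disc) * C + G.disc * ∑ _s : S, C * M) hη,
    eventually_ge_atTop 0] with t h1 ht i s x hx
  refine le_trans ?_ h1
  rw [regPayoff_eq, StochasticGame.regAux, auxPayoff, add_sub_add_right_eq_sub, ← mixedExt_sub]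
  refine abs_mixedExt_le (fun a => ?_) hx
  have e1 : z.auxStage G t i s a -
      ((1 - G.disc) * G.reward i s a + G.disc * ∑ s', G.trans s a s' * z.val t i s') =
      (1 - G.disc) * (z.estReward t i s a - G.reward i s a) +
      G.disc * ∑ s', (z.estTrans t s a s' - G.trans s a s') * z.val t i s' := by
    simp only [auxStage, sub_mul, Finset.sum_sub_distrib]
    ring
  rw [e1, add_mul]
  refine (abs_add_le _ _).trans (add_le_add ?_ ?_)
  · rw [abs_mul, abs_of_nonneg hδ1, mul_assoc]
    exact mul_le_mul_of_nonneg_left ((hC t ht s a).1 i) hδ1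
  · rw [abs_mul, abs_of_nonneg hδ0, mul_assoc, Finset.sum_mul]
    refine mul_le_mul_of_nonneg_left ((Finset.abs_sum_le_sum_abs _ _).trans
      (Finset.sum_le_sum fun s' _ => ?_)) hδ0
    rw [abs_mul]
    have := mul_le_mul ((hC t ht s a).2 s') (hM t ht i s').1 (abs_nonneg _) (by positivity)
    linarith

/-- The current payoff is close to the maxmin payoff of the auxiliary game when the total gain from
deviations is small. -/
theorem eventually_curPayoff_sub_maxminOperator_le (hreg : IsRegularizer h) (hε : 0 < ε)
    (hα : 0 < αmin) (hβ : IsValueRate β) (hz : z.IsSolution G h ε αmin β) {i j : I} (hij : i ≠ j)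
    (htwo : ∀ k, k = i ∨ k = j) (hG : ∀ s a, G.reward i s a = - G.reward j s a)
    (hh : ∀ x ∈ mixedProfiles A, h i x = - h j x) {κ : ℝ}
    (hκ : ∀ η > 0, ∀ᶠ t in atTop, ∀ s,
      z.optPayoff G h ε i s t + z.optPayoff G h ε j s t ≤ κ + η) {η : ℝ} (hη : 0 < η) :
    ∀ᶠ t in atTop, ∀ s,
      |z.curPayoff G h ε i s t - G.maxminOperator h ε i (z.val t i) s| ≤ κ + η ∧
      z.optPayoff G h ε i s t ≤ z.curPayoff G h ε i s t + κ + η := by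
  filter_upwards [hκ (η / 3) (by positivity),
    hz.eventually_regPayoff_add_le hreg hε hα hβ hG hh (show 0 < η / 3 by positivity),
    hz.eventually_regPayoff_sub_regAux_le hreg hε hα hβ (show 0 < η / 3 by positivity),
    eventually_ge_atTop 0] with t hV hsum haux ht s
  have hxm := hz.act_mem t ht s
  obtain ⟨B, hB⟩ := G.exists_abs_regAux_le (ε := ε) hreg (z.val t i) i
  have h1 := hz.curPayoff_le_optPayoff hreg ht i s
  have h2 := hz.curPayoff_le_optPayoff hreg ht j s
  have h3 := (abs_le.1 (hsum s _ hxm)).1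
  -- Against the opponent's current action player `i` gets at most the optimal payoff, and the
  -- current action of `i` guarantees about minus the optimal payoff of `j`. Maxmin and current
  -- payoff both lie between these bounds, which differ by about `κ`.
  have hup : G.maxminOperator h ε i (z.val t i) s ≤ z.optPayoff G h ε i s t + η / 3 := by
    refine maxmin_le (hB s) hxm fun y hy => ?_
    have h4 := (abs_le.1 (haux i s _ (update_mem_mixedProfiles hxm hy))).1
    have h5 := le_bestPayoff (continuousOn_regPayoff (z := z) (G := G) (ε := ε) hreg t i s) hxm hy
    simp only [optPayoff]
    linarith
  have hlo : -z.optPayoff G h ε j s t - η / 3 - η / 3 ≤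
      G.maxminOperator h ε i (z.val t i) s := by
    refine le_maxmin (hB s) ⟨_, hxm⟩ (hxm i) fun x hx => ?_
    have hmem := update_mem_mixedProfiles hx (hxm i)
    have heq : Function.update x i (z.act t s i) = Function.update (z.act t s) j (x j) := by
      funext k
      rcases htwo k with rfl | rfl
      · simp [hij]
      · simp [hij.symm]
    have h4 := (abs_le.1 (haux i s _ hmem)).2
    have h5 := (abs_le.1 (hsum s _ hmem)).1
    have h6 := le_bestPayoff (continuousOn_regPayoff (z := z) (G := G) (ε := ε) hreg t j s) hxm
      (hx j)
    rw [← heq] at h6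
    simp only [optPayoff]
    linarith
  have hVs := hV s
  simp only [curPayoff] at h1 h2 ⊢
  refine ⟨abs_le.2 ⟨?_, ?_⟩, ?_⟩ <;> linarith

/-- The continuation payoffs of a player follow the maxmin payoffs up to the asymptotic error. -/
theorem eventually_val_close (hreg : IsRegularizer h) (hβ : IsValueRate β) (hz : z.IsSolution G h ε αmin β)
    (hX : (mixedProfiles A).Nonempty) {i : I} {κ : ℝ} (hκ0 : 0 ≤ κ)
    (hκ : ∀ η > 0, ∀ᶠ t in atTop, ∀ s,
      |z.curPayoff G h ε i s t - G.maxminOperator h ε i (z.val t i) s| ≤ κ + η) {η : ℝ}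
    (hη : 0 < η) : ∀ᶠ t in atTop, ∀ s,
      |z.curPayoff G h ε i s t - z.val t i s| ≤ 3 * κ / (1 - G.disc) + η := by
  have hδ0 := G.disc_mem.1.le
  have hδ1 : 0 < 1 - G.disc := sub_pos.2 G.disc_mem.2
  obtain ⟨v, hv⟩ := G.exists_fixedPoint_maxminOperator (ε := ε) hreg hX i
  set ζ : ℝ := η / 4 with hζ
  have hζ0 : 0 < ζ := by positivity
  obtain ⟨T, hT⟩ := eventually_atTop.1 ((hκ ((1 - G.disc) * ζ / 2) (by positivity)).and
    (eventually_ge_atTop 0))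
  have hT0 := (hT T le_rfl).2
  -- In the state farthest from the fixed point `v`, the current payoff is within about `κ + δ|u -
  -- v|` of `v`, so the distance shrinks as long as it exceeds `κ / (1 - δ)`.
  have hval := LocallyAC.eventually_abs_le (f := fun (s : S) t => z.val t i s - v s) (a := T)
    (K := κ / (1 - G.disc) + ζ) (c := (1 - G.disc) * ζ / 2) (γ := β)
    (fun s => ((hz.val_locallyAC i s).mono hT0).sub (LocallyAC.const _))
    (by positivity) (by positivity)
    (fun t ht => hβ.nonneg t (hT0.trans ht)) (fun t ht => hβ.intervalIntegrable hT0 ht)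
    (hβ.tendsto_integral hT0) (by
      filter_upwards [hz.inclusion] with t h1 ht s D hD hs hl
      have ht0 : 0 ≤ t := hT0.trans ht
      obtain ⟨α, b, -, -, hu, -⟩ := h1 ht0
      rw [hD.unique ((hu i s).sub_const (v s))]
      have h2 := (hT t ht).1 s
      have h3 := G.abs_maxminOperator_sub_le (ε := ε) hreg hX hl i s
      rw [hv] at h3
      set f := z.val t i s - v s with hf
      set Γ := z.regPayoff G h ε t i s (z.act t s) with hΓ
      have h4 : |Γ - v s| ≤ κ + (1 - G.disc) * ζ / 2 + G.disc * |f| := by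
        have h5 := abs_add_le (Γ - G.maxminOperator h ε i (z.val t i) s)
          (G.maxminOperator h ε i (z.val t i) s - v s)
        rw [sub_add_sub_cancel] at h5
        simp only [curPayoff, ← hΓ] at h2
        linarith
      have h5 : f * (Γ - v s) ≤ |f| * (κ + (1 - G.disc) * ζ / 2 + G.disc * |f|) := by
        refine (le_abs_self _).trans ?_
        rw [abs_mul]
        exact mul_le_mul_of_nonneg_left h4 (abs_nonneg f)
      have h6 : |f| * |f| = f * f := abs_mul_abs_self f
      have h7 : κ + (1 - G.disc) * ζ ≤ (1 - G.disc) * |f| := by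
        have h8 := mul_le_mul_of_nonneg_left hs.le hδ1.le
        rw [mul_add, mul_div_cancel₀ _ hδ1.ne'] at h8
        exact h8
      have h8 := mul_le_mul_of_nonneg_left h7 (abs_nonneg f)
      have h9 : f * (Γ - v s) - f * f ≤ -((1 - G.disc) * ζ / 2 * |f|) := by linarith
      have h10 := mul_le_mul_of_nonneg_left h9 (hβ.nonneg t ht0)
      have h11 : f * (β t * (Γ - z.val t i s)) = β t * (f * (Γ - v s) - f * f) := by
        rw [hf]; ring
      rw [h11]
      linarith)
  -- From current payoff to maxmin, from maxmin to `v`, from `v` to the continuation payoff: each of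
  -- the three distances is at most `κ / (1 - δ) + ζ`.
  filter_upwards [hval, hκ ζ hζ0] with t h1 h2 s
  have h3 := G.abs_maxminOperator_sub_le (ε := ε) hreg hX h1 i s
  rw [hv] at h3
  have h4 := h1 s
  have h5 := h2 s
  have h6 : G.disc * (κ / (1 - G.disc) + ζ) ≤ κ / (1 - G.disc) + ζ :=
    mul_le_of_le_one_left (by positivity) G.disc_mem.2.le
  have h7 : κ ≤ κ / (1 - G.disc) := le_div_self hκ0 hδ1 (by linarith)
  have e1 : 3 * κ / (1 - G.disc) = 3 * (κ / (1 - G.disc)) := mul_div_assoc _ _ _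
  rw [e1]
  rw [abs_le] at h3 h4 h5 ⊢
  constructor <;> linarith [h3.1, h3.2, h4.1, h4.2, h5.1, h5.2]

theorem convergesToSet_of_zeroSum (hreg : IsRegularizer h) (hε : 0 < ε) (hα : 0 < αmin)
    (hβ : IsValueRate β) (hz : z.IsSolution G h ε αmin β) (hG : G.IsZeroSum)
    (hh : ∀ i j, i ≠ j → ∀ x ∈ mixedProfiles A, h i x = - h j x) {R H : ℝ} (hR0 : 0 ≤ R)
    (hH0 : 0 ≤ H) (hR : ∀ i s a, |G.reward i s a| ≤ R)
    (hH : ∀ i, ∀ x ∈ mixedProfiles A, |h i x| ≤ H) {βbar : ℝ} (hβbar : limsup β atTop ≤ βbar) :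
    ConvergesToSet z.act (G.regularizedEquilibria h (ε / (1 - G.disc))
      (28 * (R + ε * H / (1 - G.disc) + 1) / (1 - G.disc) ^ 3 / αmin * βbar)) := by
  have hδ0 := G.disc_mem.1.le
  have hδ1 : 0 < 1 - G.disc := sub_pos.2 G.disc_mem.2
  set U : ℝ := R + ε * H / (1 - G.disc) + 1 with hU
  have hU0 : 0 < U := by positivity
  obtain ⟨l, hl0, hl⟩ := hβ.exists_tendsto
  -- `β` is nonincreasing and nonnegative, so its upper limit is a limit.
  rw [hl.limsup_eq] at hβbar
  have hβbar0 : 0 ≤ βbar := hl0.trans hβbar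
  have hβev : ∀ η > 0, ∀ᶠ t in atTop, β t ≤ βbar + η := fun η hη => by
    filter_upwards [hl.eventually (gt_mem_nhds (show l < βbar + η by linarith))] with t ht
      using ht.le
  set κ : ℝ := 2 * (2 * U) * βbar / αmin with hκ
  have hκ0 : 0 ≤ κ := by positivity
  have hKu : ∀ᶠ t in atTop, ∀ i s, |z.curPayoff G h ε i s t - z.val t i s| ≤ 2 * U := by
    filter_upwards [hz.eventually_payoffs_le hreg hε hα hβ hR0 hH0 hR hH] with t ht i s
    have := (abs_sub (z.curPayoff G h ε i s t) (z.val t i s)).trans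
      (add_le_add (ht i s).2 (ht i s).1)
    linarith
  have key : ∀ i s, ∀ η > 0, ∀ᶠ t in atTop,
      |z.curPayoff G h ε i s t - z.val t i s| ≤ 3 * κ / (1 - G.disc) + η ∧
      z.optPayoff G h ε i s t ≤ z.curPayoff G h ε i s t + κ + η := by
    intro i s η hη
    obtain ⟨j, hij, htwo⟩ : ∃ j, i ≠ j ∧ ∀ k, k = i ∨ k = j := by
      obtain ⟨p, q, hpq, huniv⟩ := Finset.card_eq_two.1 (Finset.card_univ.trans hG.1)
      have hmem : ∀ k, k = p ∨ k = q := fun k => by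
        have := Finset.mem_univ k
        rwa [huniv, Finset.mem_insert, Finset.mem_singleton] at this
      rcases hmem i with rfl | rfl
      · exact ⟨q, hpq, hmem⟩
      · exact ⟨p, hpq.symm, fun k => (hmem k).symm⟩
    have hV := fun η (hη : 0 < η) => hz.eventually_optPayoff_add_le hreg hε hα hβ hij htwo
      (fun s a => hG.2 i j hij s a) (hh i j hij) (K := 2 * U) (by positivity) hKu hβbar0 hβev hη
    have hT := fun η (hη : 0 < η) => hz.eventually_curPayoff_sub_maxminOperator_le hreg hε hα hβ
      hij htwo (fun s a => hG.2 i j hij s a) (hh i j hij) hV hη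
    have hX : (mixedProfiles A).Nonempty := ⟨_, hz.act_mem 0 le_rfl s⟩
    have hclose := hz.eventually_val_close hreg hβ hX hκ0
      (fun η hη => (hT η hη).mono fun t ht s => (ht s).1) hη
    filter_upwards [hclose, hT η hη] with t h1 h2 using ⟨h1 s, (h2 s).2⟩
  -- A best response gains at most `κ` over the current payoff, itself within `3κ / (1 - δ)` of the
  -- continuation payoff. The errors add up to `7κ / (1 - δ)`, and `κ = 4 * U * βbar / αmin` yields
  -- the factor `28`.
  refine hz.convergesToSet_regularizedEquilibria hreg hε hα hβ (κ₁ := 4 * κ / (1 - G.disc))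
    (κ₂ := 3 * κ / (1 - G.disc))
    (fun η hη => eventually_all.2 fun i => eventually_all.2 fun s => ?_)
    (fun η hη => eventually_all.2 fun i => eventually_all.2 fun s => ?_) (le_of_eq ?_)
  · filter_upwards [key i s (η / 2) (half_pos hη)] with t ht
    have h1 := (abs_le.1 ht.1).2
    have h2 : κ ≤ κ / (1 - G.disc) := le_div_self hκ0 hδ1 (by linarith)
    rw [mul_div_assoc] at h1 ⊢
    linarith [ht.2]
  · filter_upwards [key i s η hη] with t ht
    have h1 := (abs_le.1 ht.1).1
    linarith
  · rw [hκ]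
    field_simp
    ring

end IsSolution
end MBRDPath

end

/-! ### The theorem -/

theorem theorem3 {S : Type*} [Fintype S] {I : Type*} [Fintype I] [DecidableEq I]
    {A : I → Type*} [∀ i, Fintype (A i)] (G : StochasticGame S I A)
    (h : I → (∀ i, A i → ℝ) → ℝ) (hreg : IsRegularizer h)
    (ε : ℝ) (hε : 0 < ε) :
    (G.IsIdenticalInterest → (∀ i j, ∀ x ∈ mixedProfiles A, h i x = h j x) →
      ∀ αmin : ℝ, 0 < αmin → ∀ β : ℝ → ℝ, IsValueRate β →
        ∀ z : MBRDPath S I A, z.IsSolution G h ε αmin β →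
          (∀ i j, z.val 0 i = z.val 0 j ∧ z.estReward 0 i = z.estReward 0 j) →
            ConvergesToSet z.act (G.regularizedEquilibria h (ε / (1 - G.disc)) 0)) ∧
    (G.IsZeroSum → (∀ i j, i ≠ j → ∀ x ∈ mixedProfiles A, h i x = - h j x) →
      ∃ D : ℝ, 0 < D ∧
        ∀ αmin : ℝ, 0 < αmin → ∀ β : ℝ → ℝ, IsValueRate β →
          ∀ z : MBRDPath S I A, z.IsSolution G h ε αmin β →
            (∀ βbar : ℝ, limsup β atTop ≤ βbar →
              ConvergesToSet z.act
                (G.regularizedEquilibria h (ε / (1 - G.disc)) (D / αmin * βbar))) ∧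
            (Tendsto β atTop (𝓝 0) →
              ConvergesToSet z.act (G.regularizedEquilibria h (ε / (1 - G.disc)) 0))) := by
  refine ⟨fun hG hh αmin hα β hβ z hz h0 => hz.convergesToSet_of_identical hreg hε hα hβ hG hh h0,
    fun hG hh => ?_⟩
  obtain ⟨H, hH0, hH⟩ := hreg.exists_bound
  obtain ⟨R, hR0, hR⟩ := exists_abs_le_of_finite
    (fun k : I × S × (∀ i, A i) => G.reward k.1 k.2.1 k.2.2)
  have hδ1 : 0 < 1 - G.disc := sub_pos.2 G.disc_mem.2
  have key := fun (αmin : ℝ) (hα : 0 < αmin) (β : ℝ → ℝ) (hβ : IsValueRate β)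
      (z : MBRDPath S I A) (hz : z.IsSolution G h ε αmin β) (βbar : ℝ)
      (hβbar : limsup β atTop ≤ βbar) =>
    hz.convergesToSet_of_zeroSum hreg hε hα hβ hG hh hR0 hH0 (fun i s a => hR (i, s, a)) hH hβbar
  -- `R` and `H` bound the rewards and the regularizers, so `D` is fixed before the rates and the
  -- solution. A vanishing `β` is the case `βbar = 0`.
  refine ⟨28 * (R + ε * H / (1 - G.disc) + 1) / (1 - G.disc) ^ 3, by positivity,
    fun αmin hα β hβ z hz => ⟨key αmin hα β hβ z hz, fun h0 => ?_⟩⟩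
  simpa using key αmin hα β hβ z hz 0 h0.limsup_eq.le
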